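/- Let $n\ge 2$ and $a>0$. Let $\mathrm{Nil}(2n+1)=\mathbb R^{n}\times\mathbb R^{n}\times\mathbb R$ be the Heisenberg group in exponential coordinates $(x,y,z)$, with the left-invariant metric $\hat g=\sum_i(dx_i^2+dy_i^2)+\bigl(dz-\tfrac12\sum_i(x_i\,dy_i-y_i\,dx_i)\bigr)^2$, for which the vector fields $X_i=\partial_{x_i}-\tfrac12y_i\partial_z$, $Y_i=\partial_{y_i}+\tfrac12x_i\partial_z$, $Z=\partial_z$ form an orthonormal frame. The Cauchy problem $$f(4+f^2)f_{tt}=4(2n-1)(1+f_t^2)+(2n-2)f^2f_t^2,\qquad f(0)=a,\quad f_t(0)=0,\quad f>0,$$ has a maximal solution $f=f(a,\cdot)$, and it is defined on a bounded symmetric interval $(-T(a),T(a))$, $0<T(a)<\infty$. Put $F(t,\theta)=(f(t)\theta,t)$ for $\theta\in S^{2n-1}\subset\mathbb R^{2n}$, and let $\mathcal C_a=F\bigl((-T(a),T(a))\times S^{2n-1}\bigr)$ be the corresponding rotational catenoid (minimal hypersurface of revolution) with the induced metric and a unit normal $N$. For $-T(a)\le r<s\le T(a)$ put $\mathcal D_a(r,s)=F\bigl((r,s)\times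 S^{2n-1}\bigr)$, and let $\mathcal C_{a,+}=\mathcal D_a(0,T(a))$, $\mathcal C_{a,-}=\mathcal D_a(-T(a),0)$ be the half-catenoids. Let $J=-\Delta-(|A|^2+\widehat{\mathrm{Ric}}(N,N))$ be the Jacobi operator of $\mathcal C_a$. For a relatively compact domain $\Omega$ of $\mathcal C_a$ let $\lambda_1(\Omega)$ be the least eigenvalue of $J$ in $\Omega$ with Dirichlet boundary conditions (the infimum of $\int(|\nabla u|^2-(|A|^2+\widehat{\mathrm{Ric}}(N,N))u^2)/\int u^2$ over $0\ne u\in C_c^\infty(\Omega)$), and let $\mathrm{Ind}(\Omega)$ be the number of its negative eigenvalues, counted with multiplicity. The domain $\Omega$ is stable if $\lambda_1(\Omega)>0$ and stable-unstable if $\lambda_1(\Omega)=0$. A domain of $\mathcal C_a$, not necessarily relatively compact, is r-stable if all its subdomains that are relatively compact in $\mathcal C_a$ are stable. The index of $\mathcal C_a$ is the supremum of $\mathrm{Ind}(\Omega)$ over all relatively compact $\Omega$. Then: (i) The half-catenoids $\mathcal C_{a,+}$ and $\mathcal C_{a,-}$ are r-stable. (ii) There exists $z(a)\in(0,T(a))$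 such that $\mathcal D_a(-z(a),z(a))$ is stable-unstable. Moreover, $\mathcal C_a$ has index at least $1$. (iii) There exists $\ell(a)\in(0,T(a))$ such that $\mathcal D_a(-\ell(a),T(a))$, which properly contains $\mathcal C_{a,+}$, is r-stable; and (iv) with the same $\ell(a)$, for every $r\in(\ell(a),T(a))$ there exists $s\in(0,T(a))$ such that $\mathcal D_a(-r,s)$ is stable-unstable. -/

import Mathlib

open Set MeasureTheory
open scoped ContDiff

noncomputable section

namespace NilCatenoid

/-! ## The Riemannian manifold `Nil(2n+1)` -/

/-- The Euclidean space `ℝ^{2n}`; a vector `w` has the coordinates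
`x_i = w (Sum.inl i)` and `y_i = w (Sum.inr i)`. -/
abbrev Hor (n : ℕ) : Type := EuclideanSpace ℝ (Fin n ⊕ Fin n)

/-- `Nil(2n+1)` in exponential coordinates `((x, y), z)`; tangent vectors at any point are
identified with elements of the same vector space. -/
abbrev Nil (n : ℕ) : Type := Hor n × ℝ

/-- The left-invariant one-form `dz - ½ ∑ (x_i dy_i - y_i dx_i)`. -/
def contactForm {n : ℕ} (p v : Nil n) : ℝ :=
  v.2 - (1 / 2) * ∑ i : Fin n,
    (p.1 (Sum.inl i) * v.1 (Sum.inr i) - p.1 (Sum.inr i) * v.1 (Sum.inl i))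

/-- The left-invariant metric
`ĝ = ∑ (dx_i² + dy_i²) + (dz - ½ ∑ (x_i dy_i - y_i dx_i))²` at the point `p`. -/
def metric {n : ℕ} (p v w : Nil n) : ℝ :=
  inner ℝ v.1 w.1 + contactForm p v * contactForm p w

/-- The left-invariant frame
`X_i = ∂_{x_i} - ½ y_i ∂_z`, `Y_i = ∂_{y_i} + ½ x_i ∂_z`, `Z = ∂_z`. -/
def frame {n : ℕ} : (Fin n ⊕ Fin n) ⊕ Unit → Nil n → Nil n
  | Sum.inl (Sum.inl i), p =>
      (EuclideanSpace.single (Sum.inl i) (1 : ℝ), -(1 / 2) * p.1 (Sum.inr i))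
  | Sum.inl (Sum.inr i), p =>
      (EuclideanSpace.single (Sum.inr i) (1 : ℝ), (1 / 2) * p.1 (Sum.inl i))
  | Sum.inr _, _ => (0, 1)

/-- The frame is orthonormal, so that the traces below may be computed in it. -/
theorem metric_frame {n : ℕ} (p : Nil n) (j k : (Fin n ⊕ Fin n) ⊕ Unit) :
    metric p (frame j p) (frame k p) = if j = k then 1 else 0 := by
  rcases j with (i | i) | i <;> rcases k with (l | l) | l <;>
    simp [metric, frame, contactForm, EuclideanSpace.inner_single_left, eq_comm]

/-- The Christoffel bilinear map `Γ_p` of the Levi-Civita connection in the coordinates: for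
constant vector fields `v`, `w`, `e` it satisfies the Koszul formula
`2 ĝ(Γ(v, w), e) = v ĝ(w, e) + w ĝ(v, e) - e ĝ(v, w)`. -/
def christoffel {n : ℕ} (p v w : Nil n) : Nil n :=
  ∑ k, ((1 / 2 : ℝ) *
    (fderiv ℝ (fun q => metric q w (frame k p)) p v
      + fderiv ℝ (fun q => metric q v (frame k p)) p w
      - fderiv ℝ (fun q => metric q v w) p (frame k p))) • frame k p

/-- The Levi-Civita covariant derivative `D_v Y` at `p` of a vector field `Y`. -/
def covDeriv {n : ℕ} (p v : Nil n) (Y : Nil n → Nil n) : Nil n :=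
  fderiv ℝ Y p v + christoffel p v (Y p)

/-- The curvature tensor `R(u, v) w = D_u D_v w - D_v D_u w`, where `u`, `v`, `w` are extended
to constant (hence commuting) vector fields. -/
def curvature {n : ℕ} (p u v w : Nil n) : Nil n :=
  covDeriv p u (fun q => christoffel q v w) - covDeriv p v (fun q => christoffel q u w)

/-- The Ricci tensor: `Ric(v, w)` is the trace of `u ↦ R(u, v) w`. -/
def ricci {n : ℕ} (p v w : Nil n) : ℝ :=
  ∑ k, metric p (curvature p (frame k p) v w) (frame k p)

/-! ## The catenoids -/

/-- `f` is a positive solution on the open interval `I ∋ 0` of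
`f (4 + f²) f'' = 4 (2n - 1) (1 + f'²) + (2n - 2) f² f'²`, `f(0) = a`, `f'(0) = 0`. -/
structure IsProfile (n : ℕ) (a : ℝ) (I : Set ℝ) (f : ℝ → ℝ) : Prop where
  isOpen : IsOpen I
  ordConnected : I.OrdConnected
  zero_mem : (0 : ℝ) ∈ I
  contDiffOn : ContDiffOn ℝ 2 f I
  pos : ∀ t ∈ I, 0 < f t
  ode : ∀ t ∈ I, f t * (4 + f t ^ 2) * deriv (deriv f) t =
    4 * (2 * (n : ℝ) - 1) * (1 + deriv f t ^ 2)
      + (2 * (n : ℝ) - 2) * f t ^ 2 * deriv f t ^ 2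
  value_zero : f 0 = a
  deriv_zero : deriv f 0 = 0

/-- `f` on `I` is the maximal solution of the Cauchy problem. -/
def IsMaximalProfile (n : ℕ) (a : ℝ) (I : Set ℝ) (f : ℝ → ℝ) : Prop :=
  IsProfile n a I f ∧ ∀ (J : Set ℝ) (g : ℝ → ℝ), IsProfile n a J g → J ⊆ I

/-- The unit sphere `S^{2n-1}` of `ℝ^{2n}`. -/
abbrev Sph (n : ℕ) : Type := Metric.sphere (0 : Hor n) 1

/-- The parametrization `F(t, θ) = (f(t) θ, t)` of the hypersurface of revolution. -/
def revol {n : ℕ} (f : ℝ → ℝ) (q : ℝ × Sph n) : Nil n :=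
  (f q.1 • (q.2 : Hor n), q.1)

/-- The piece `F((r, s) × S^{2n-1})` of the hypersurface of revolution. -/
def piece (n : ℕ) (f : ℝ → ℝ) (r s : ℝ) : Set (Nil n) :=
  revol f '' (Ioo r s ×ˢ univ)

/-! ## Extrinsic geometry of the hypersurface of revolution -/

/-- A defining function of the hypersurface of revolution: it is the zero set of
`f(z) - |(x, y)|`. -/
def defining {n : ℕ} (f : ℝ → ℝ) (p : Nil n) : ℝ := f p.2 - ‖p.1‖

/-- The gradient for `ĝ` of a function on `Nil(2n+1)`. -/
def grad {n : ℕ} (h : Nil n → ℝ) (p : Nil n) : Nil n :=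
  ∑ k, fderiv ℝ h p (frame k p) • frame k p

/-- The unit normal field, as the normalized gradient of the defining function. -/
def normal {n : ℕ} (f : ℝ → ℝ) (p : Nil n) : Nil n :=
  (√(metric p (grad (defining f) p) (grad (defining f) p)))⁻¹ • grad (defining f) p

/-- The `ĝ`-orthogonal projection to the tangent space of the hypersurface at `p`. -/
def tangential {n : ℕ} (f : ℝ → ℝ) (p v : Nil n) : Nil n :=
  v - metric p v (normal f p) • normal f p

/-- The second fundamental form `A(v, w) = - ĝ(D_v N, w)`, for tangent vectors `v`, `w`. -/
def secondFF {n : ℕ} (f : ℝ → ℝ) (p v w : Nil n) : ℝ :=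
  -metric p (covDeriv p v (normal f)) w

/-- The squared norm `|A|²`; the form is extended by zero in the normal direction, and its
squared norm is computed in the orthonormal frame. -/
def normSqSecondFF {n : ℕ} (f : ℝ → ℝ) (p : Nil n) : ℝ :=
  ∑ j, ∑ k, secondFF f p (tangential f p (frame j p)) (tangential f p (frame k p)) ^ 2

/-- The squared norm of the gradient on the hypersurface of the restriction of `u`, in the
induced metric. -/
def normSqTangentialGrad {n : ℕ} (f : ℝ → ℝ) (u : Nil n → ℝ) (p : Nil n) : ℝ :=
  ∑ k, fderiv ℝ u p (tangential f p (frame k p)) ^ 2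

/-- The potential `|A|² + Ric(N, N)` of the Jacobi operator `J = - Δ - (|A|² + Ric(N, N))`. -/
def potential {n : ℕ} (f : ℝ → ℝ) (p : Nil n) : ℝ :=
  normSqSecondFF f p + ricci p (normal f p) (normal f p)

/-! ## The Riemannian measure of the hypersurface -/

/-- An orthonormal basis of the tangent space `ℝ × θ^⊥` of `ℝ × S^{2n-1}` at `(t, θ)`. -/
def productFrame {n : ℕ} (θ : Sph n) :
    Option (Fin (Module.finrank ℝ (Submodule.span ℝ {(θ : Hor n)})ᗮ)) → ℝ × Hor n
  | none => (1, 0)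
  | some i => (0, (stdOrthonormalBasis ℝ (Submodule.span ℝ {(θ : Hor n)})ᗮ i : Hor n))

/-- The tangent map of the parametrization at `(t, θ)`. -/
def tangentMap {n : ℕ} (f : ℝ → ℝ) (q : ℝ × Sph n) (ξ : ℝ × Hor n) : Nil n :=
  fderiv ℝ (fun r : ℝ × Hor n => ((f r.1 • r.2, r.1) : Nil n)) (q.1, (q.2 : Hor n)) ξ

/-- The density of the Riemannian measure of the induced metric `F^* ĝ` with respect to that of
the product metric of `ℝ × S^{2n-1}`: the square root of the Gram determinant. -/
def density {n : ℕ} (f : ℝ → ℝ) (q : ℝ × Sph n) : ℝ :=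
  √(Matrix.det (Matrix.of fun i j =>
    metric (revol f q) (tangentMap f q (productFrame q.2 i))
      (tangentMap f q (productFrame q.2 j))))

/-- The integral of `w` over the hypersurface `F((-T, T) × S^{2n-1})` for its Riemannian
measure. -/
def areaIntegral (n : ℕ) (f : ℝ → ℝ) (T : ℝ) (w : Nil n → ℝ) : ℝ :=
  ∫ q in Ioo (-T) T ×ˢ (univ : Set (Sph n)), w (revol f q) * density f q
    ∂((volume : Measure ℝ).prod (volume : Measure (Hor n)).toSphere)

/-! ## Stability

Here `M = F((-T, T) × S^{2n-1})`. Functions on `M` are represented by functions on the ambient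
space, of which only the restrictions to `M` matter. -/

/-- Smooth functions whose restriction to `M` has compact support in `Ω`. -/
def IsTestFunction (n : ℕ) (f : ℝ → ℝ) (T : ℝ) (Ω : Set (Nil n)) (u : Nil n → ℝ) : Prop :=
  ContDiff ℝ ∞ u ∧
    ∃ K, IsCompact K ∧ K ⊆ Ω ∧ ∀ p ∈ piece n f (-T) T, p ∉ K → u p = 0

/-- The quadratic form `∫_M u J(u) = ∫_M |∇u|² - (|A|² + Ric(N, N)) u²` of the Jacobi
operator. -/
def jacobiForm (n : ℕ) (f : ℝ → ℝ) (T : ℝ) (u : Nil n → ℝ) : ℝ :=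
  areaIntegral n f T fun p => normSqTangentialGrad f u p - potential f p * u p ^ 2

/-- The relatively compact open subsets of `M`. -/
def IsRelCompactOpen (n : ℕ) (f : ℝ → ℝ) (T : ℝ) (Ω : Set (Nil n)) : Prop :=
  (∃ U, IsOpen U ∧ Ω = piece n f (-T) T ∩ U) ∧
    ∃ K, IsCompact K ∧ K ⊆ piece n f (-T) T ∧ Ω ⊆ K

/-- The least eigenvalue `λ₁(Ω)` of the Jacobi operator in `Ω` with Dirichlet boundary
conditions: the infimum of the Rayleigh quotients (in `[-∞, ∞]`). -/
def firstEigenvalue (n : ℕ) (f : ℝ → ℝ) (T : ℝ) (Ω : Set (Nil n)) : EReal :=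
  ⨅ (u : Nil n → ℝ) (_ : IsTestFunction n f T Ω u) (_ : ∃ p ∈ piece n f (-T) T, u p ≠ 0),
    ((jacobiForm n f T u / areaIntegral n f T (fun p => u p ^ 2) : ℝ) : EReal)

/-- Stable domains: relatively compact, with `λ₁ > 0`. -/
def IsStable (n : ℕ) (f : ℝ → ℝ) (T : ℝ) (Ω : Set (Nil n)) : Prop :=
  IsRelCompactOpen n f T Ω ∧ 0 < firstEigenvalue n f T Ω

/-- Stable-unstable domains: relatively compact, with `λ₁ = 0`. -/
def IsStableUnstable (n : ℕ) (f : ℝ → ℝ) (T : ℝ) (Ω : Set (Nil n)) : Prop :=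
  IsRelCompactOpen n f T Ω ∧ firstEigenvalue n f T Ω = 0

/-- `Ω` is r-stable when all relatively compact subdomains of `Ω` are stable. -/
def IsRStable (n : ℕ) (f : ℝ → ℝ) (T : ℝ) (Ω : Set (Nil n)) : Prop :=
  ∀ Ω', Ω' ⊆ Ω → IsRelCompactOpen n f T Ω' → IsStable n f T Ω'

/-- The index `Ind(Ω)`, the number of negative Dirichlet eigenvalues of the Jacobi operator in
`Ω` with multiplicity: the largest dimension of a space of test functions on which its quadratic
form is negative definite. -/
def indexOn (n : ℕ) (f : ℝ → ℝ) (T : ℝ) (Ω : Set (Nil n)) : ℕ∞ :=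
  ⨆ (S : Submodule ℝ (Nil n → ℝ)) (_ : ∀ u ∈ S, IsTestFunction n f T Ω u)
    (_ : ∀ u ∈ S, u ≠ 0 → jacobiForm n f T u < 0), Cardinal.toENat (Module.rank ℝ S)

/-- The Morse index of `M`, the supremum of `Ind(Ω)` over the relatively compact `Ω ⊆ M`. -/
def morseIndex (n : ℕ) (f : ℝ → ℝ) (T : ℝ) : ℕ∞ :=
  ⨆ (Ω : Set (Nil n)) (_ : IsRelCompactOpen n f T Ω), indexOn n f T Ω

end NilCatenoid

end

noncomputable section

namespace NilCatenoid

/-! ## An explicit parametrization of the catenoids -/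

/-! Write P = 1 + f²/4 and W = (f/a)^(2n-1). A profile has the first integral W² = 1 + f'²P
(`weightW_sq`). Setting sinh τ = f'√P turns it into f = a cosh(τ)^(1/(2n-1)), with the height given
as the integral of a speed that decays exponentially because 2n - 1 ≥ 3. Existence, maximality, the
finite half-height T and the evenness of every profile follow from this explicit form.

On the hypersurface the area density is a^(2n-1) W² and the potential is V/W² with V =
`jacobiPotential`, so the Jacobi equation for a function w of the height is (P w')' + V w = 0.
Vertical translation gives the odd solution f'/W. Varying a gives the even solution (f - f'h)/W,
where h(0) = 0 and h' = (4 + 2f²)/(4 + f²). The signs of the combinations (f - f'(h - c))/W are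
governed by the single function y = f/f' - h on (0, T) (`jacobiRatio`): it decreases strictly from
+∞ to -H, where H > 0 is the limit of h at T. The combination with parameter c vanishes at s > 0 iff
y(s) = -c, and at -r < 0 iff y(r) = c. Hence z is defined by y(z) = 0 and ℓ by y(ℓ) = H, and for r >
ℓ the value -y(r) > -H is attained at some s.

Arbitrary test functions are handled without separation of variables. The gradient dominates the
derivative along the curves orthogonal to the slices t = const. These curves move θ by the rotations
exp(αJ), which preserve the measure of the sphere, so the derivative of ρ(t)u² along them has
integral zero, and completing the square reduces lower bounds of the form to a Riccati inequality
for ρ (`le_jacobiForm`). One positive solution makes the form nonnegative. Two independent positive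
solutions give a strictly positive lower bound, by averaging their logarithmic derivatives
(`exists_pos_le_jacobiForm`). On a piece where a positive solution vanishes at both ends, smooth
cut-offs of that solution show λ₁ ≤ 0.

For the index, h is replaced by h - κt with small κ > 0. The resulting function still vanishes at
some ±b, and the constant Wronskian evaluates its form to a positive multiple of ∫ κ(κ(1 - 1/W²) -
(2n-1)), which is negative (`integral_form_field`). -/

/-- The radius of the catenoid at the parameter `τ`, for which `f' √(1 + f² / 4) = sinh τ`. -/
def catRadius (n : ℕ) (a τ : ℝ) : ℝ := a * Real.cosh τ ^ (1 / (2 * (n : ℝ) - 1))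

/-- The derivative of the height with respect to the parameter. -/
def catSpeed (n : ℕ) (a τ : ℝ) : ℝ :=
  catRadius n a τ * √(1 + catRadius n a τ ^ 2 / 4) / ((2 * (n : ℝ) - 1) * Real.cosh τ)

/-- The height of the catenoid at the parameter `τ`. -/
def catHeight (n : ℕ) (a τ : ℝ) : ℝ := ∫ σ in (0 : ℝ)..τ, catSpeed n a σ

/-- The half-height `T(a)` of the catenoid. -/
def catHalf (n : ℕ) (a : ℝ) : ℝ := ⨆ τ, catHeight n a τ

section Param

variable {n : ℕ} {a : ℝ}

theorem exponent_pos (hn : 2 ≤ n) : (3 : ℝ) ≤ 2 * (n : ℝ) - 1 := by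
  have : (2 : ℝ) ≤ n := by exact_mod_cast hn
  linarith

theorem catRadius_pos (ha : 0 < a) (τ : ℝ) : 0 < catRadius n a τ :=
  mul_pos ha (Real.rpow_pos_of_pos (Real.cosh_pos τ) _)

theorem catRadius_neg (τ : ℝ) : catRadius n a (-τ) = catRadius n a τ := by
  simp [catRadius]

theorem catSpeed_neg (τ : ℝ) : catSpeed n a (-τ) = catSpeed n a τ := by
  simp [catSpeed, catRadius_neg]

theorem catRadius_zero : catRadius n a 0 = a := by simp [catRadius]

theorem hasDerivAt_catRadius (n : ℕ) (a τ : ℝ) : HasDerivAt (catRadius n a)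
    (catRadius n a τ * Real.sinh τ / ((2 * (n : ℝ) - 1) * Real.cosh τ)) τ := by
  have h := ((Real.hasDerivAt_cosh τ).rpow_const (p := 1 / (2 * (n : ℝ) - 1))
    (Or.inl (Real.cosh_pos τ).ne')).const_mul a
  refine h.congr_deriv ?_
  rw [Real.rpow_sub_one (Real.cosh_pos τ).ne', catRadius]
  have := (Real.cosh_pos τ).ne'
  field_simp

theorem continuous_catRadius (n : ℕ) (a : ℝ) : Continuous (catRadius n a) :=
  continuous_iff_continuousAt.2 fun τ => (hasDerivAt_catRadius n a τ).continuousAt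

theorem continuous_catSpeed (hn : 2 ≤ n) : Continuous (catSpeed n a) := by
  have h3 := exponent_pos hn
  have h := continuous_catRadius n a
  unfold catSpeed
  refine Continuous.div (by fun_prop) (by have := Real.continuous_cosh; fun_prop) fun τ => ?_
  have := Real.cosh_pos τ
  positivity

theorem catSpeed_pos (hn : 2 ≤ n) (ha : 0 < a) (τ : ℝ) : 0 < catSpeed n a τ := by
  have h3 := exponent_pos hn
  have h := catRadius_pos (n := n) ha τ
  have := Real.cosh_pos τ
  unfold catSpeed
  have : 0 < (2 * (n : ℝ) - 1) := by linarith
  positivity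

/-- The numerator grows at most like the square of the radius, hence at most like cosh^(2/3), while
the denominator grows like cosh. This is where n ≥ 2 makes the height bounded. -/
theorem catSpeed_le (hn : 2 ≤ n) (ha : 0 < a) (τ : ℝ) :
    catSpeed n a τ ≤ 2 * (a + a ^ 2 / 2) * Real.exp (-τ / 3) := by
  have h3 := exponent_pos hn
  have hR := catRadius_pos (n := n) ha τ
  have hc := Real.cosh_pos τ
  have hc1 := Real.one_le_cosh τ
  -- The exponent 1/3 is the largest value of 1/(2n-1) for n ≥ 2; with q³ = cosh τ all estimates
  -- become polynomial in q.
  set q : ℝ := Real.cosh τ ^ (1 / 3 : ℝ) with hq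
  have hq3 : q ^ 3 = Real.cosh τ := by
    rw [hq, ← Real.rpow_natCast, ← Real.rpow_mul hc.le]; norm_num
  have hq1 : 1 ≤ q := Real.one_le_rpow hc1 (by norm_num)
  have hRq : catRadius n a τ ≤ a * q := by
    unfold catRadius
    refine mul_le_mul_of_nonneg_left (Real.rpow_le_rpow_of_exponent_le hc1 ?_) ha.le
    exact one_div_le_one_div_of_le (by norm_num) h3
  have hs : √(1 + catRadius n a τ ^ 2 / 4) ≤ 1 + catRadius n a τ / 2 := by
    rw [Real.sqrt_le_left (by positivity)]
    nlinarith
  have h1 : catRadius n a τ * √(1 + catRadius n a τ ^ 2 / 4) ≤ (a + a ^ 2 / 2) * q ^ 2 := by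
    calc catRadius n a τ * √(1 + catRadius n a τ ^ 2 / 4)
        ≤ (a * q) * (1 + a * q / 2) := by
          refine mul_le_mul hRq (hs.trans ?_) (Real.sqrt_nonneg _) (by positivity)
          linarith
      _ ≤ (a + a ^ 2 / 2) * q ^ 2 := by nlinarith [mul_nonneg ha.le (by linarith : 0 ≤ q - 1)]
  have h2 : catSpeed n a τ ≤ (a + a ^ 2 / 2) / q := by
    unfold catSpeed
    rw [div_le_div_iff₀ (by nlinarith) (by positivity), ← hq3]
    have : q ^ 3 ≤ (2 * (n : ℝ) - 1) * q ^ 3 := le_mul_of_one_le_left (by positivity) (by linarith)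
    calc catRadius n a τ * √(1 + catRadius n a τ ^ 2 / 4) * q
        ≤ (a + a ^ 2 / 2) * q ^ 2 * q := by gcongr
      _ = (a + a ^ 2 / 2) * q ^ 3 := by ring
      _ ≤ _ := by gcongr
  have h4 : Real.exp (τ / 3) / 2 ≤ q := by
    refine le_of_pow_le_pow_left₀ (n := 3) (by norm_num) (by positivity) ?_
    rw [hq3, div_pow, ← Real.exp_nat_mul, Real.cosh_eq]
    have : ((3 : ℕ) : ℝ) * (τ / 3) = τ := by push_cast; ring
    rw [this]
    have := Real.exp_pos τ
    have := Real.exp_pos (-τ)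
    linarith
  refine h2.trans ?_
  have h5 : Real.exp (-τ / 3) = (Real.exp (τ / 3))⁻¹ := by rw [← Real.exp_neg]; ring_nf
  rw [h5, div_le_iff₀ (by positivity)]
  have he := Real.exp_pos (τ / 3)
  have h6 : 1 ≤ 2 * (Real.exp (τ / 3))⁻¹ * q := by
    rw [← div_le_iff₀' (by positivity)]
    refine le_trans (le_of_eq ?_) h4
    field_simp
  calc a + a ^ 2 / 2 = (a + a ^ 2 / 2) * 1 := by ring
    _ ≤ (a + a ^ 2 / 2) * (2 * (Real.exp (τ / 3))⁻¹ * q) := by gcongr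
    _ = _ := by ring

theorem hasDerivAt_catHeight (hn : 2 ≤ n) (τ : ℝ) :
    HasDerivAt (catHeight n a) (catSpeed n a τ) τ :=
  ((continuous_catSpeed hn).integral_hasStrictDerivAt 0 τ).hasDerivAt

theorem strictMono_catHeight (hn : 2 ≤ n) (ha : 0 < a) : StrictMono (catHeight n a) :=
  strictMono_of_hasDerivAt_pos (hasDerivAt_catHeight hn) (catSpeed_pos hn ha)

theorem continuous_catHeight (hn : 2 ≤ n) : Continuous (catHeight n a) :=
  continuous_iff_continuousAt.2 fun τ => (hasDerivAt_catHeight hn τ).continuousAt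

theorem catHeight_zero : catHeight n a 0 = 0 := by simp [catHeight]

theorem catHeight_neg (τ : ℝ) : catHeight n a (-τ) = -catHeight n a τ := by
  have h := intervalIntegral.integral_comp_neg (a := 0) (b := τ) (fun σ => catSpeed n a σ)
  simp only [catSpeed_neg, neg_zero] at h
  rw [catHeight, catHeight, h, intervalIntegral.integral_symm]

theorem bddAbove_catHeight (hn : 2 ≤ n) (ha : 0 < a) : BddAbove (range (catHeight n a)) := by
  refine ⟨6 * (a + a ^ 2 / 2), ?_⟩
  rintro _ ⟨τ, rfl⟩
  -- The added term is minus a primitive of the bound in `catSpeed_le`; comparing with τ = 0 bounds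
  -- the height by its value there.
  have hanti : Antitone fun τ => catHeight n a τ + 6 * (a + a ^ 2 / 2) * Real.exp (-τ / 3) := by
    refine antitone_of_hasDerivAt_nonpos
      (f' := fun τ => catSpeed n a τ - 2 * (a + a ^ 2 / 2) * Real.exp (-τ / 3))
      (fun τ => ?_) (fun τ => by simpa using catSpeed_le hn ha τ)
    refine ((hasDerivAt_catHeight hn τ).add
      ((((hasDerivAt_id τ).neg.div_const 3).exp).const_mul _)).congr_deriv ?_
    simp only [id, Pi.neg_apply]
    ring
  rcases le_total τ 0 with h | h
  · have := (strictMono_catHeight hn ha).monotone h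
    rw [catHeight_zero] at this
    exact this.trans (by positivity)
  · have := hanti h
    simp only [catHeight_zero, neg_zero, zero_div, Real.exp_zero, mul_one, zero_add] at this
    have := Real.exp_pos (-τ / 3)
    have : 0 ≤ 6 * (a + a ^ 2 / 2) * Real.exp (-τ / 3) := by positivity
    linarith

theorem catHeight_lt_catHalf (hn : 2 ≤ n) (ha : 0 < a) (τ : ℝ) : catHeight n a τ < catHalf n a :=
  ((strictMono_catHeight hn ha) (lt_add_one τ)).trans_le
    (le_ciSup (bddAbove_catHeight hn ha) (τ + 1))

theorem catHalf_pos (hn : 2 ≤ n) (ha : 0 < a) : 0 < catHalf n a := by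
  simpa [catHeight_zero] using catHeight_lt_catHalf hn ha 0

theorem range_catHeight (hn : 2 ≤ n) (ha : 0 < a) :
    range (catHeight n a) = Ioo (-catHalf n a) (catHalf n a) := by
  ext t
  constructor
  · rintro ⟨τ, rfl⟩
    have h1 := catHeight_lt_catHalf hn ha τ
    have h2 := catHeight_lt_catHalf hn ha (-τ)
    rw [catHeight_neg] at h2
    exact ⟨by linarith, h1⟩
  · rintro ⟨h1, h2⟩
    obtain ⟨u, hu⟩ := exists_lt_of_lt_ciSup h2
    obtain ⟨v, hv⟩ := exists_lt_of_lt_ciSup (by linarith : -t < catHalf n a)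
    refine mem_range_of_exists_le_of_exists_ge (continuous_catHeight hn) ⟨-v, ?_⟩ ⟨u, hu.le⟩
    rw [catHeight_neg]
    linarith

end Param

/-! ## Analysis of the profiles -/

/-- `1 + f² / 4`. -/
def weightP (f : ℝ → ℝ) (t : ℝ) : ℝ := 1 + f t ^ 2 / 4

/-- `(f / a)^(2n - 1)`, which is `√(1 + f'² (1 + f² / 4))` for a profile. -/
def weightW (n : ℕ) (a : ℝ) (f : ℝ → ℝ) (t : ℝ) : ℝ := (f t / a) ^ (2 * n - 1)

theorem cast_two_mul_sub_one {n : ℕ} (hn : 2 ≤ n) : ((2 * n - 1 : ℕ) : ℝ) = 2 * (n : ℝ) - 1 := by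
  rw [Nat.cast_sub (by omega)]; push_cast; ring

theorem weightP_pos (f : ℝ → ℝ) (t : ℝ) : 0 < weightP f t := by unfold weightP; positivity

namespace IsProfile

variable {n : ℕ} {a : ℝ} {I : Set ℝ} {f : ℝ → ℝ} {t : ℝ}

theorem hasDerivAt (hf : IsProfile n a I f) (ht : t ∈ I) : HasDerivAt f (deriv f t) t :=
  ((hf.contDiffOn.differentiableOn (by norm_num)).differentiableAt
    (hf.isOpen.mem_nhds ht)).hasDerivAt

theorem contDiffOn_deriv (hf : IsProfile n a I f) : ContDiffOn ℝ 1 (deriv f) I :=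
  ((contDiffOn_succ_iff_deriv_of_isOpen (n := 1) hf.isOpen).1
    (by simpa [one_add_one_eq_two] using hf.contDiffOn)).2.2

theorem hasDerivAt_deriv (hf : IsProfile n a I f) (ht : t ∈ I) :
    HasDerivAt (deriv f) (deriv (deriv f) t) t :=
  ((hf.contDiffOn_deriv.differentiableOn (by norm_num)).differentiableAt
    (hf.isOpen.mem_nhds ht)).hasDerivAt

theorem weightW_pos (hf : IsProfile n a I f) (ha : 0 < a) (ht : t ∈ I) : 0 < weightW n a f t := by
  have := hf.pos t ht
  unfold weightW; positivity

theorem hasDerivAt_weightW (hf : IsProfile n a I f) (hn : 2 ≤ n) (ha : 0 < a) (ht : t ∈ I) :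
    HasDerivAt (weightW n a f) ((2 * (n : ℝ) - 1) * weightW n a f t * deriv f t / f t) t := by
  have h := ((hf.hasDerivAt ht).div_const a).pow (2 * n - 1)
  refine HasDerivAt.congr_deriv h ?_
  have hp := hf.pos t ht
  rw [cast_two_mul_sub_one hn, weightW]
  obtain ⟨k, hk⟩ : ∃ k, 2 * n - 1 = k + 1 := ⟨2 * n - 2, by omega⟩
  rw [hk, Nat.add_sub_cancel, pow_succ]
  field_simp

theorem hasDerivAt_weightP (hf : IsProfile n a I f) (ht : t ∈ I) :
    HasDerivAt (weightP f) (f t * deriv f t / 2) t := by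
  refine ((((hf.hasDerivAt ht).pow 2).div_const 4).const_add 1).congr_deriv ?_
  simp
  ring

theorem ode' (hf : IsProfile n a I f) (ht : t ∈ I) : deriv (deriv f) t =
    (4 * (2 * (n : ℝ) - 1) * (1 + deriv f t ^ 2)
      + (2 * (n : ℝ) - 2) * f t ^ 2 * deriv f t ^ 2) / (f t * (4 + f t ^ 2)) := by
  have hp := hf.pos t ht
  rw [eq_div_iff (by positivity), ← hf.ode t ht]
  ring

/-- The first integral of the profile equation. -/
theorem weightW_sq (hf : IsProfile n a I f) (hn : 2 ≤ n) (ha : 0 < a) (ht : t ∈ I) :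
    weightW n a f t ^ 2 = 1 + deriv f t ^ 2 * weightP f t := by
  -- The differential equation says exactly that this quotient is constant; at t = 0 it equals 1.
  have key : ∀ t ∈ I, HasDerivAt
      (fun s => (1 + deriv f s ^ 2 * weightP f s) / weightW n a f s ^ 2) 0 t := by
    intro t ht
    have hp := hf.pos t ht
    have hW := hf.weightW_pos ha ht
    refine HasDerivAt.congr_deriv (((((hf.hasDerivAt_deriv ht).pow 2).mul
      (hf.hasDerivAt_weightP ht)).const_add 1).div ((hf.hasDerivAt_weightW hn ha ht).pow 2)
      (by simp; positivity)) ?_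
    simp only [Pi.pow_apply, Pi.mul_apply]
    rw [div_eq_zero_iff]; left
    rw [hf.ode' ht, weightP]
    field_simp
    ring
  have := hf.isOpen.is_const_of_deriv_eq_zero hf.ordConnected.isPreconnected
    (fun t ht => (key t ht).differentiableAt.differentiableWithinAt)
    (fun t ht => (key t ht).deriv) ht hf.zero_mem
  have hW := hf.weightW_pos ha ht
  rw [hf.deriv_zero] at this
  simp only [weightW, hf.value_zero, div_self ha.ne'] at this hW
  simp only [ne_eq, OfNat.ofNat_ne_zero, not_false_eq_true, zero_pow, zero_mul, add_zero, one_pow,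
    div_one] at this
  rw [div_eq_one_iff_eq (by positivity)] at this
  rw [weightW, this]

/-- The parameter `τ` along a profile. -/
def param (f : ℝ → ℝ) (t : ℝ) : ℝ := Real.arsinh (deriv f t * √(weightP f t))

theorem cosh_param (hf : IsProfile n a I f) (hn : 2 ≤ n) (ha : 0 < a) (ht : t ∈ I) :
    Real.cosh (param f t) = weightW n a f t := by
  rw [param, Real.cosh_arsinh, mul_pow, Real.sq_sqrt (weightP_pos f t).le,
    ← hf.weightW_sq hn ha ht, Real.sqrt_sq (hf.weightW_pos ha ht).le]

theorem catRadius_param (hf : IsProfile n a I f) (hn : 2 ≤ n) (ha : 0 < a) (ht : t ∈ I) :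
    catRadius n a (param f t) = f t := by
  have hp := hf.pos t ht
  have h3 := exponent_pos hn
  rw [catRadius, hf.cosh_param hn ha ht, weightW, ← Real.rpow_natCast, ← Real.rpow_mul (by positivity),
    cast_two_mul_sub_one hn, mul_one_div_cancel (by linarith), Real.rpow_one]
  field_simp

/-- By the first integral cosh of the parameter is W, so the derivative of arsinh is a division by
W; the equation for f'' then turns the numerator into the reciprocal of the speed. -/
theorem hasDerivAt_param (hf : IsProfile n a I f) (hn : 2 ≤ n) (ha : 0 < a) (ht : t ∈ I) :
    HasDerivAt (param f) (catSpeed n a (param f t))⁻¹ t := by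
  have hp := hf.pos t ht
  have hW := hf.weightW_pos ha ht
  have hP := weightP_pos f t
  have h3 := exponent_pos hn
  have h := ((hf.hasDerivAt_deriv ht).mul ((hf.hasDerivAt_weightP ht).sqrt hP.ne')).arsinh
  refine HasDerivAt.congr_deriv h ?_
  have hsq := hf.weightW_sq hn ha ht
  have hs := Real.sq_sqrt hP.le
  have hs0 := Real.sqrt_pos.2 hP
  simp only [Pi.mul_apply]
  rw [mul_pow, hs, ← hsq, Real.sqrt_sq hW.le, catSpeed, hf.catRadius_param hn ha ht,
    hf.cosh_param hn ha ht]
  change _ = (f t * √(weightP f t) / _)⁻¹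
  set s := √(weightP f t)
  have h4 : f t ^ 2 = 4 * s ^ 2 - 4 := by rw [hs, weightP]; ring
  rw [hf.ode' ht, smul_eq_mul]
  have : 0 < 2 * (n : ℝ) - 1 := by linarith
  rw [← hs] at hsq
  rw [show f t * (4 + f t ^ 2) = f t * (4 * s ^ 2) by rw [h4]; ring]
  field_simp
  rw [h4, hsq]
  ring

/-- The speeds cancel by the chain rule, so the difference of the two sides is constant on the
interval and zero at t = 0. Together with `catRadius_param` this identifies every profile with the
explicit one, which gives uniqueness. -/
theorem catHeight_param (hf : IsProfile n a I f) (hn : 2 ≤ n) (ha : 0 < a) (ht : t ∈ I) :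
    catHeight n a (param f t) = t := by
  have key : ∀ t ∈ I, HasDerivAt (fun s => catHeight n a (param f s) - s) 0 t := fun t ht => by
    refine HasDerivAt.congr_deriv (((hasDerivAt_catHeight hn (param f t)).comp t
      (hf.hasDerivAt_param hn ha ht)).sub (hasDerivAt_id t)) ?_
    rw [mul_inv_cancel₀ (catSpeed_pos hn ha _).ne', sub_self]
  have := hf.isOpen.is_const_of_deriv_eq_zero hf.ordConnected.isPreconnected
    (fun t ht => (key t ht).differentiableAt.differentiableWithinAt)
    (fun t ht => (key t ht).deriv) ht hf.zero_mem
  simp only [param, hf.deriv_zero, zero_mul, Real.arsinh_zero, catHeight_zero, sub_zero] at this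
  rw [← sub_eq_zero, param, this]

theorem subset (hf : IsProfile n a I f) (hn : 2 ≤ n) (ha : 0 < a) :
    I ⊆ Ioo (-catHalf n a) (catHalf n a) := fun t ht => by
  rw [← range_catHeight hn ha]
  exact ⟨_, hf.catHeight_param hn ha ht⟩

end IsProfile

/-! ### Existence of the maximal profile -/

section Existence

variable {n : ℕ} {a : ℝ}

/-- The inverse function of the height. -/
def catParam (n : ℕ) (a : ℝ) : ℝ → ℝ := Function.invFun (catHeight n a)

theorem catHeight_catParam (hn : 2 ≤ n) (ha : 0 < a) {t : ℝ}
    (ht : t ∈ Ioo (-catHalf n a) (catHalf n a)) : catHeight n a (catParam n a t) = t :=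
  Function.invFun_eq (by rwa [← range_catHeight hn ha] at ht)

theorem catParam_catHeight (hn : 2 ≤ n) (ha : 0 < a) (τ : ℝ) :
    catParam n a (catHeight n a τ) = τ :=
  Function.leftInverse_invFun (strictMono_catHeight hn ha).injective τ

theorem hasDerivAt_catParam (hn : 2 ≤ n) (ha : 0 < a) {t : ℝ}
    (ht : t ∈ Ioo (-catHalf n a) (catHalf n a)) :
    HasDerivAt (catParam n a) (catSpeed n a (catParam n a t))⁻¹ t := by
  have hI : Ioo (-catHalf n a) (catHalf n a) ∈ nhds t := isOpen_Ioo.mem_nhds ht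
  have hmono : StrictMonoOn (catParam n a) (Ioo (-catHalf n a) (catHalf n a)) := by
    intro x hx y hy hxy
    rwa [← (strictMono_catHeight hn ha).lt_iff_lt, catHeight_catParam hn ha hx,
      catHeight_catParam hn ha hy]
  -- A strictly monotone map whose image is a neighbourhood is continuous, which is what the inverse
  -- function rule needs.
  have himg : catParam n a '' Ioo (-catHalf n a) (catHalf n a) = univ := by
    refine eq_univ_of_forall fun τ => ⟨catHeight n a τ, ?_, catParam_catHeight hn ha τ⟩
    rw [← range_catHeight hn ha]
    exact mem_range_self τ
  refine HasDerivAt.of_local_left_inverse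
    (hmono.continuousAt_of_image_mem_nhds hI (by rw [himg]; exact Filter.univ_mem))
    (hasDerivAt_catHeight hn _) (catSpeed_pos hn ha _).ne' ?_
  filter_upwards [hI] with y hy using catHeight_catParam hn ha hy

/-- The catenoid profile. -/
def catProfile (n : ℕ) (a t : ℝ) : ℝ := catRadius n a (catParam n a t)

theorem hasDerivAt_catProfile (hn : 2 ≤ n) (ha : 0 < a) {t : ℝ}
    (ht : t ∈ Ioo (-catHalf n a) (catHalf n a)) :
    HasDerivAt (catProfile n a)
      (Real.sinh (catParam n a t) / √(1 + catProfile n a t ^ 2 / 4)) t := by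
  refine ((hasDerivAt_catRadius n a _).comp t (hasDerivAt_catParam hn ha ht)).congr_deriv ?_
  have hR := catRadius_pos (n := n) ha (catParam n a t)
  have h3 := exponent_pos hn
  have : 0 < 2 * (n : ℝ) - 1 := by linarith
  have hc := Real.cosh_pos (catParam n a t)
  unfold catProfile catSpeed
  have hs : 0 < √(1 + catRadius n a (catParam n a t) ^ 2 / 4) := by positivity
  field_simp

theorem hasDerivAt_deriv_catProfile (hn : 2 ≤ n) (ha : 0 < a) {t : ℝ}
    (ht : t ∈ Ioo (-catHalf n a) (catHalf n a)) :
    HasDerivAt (deriv (catProfile n a))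
      ((4 * (2 * (n : ℝ) - 1) * (1 + deriv (catProfile n a) t ^ 2)
      + (2 * (n : ℝ) - 2) * catProfile n a t ^ 2 * deriv (catProfile n a) t ^ 2) /
        (catProfile n a t * (4 + catProfile n a t ^ 2))) t := by
  have hI : Ioo (-catHalf n a) (catHalf n a) ∈ nhds t := isOpen_Ioo.mem_nhds ht
  have heq : deriv (catProfile n a) =ᶠ[nhds t]
      fun t => Real.sinh (catParam n a t) / √(1 + catProfile n a t ^ 2 / 4) := by
    filter_upwards [hI] with y hy using (hasDerivAt_catProfile hn ha hy).deriv
  refine HasDerivAt.congr_of_eventuallyEq ?_ heq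
  have hR := catRadius_pos (n := n) ha (catParam n a t)
  rw [heq.self_of_nhds]
  have hpos : 0 < 1 + catProfile n a t ^ 2 / 4 := by positivity
  have hd := (((((hasDerivAt_catProfile hn ha ht).pow 2).div_const 4).const_add 1).sqrt
    hpos.ne')
  have h := (((Real.hasDerivAt_sinh _).comp t (hasDerivAt_catParam hn ha ht)).div hd
    (Real.sqrt_pos.2 hpos).ne')
  refine h.congr_deriv ?_
  have h3 := exponent_pos hn
  have hm : 0 < 2 * (n : ℝ) - 1 := by linarith
  have hc := Real.cosh_pos (catParam n a t)
  simp only [Function.comp_apply, Pi.pow_apply]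
  rw [catSpeed]
  change 0 < catProfile n a t at hR
  rw [show catRadius n a (catParam n a t) = catProfile n a t from rfl]
  have hs := Real.sq_sqrt hpos.le
  have hs0 := Real.sqrt_pos.2 hpos
  set s := √(1 + catProfile n a t ^ 2 / 4)
  have h4 : catProfile n a t ^ 2 = 4 * s ^ 2 - 4 := by rw [hs]; ring
  rw [show catProfile n a t * (4 + catProfile n a t ^ 2) = catProfile n a t * (4 * s ^ 2) by
    rw [h4]; ring, h4]
  have hch := Real.cosh_sq (catParam n a t)
  simp only [Nat.cast_ofNat, Nat.add_one_sub_one, pow_one]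
  field_simp
  rw [hch, h4]
  ring

theorem isProfile_catProfile (hn : 2 ≤ n) (ha : 0 < a) :
    IsProfile n a (Ioo (-catHalf n a) (catHalf n a)) (catProfile n a) where
  isOpen := isOpen_Ioo
  ordConnected := ordConnected_Ioo
  zero_mem := by have := catHalf_pos hn ha; constructor <;> linarith
  contDiffOn := by
    have hc : ContinuousOn (catProfile n a) (Ioo (-catHalf n a) (catHalf n a)) :=
      fun t ht => (hasDerivAt_catProfile hn ha ht).continuousAt.continuousWithinAt
    have hc' : ContinuousOn (deriv (catProfile n a)) (Ioo (-catHalf n a) (catHalf n a)) :=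
      fun t ht => (hasDerivAt_deriv_catProfile hn ha ht).continuousAt.continuousWithinAt
    rw [show (2 : WithTop ℕ∞) = 1 + 1 from one_add_one_eq_two.symm,
      contDiffOn_succ_iff_deriv_of_isOpen isOpen_Ioo]
    refine ⟨fun t ht => (hasDerivAt_catProfile hn ha ht).differentiableAt.differentiableWithinAt,
      by simp, ?_⟩
    rw [show (1 : WithTop ℕ∞) = 0 + 1 from (zero_add 1).symm,
      contDiffOn_succ_iff_deriv_of_isOpen isOpen_Ioo]
    refine ⟨fun t ht =>
      (hasDerivAt_deriv_catProfile hn ha ht).differentiableAt.differentiableWithinAt,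
      by simp, ?_⟩
    rw [contDiffOn_zero]
    refine ContinuousOn.congr ?_ fun t ht => (hasDerivAt_deriv_catProfile hn ha ht).deriv
    refine ContinuousOn.div (by fun_prop) (by fun_prop) fun t _ => ?_
    have := catRadius_pos (n := n) ha (catParam n a t)
    change 0 < catProfile n a t at this
    positivity
  pos t _ := catRadius_pos ha _
  ode t ht := by
    have := catRadius_pos (n := n) ha (catParam n a t)
    change 0 < catProfile n a t at this
    rw [(hasDerivAt_deriv_catProfile hn ha ht).deriv]
    field_simp
  value_zero := by
    have : catParam n a 0 = 0 := by simpa [catHeight_zero] using catParam_catHeight hn ha 0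
    rw [catProfile, this, catRadius_zero]
  deriv_zero := by
    have h0 : catParam n a 0 = 0 := by simpa [catHeight_zero] using catParam_catHeight hn ha 0
    have := catHalf_pos hn ha
    rw [(hasDerivAt_catProfile hn ha (by constructor <;> linarith)).deriv, h0]
    simp

theorem isMaximalProfile_catProfile (hn : 2 ≤ n) (ha : 0 < a) :
    IsMaximalProfile n a (Ioo (-catHalf n a) (catHalf n a)) (catProfile n a) :=
  ⟨isProfile_catProfile hn ha, fun _ _ hg => hg.subset hn ha⟩

end Existence

/-! ### Smoothness of profiles -/

namespace IsProfile

variable {n : ℕ} {a : ℝ} {I : Set ℝ} {f : ℝ → ℝ} {t : ℝ}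

theorem contDiffOn_infty (hf : IsProfile n a I f) : ContDiffOn ℝ ∞ f I := by
  rw [_root_.contDiffOn_infty]
  -- Bootstrapping: f'' is a rational function of f and f', so the pair (f, f') gains one derivative
  -- at each step.
  have key : ∀ k : ℕ, ContDiffOn ℝ k f I ∧ ContDiffOn ℝ k (deriv f) I := by
    intro k
    induction k with
    | zero =>
      exact ⟨hf.contDiffOn.of_le (by norm_num), hf.contDiffOn_deriv.of_le (by norm_num)⟩
    | succ k ih =>
      obtain ⟨h1, h2⟩ := ih
      push_cast
      rw [contDiffOn_succ_iff_deriv_of_isOpen hf.isOpen,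
        contDiffOn_succ_iff_deriv_of_isOpen hf.isOpen]
      refine ⟨⟨fun t ht => (hf.hasDerivAt ht).differentiableAt.differentiableWithinAt,
        by simp, h2⟩, fun t ht => (hf.hasDerivAt_deriv ht).differentiableAt.differentiableWithinAt,
        by simp, ?_⟩
      refine ContDiffOn.congr ?_ fun t ht => hf.ode' ht
      refine ContDiffOn.div (by fun_prop) (by fun_prop) fun t ht => ?_
      have := hf.pos t ht
      positivity
  exact fun k => (key k).1

theorem contDiffOn_deriv_infty (hf : IsProfile n a I f) : ContDiffOn ℝ ∞ (deriv f) I :=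
  ((contDiffOn_infty_iff_deriv_of_isOpen hf.isOpen).1 hf.contDiffOn_infty).2

theorem continuousOn (hf : IsProfile n a I f) : ContinuousOn f I :=
  hf.contDiffOn.continuousOn

end IsProfile

/-! ## The scaling Jacobi field -/

/-- The function `h` for which `f - f' h` is the derivative of the profiles with respect to
the parameter `a`, up to a factor. -/
def scaleH (f : ℝ → ℝ) (t : ℝ) : ℝ := ∫ s in (0 : ℝ)..t, (4 + 2 * f s ^ 2) / (4 + f s ^ 2)

/-- The profile is symmetric and defined on the maximal interval. -/
abbrev IsFullProfile (n : ℕ) (a : ℝ) (f : ℝ → ℝ) : Prop :=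
  IsProfile n a (Ioo (-catHalf n a) (catHalf n a)) f

theorem hasDerivAt_integral_of_continuousOn {T : ℝ} {φ : ℝ → ℝ}
    (hφ : ContinuousOn φ (Ioo (-T) T)) {t : ℝ} (ht : t ∈ Ioo (-T) T) :
    HasDerivAt (fun t => ∫ s in (0 : ℝ)..t, φ s) (φ t) t := by
  have h0 : (0 : ℝ) ∈ Ioo (-T) T := by constructor <;> linarith [ht.1, ht.2]
  have hsub : uIcc 0 t ⊆ Ioo (-T) T := ordConnected_Ioo.uIcc_subset h0 ht
  exact intervalIntegral.integral_hasDerivAt_right (hφ.mono hsub).intervalIntegrable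
    (hφ.stronglyMeasurableAtFilter isOpen_Ioo t ht) (hφ.continuousAt (isOpen_Ioo.mem_nhds ht))

namespace IsProfile

variable {n : ℕ} {a : ℝ} {f : ℝ → ℝ} {t : ℝ}

theorem neg_mem_Ioo {T t : ℝ} (ht : t ∈ Ioo (-T) T) : -t ∈ Ioo (-T) T :=
  ⟨by linarith [ht.2], by linarith [ht.1]⟩

/-- Evenness of the profile is not a uniqueness argument for the Cauchy problem: it comes from the
injectivity and oddness of the height as a function of τ. -/
theorem param_neg (hf : IsFullProfile n a f) (hn : 2 ≤ n) (ha : 0 < a)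
    (ht : t ∈ Ioo (-catHalf n a) (catHalf n a)) : param f (-t) = -param f t := by
  refine (strictMono_catHeight hn ha).injective ?_
  rw [hf.catHeight_param hn ha (neg_mem_Ioo ht), catHeight_neg, hf.catHeight_param hn ha ht]

theorem even (hf : IsFullProfile n a f) (hn : 2 ≤ n) (ha : 0 < a)
    (ht : t ∈ Ioo (-catHalf n a) (catHalf n a)) : f (-t) = f t := by
  rw [← hf.catRadius_param hn ha ht, ← hf.catRadius_param hn ha (neg_mem_Ioo ht),
    hf.param_neg hn ha ht, catRadius_neg]

theorem deriv_neg (hf : IsFullProfile n a f) (hn : 2 ≤ n) (ha : 0 < a)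
    (ht : t ∈ Ioo (-catHalf n a) (catHalf n a)) : deriv f (-t) = -deriv f t := by
  have h1 : HasDerivAt (fun s => f (-s)) (deriv f (-t) * (-1)) t :=
    (hf.hasDerivAt (neg_mem_Ioo ht)).comp t (hasDerivAt_neg t)
  have h2 : HasDerivAt f (deriv f (-t) * (-1)) t := by
    refine h1.congr_of_eventuallyEq ?_
    filter_upwards [isOpen_Ioo.mem_nhds ht] with s hs using (hf.even hn ha hs).symm
  rw [h2.deriv]; ring

theorem deriv_pos (hf : IsFullProfile n a f) (hn : 2 ≤ n) (ha : 0 < a)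
    (ht : t ∈ Ioo 0 (catHalf n a)) : 0 < deriv f t := by
  have ht' : t ∈ Ioo (-catHalf n a) (catHalf n a) := ⟨by linarith [ht.1, ht.2], ht.2⟩
  have h1 : 0 < param f t := by
    rw [← (strictMono_catHeight hn ha).lt_iff_lt, catHeight_zero, hf.catHeight_param hn ha ht']
    exact ht.1
  rw [param, Real.arsinh_pos_iff] at h1
  exact pos_of_mul_pos_left h1 (Real.sqrt_nonneg _)

theorem continuousOn_scaleIntegrand {I : Set ℝ} (hf : IsProfile n a I f) :
    ContinuousOn (fun s => (4 + 2 * f s ^ 2) / (4 + f s ^ 2)) I := by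
  have := hf.continuousOn
  exact ContinuousOn.div (by fun_prop) (by fun_prop) fun s _ => by positivity

theorem hasDerivAt_scaleH {T : ℝ} (hf : IsProfile n a (Ioo (-T) T) f) (ht : t ∈ Ioo (-T) T) :
    HasDerivAt (scaleH f) ((4 + 2 * f t ^ 2) / (4 + f t ^ 2)) t :=
  hasDerivAt_integral_of_continuousOn hf.continuousOn_scaleIntegrand ht

theorem scaleH_neg (hf : IsFullProfile n a f) (hn : 2 ≤ n) (ha : 0 < a)
    (ht : t ∈ Ioo (-catHalf n a) (catHalf n a)) : scaleH f (-t) = -scaleH f t := by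
  have h := intervalIntegral.integral_comp_neg (a := 0) (b := t)
    (fun s => (4 + 2 * f s ^ 2) / (4 + f s ^ 2))
  have h0 : (0 : ℝ) ∈ Ioo (-catHalf n a) (catHalf n a) := hf.zero_mem
  have h2 : ∫ s in (0 : ℝ)..t, (4 + 2 * f (-s) ^ 2) / (4 + f (-s) ^ 2) =
      ∫ s in (0 : ℝ)..t, (4 + 2 * f s ^ 2) / (4 + f s ^ 2) := by
    refine intervalIntegral.integral_congr fun s hs => ?_
    simp only [hf.even hn ha (ordConnected_Ioo.uIcc_subset h0 ht hs)]
  rw [scaleH, scaleH, intervalIntegral.integral_symm, ← h2, h, neg_zero]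

theorem strictMonoOn_scaleH {T : ℝ} (hf : IsProfile n a (Ioo (-T) T) f) :
    StrictMonoOn (scaleH f) (Ioo (-T) T) := by
  refine strictMonoOn_of_hasDerivWithinAt_pos (convex_Ioo _ _)
    (fun t ht => (hf.hasDerivAt_scaleH ht).continuousAt.continuousWithinAt)
    (fun t ht => (hf.hasDerivAt_scaleH (interior_subset ht)).hasDerivWithinAt) fun t _ => ?_
  positivity

/-- The limit of `h` at the end of the interval. -/
theorem exists_scaleH_tendsto (hf : IsFullProfile n a f) :
    ∃ H, Filter.Tendsto (scaleH f) (nhdsWithin (catHalf n a) (Iio (catHalf n a))) (nhds H) ∧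
      ∀ t ∈ Ioo (-catHalf n a) (catHalf n a), scaleH f t < H := by
  have h0 := hf.zero_mem
  have hmono := hf.strictMonoOn_scaleH
  have hbd : ∀ t ∈ Ioo (-catHalf n a) (catHalf n a), scaleH f t ≤ 2 * catHalf n a := by
    -- The integrand of h is at most 2, so h stays bounded on the bounded interval and, being
    -- increasing, has a limit.
    have hanti : AntitoneOn (fun t => scaleH f t - 2 * t) (Ioo (-catHalf n a) (catHalf n a)) := by
      refine antitoneOn_of_hasDerivWithinAt_nonpos (convex_Ioo _ _)
        (f' := fun t => (4 + 2 * f t ^ 2) / (4 + f t ^ 2) - 2)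
        (fun t ht => ((hf.hasDerivAt_scaleH ht).sub
          ((hasDerivAt_id t).const_mul 2)).continuousAt.continuousWithinAt)
        (fun t ht => ((((hf.hasDerivAt_scaleH (interior_subset ht)).sub
          ((hasDerivAt_id t).const_mul 2))).congr_deriv (by simp)).hasDerivWithinAt) fun t _ => ?_
      rw [sub_nonpos, div_le_iff₀ (by positivity)]
      linarith [sq_nonneg (f t)]
    intro t ht
    rcases le_total t 0 with h | h
    · refine (hmono.monotoneOn ht h0 h).trans ?_
      simp only [scaleH, intervalIntegral.integral_same]
      linarith [h0.2]
    · have := hanti h0 ht h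
      simp only [scaleH, intervalIntegral.integral_same, mul_zero, sub_zero] at this
      change scaleH f t - 2 * t ≤ 0 at this
      linarith [ht.2]
  have hbdd : BddAbove (scaleH f '' Ioo (-catHalf n a) (catHalf n a)) := by
    refine ⟨2 * catHalf n a, ?_⟩
    rintro _ ⟨t, ht, rfl⟩
    exact hbd t ht
  have hlt : -catHalf n a < catHalf n a := h0.1.trans h0.2
  refine ⟨sSup (scaleH f '' Ioo (-catHalf n a) (catHalf n a)), ?_, fun t ht => ?_⟩
  · have := hmono.monotoneOn.tendsto_nhdsWithin_Ioo_left (by simpa using hlt) hbdd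
    exact this
  · have ht2 : (t + catHalf n a) / 2 ∈ Ioo (-catHalf n a) (catHalf n a) := by
      constructor <;> linarith [ht.1, ht.2]
    exact (hmono ht ht2 (by linarith [ht.2])).trans_le (le_csSup hbdd ⟨_, ht2, rfl⟩)

/-- In the parameter τ the quotient is f√P / sinh τ. Up to a constant this is the speed dt/dτ once
sinh and cosh are comparable, and the speed tends to zero. -/
theorem tendsto_div_deriv (hf : IsFullProfile n a f) (hn : 2 ≤ n) (ha : 0 < a) :
    Filter.Tendsto (fun t => f t / deriv f t) (nhdsWithin (catHalf n a) (Iio (catHalf n a)))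
      (nhds 0) := by
  have hT := catHalf_pos hn ha
  have h3 := exponent_pos hn
  have hm : 0 < 2 * (n : ℝ) - 1 := by linarith
  have hparam : Filter.Tendsto (param f) (nhdsWithin (catHalf n a) (Iio (catHalf n a)))
      Filter.atTop := by
    refine Filter.tendsto_atTop.2 fun M => ?_
    have hM := catHeight_lt_catHalf hn ha M
    filter_upwards [Ioo_mem_nhdsLT (max_lt hM hT)] with t ht
    have h1 : catHeight n a M < t := (le_max_left _ _).trans_lt ht.1
    have h2 : 0 < t := (le_max_right _ _).trans_lt ht.1
    rw [← hf.catHeight_param hn ha ⟨by linarith, ht.2⟩,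
      (strictMono_catHeight hn ha).lt_iff_lt] at h1
    exact h1.le
  have hexp : Filter.Tendsto (fun τ => (2 * (n : ℝ) - 1) * (2 * (2 * (a + a ^ 2 / 2) *
      Real.exp (-τ / 3)))) Filter.atTop (nhds 0) := by
    have : Filter.Tendsto (fun τ : ℝ => Real.exp (-τ / 3)) Filter.atTop (nhds 0) := by
      refine Real.tendsto_exp_neg_atTop_nhds_zero.comp
        (Filter.tendsto_id.atTop_div_const (show (0 : ℝ) < 3 by norm_num)) |>.congr fun τ => ?_
      simp [neg_div]
    have := ((this.const_mul (2 * (a + a ^ 2 / 2))).const_mul 2).const_mul (2 * (n : ℝ) - 1)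
    simpa using this
  have hlim := hexp.comp hparam
  refine squeeze_zero' ?_ ?_ hlim
  · filter_upwards [Ioo_mem_nhdsLT hT] with t ht
    have := hf.deriv_pos hn ha ht
    have := hf.pos t ⟨by linarith [ht.1], ht.2⟩
    positivity
  · filter_upwards [Ioo_mem_nhdsLT hT, hparam.eventually_ge_atTop 1] with t ht hτ
    have ht' : t ∈ Ioo (-catHalf n a) (catHalf n a) := ⟨by linarith [ht.1], ht.2⟩
    have hd := hf.deriv_pos hn ha ht
    have hp := hf.pos t ht'
    have hle := catSpeed_le hn ha (param f t)
    refine le_trans ?_ (mul_le_mul_of_nonneg_left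
      (mul_le_mul_of_nonneg_left hle (by norm_num : (0 : ℝ) ≤ 2)) hm.le)
    -- This amounts to 3 exp(-τ) ≤ exp(τ), and τ ≥ 1 gives exp(τ) ≥ 2 and exp(-τ) ≤ 1/2.
    have hch : Real.cosh (param f t) ≤ 2 * Real.sinh (param f t) := by
      rw [Real.cosh_eq, Real.sinh_eq]
      have h1 : Real.exp (-param f t) ≤ Real.exp (-1) := Real.exp_le_exp.2 (by linarith)
      have h2 : 1 + 1 ≤ Real.exp (param f t) :=
        (by linarith : 1 + 1 ≤ param f t + 1).trans (Real.add_one_le_exp _)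
      have h4 : Real.exp (-1) ≤ 1 / 2 := by
        rw [Real.exp_neg, inv_le_comm₀ (Real.exp_pos _) (by norm_num)]
        have := Real.add_one_le_exp (1 : ℝ)
        norm_num at this ⊢
        linarith
      linarith
    have hsinh : Real.sinh (param f t) = deriv f t * √(weightP f t) := Real.sinh_arsinh _
    have hc := Real.cosh_pos (param f t)
    have hs := Real.sqrt_pos.2 (weightP_pos f t)
    rw [catSpeed, hf.catRadius_param hn ha ht']
    change _ ≤ _ * (2 * (f t * √(weightP f t) / _))
    rw [show (2 * (n : ℝ) - 1) * (2 * (f t * √(weightP f t) /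
      ((2 * (n : ℝ) - 1) * Real.cosh (param f t)))) =
      2 * f t * √(weightP f t) / Real.cosh (param f t) by field_simp,
      div_le_div_iff₀ hd hc]
    rw [hsinh] at hch
    nlinarith [mul_le_mul_of_nonneg_left hch hp.le]

/-- `f / f' - h`, the quotient of the even by the odd Jacobi field. -/
def jacobiRatio (f : ℝ → ℝ) (t : ℝ) : ℝ := f t / deriv f t - scaleH f t

theorem hasDerivAt_jacobiRatio {T : ℝ} (hf : IsProfile n a (Ioo (-T) T) f) (ht : t ∈ Ioo (-T) T)
    (hd : deriv f t ≠ 0) : HasDerivAt (jacobiRatio f)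
      ((deriv f t * deriv f t - f t * deriv (deriv f) t) / deriv f t ^ 2 -
        (4 + 2 * f t ^ 2) / (4 + f t ^ 2)) t :=
  ((hf.hasDerivAt ht).div (hf.hasDerivAt_deriv ht) hd).sub (hf.hasDerivAt_scaleH ht)

/-- The quotient f/f' is nonincreasing because f is logarithmically convex, and h' > 1 leaves room
for a linear term of slope up to 1. That room is what the index estimate uses. -/
theorem strictAntiOn_jacobiRatio_add (hf : IsFullProfile n a f) (hn : 2 ≤ n) (ha : 0 < a) {κ : ℝ}
    (hκ : κ ≤ 1) : StrictAntiOn (fun t => jacobiRatio f t + κ * t) (Ioo 0 (catHalf n a)) := by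
  have hsub : ∀ t ∈ Ioo 0 (catHalf n a), t ∈ Ioo (-catHalf n a) (catHalf n a) :=
    fun t ht => ⟨by linarith [ht.1, ht.2], ht.2⟩
  have hderiv := fun t ht => (hf.hasDerivAt_jacobiRatio (hsub t ht)
      (hf.deriv_pos hn ha ht).ne').add ((hasDerivAt_id t).const_mul κ)
  refine strictAntiOn_of_hasDerivWithinAt_neg (convex_Ioo _ _)
    (fun t ht => (hderiv t ht).continuousAt.continuousWithinAt)
    (fun t ht => (hderiv t (interior_subset ht)).hasDerivWithinAt) fun t ht => ?_
  rw [interior_Ioo] at ht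
  have hd := hf.deriv_pos hn ha ht
  have hp := hf.pos t (hsub t ht)
  have h3 := exponent_pos hn
  -- Logarithmic convexity: the right side of the profile equation dominates (4 + f²)f'², since
  -- 4(2n-1) ≥ 4 and 2n - 2 ≥ 1.
  have h1 : deriv f t * deriv f t ≤ f t * deriv (deriv f) t := by
    have hode := hf.ode t (hsub t ht)
    rw [mul_right_comm] at hode
    refine le_of_mul_le_mul_right ?_ (by positivity : 0 < 4 + f t ^ 2)
    rw [hode]
    nlinarith [mul_pos hd hd, mul_pos (pow_pos hp 2) (mul_pos hd hd)]
  have h2 : (deriv f t * deriv f t - f t * deriv (deriv f) t) / deriv f t ^ 2 ≤ 0 :=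
    div_nonpos_of_nonpos_of_nonneg (by linarith) (by positivity)
  have h4 : 1 < (4 + 2 * f t ^ 2) / (4 + f t ^ 2) := by
    rw [one_lt_div (by positivity)]
    linarith [pow_pos hp 2]
  linarith

theorem strictAntiOn_jacobiRatio (hf : IsFullProfile n a f) (hn : 2 ≤ n) (ha : 0 < a) :
    StrictAntiOn (jacobiRatio f) (Ioo 0 (catHalf n a)) := by
  simpa using hf.strictAntiOn_jacobiRatio_add hn ha zero_le_one

theorem jacobiRatio_tendsto (hf : IsFullProfile n a f) (hn : 2 ≤ n) (ha : 0 < a) {H : ℝ}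
    (hH : Filter.Tendsto (scaleH f) (nhdsWithin (catHalf n a) (Iio (catHalf n a))) (nhds H)) :
    Filter.Tendsto (jacobiRatio f) (nhdsWithin (catHalf n a) (Iio (catHalf n a)))
      (nhds (-H)) := by
  have h := (hf.tendsto_div_deriv hn ha).sub hH
  rw [zero_sub] at h
  exact h

/-- The values of `f / f' - h + κ t` on the positive half-interval. -/
theorem exists_jacobiRatio_add_eq (hf : IsFullProfile n a f) (hn : 2 ≤ n) (ha : 0 < a) {H κ : ℝ}
    (hH : Filter.Tendsto (scaleH f) (nhdsWithin (catHalf n a) (Iio (catHalf n a))) (nhds H))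
    {c : ℝ} (hc : -H + κ * catHalf n a < c) :
    ∃ t ∈ Ioo 0 (catHalf n a), jacobiRatio f t + κ * t = c := by
  have hT := catHalf_pos hn ha
  have hsub : ∀ t ∈ Ico 0 (catHalf n a), t ∈ Ioo (-catHalf n a) (catHalf n a) :=
    fun t ht => ⟨by linarith [ht.1, ht.2], ht.2⟩
  have hlim : Filter.Tendsto (fun t => jacobiRatio f t + κ * t)
      (nhdsWithin (catHalf n a) (Iio (catHalf n a))) (nhds (-H + κ * catHalf n a)) :=
    (hf.jacobiRatio_tendsto hn ha hH).add
      (Filter.Tendsto.mono_left ((continuous_const_mul κ).tendsto _) nhdsWithin_le_nhds)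
  obtain ⟨b, hb, hbT⟩ := ((hlim.eventually_lt_const hc).and (Ioo_mem_nhdsLT hT)).exists
  -- Multiplying the equation by f' removes the pole of f/f' at 0: φ(0) = a > 0 replaces the limit
  -- +∞, and the intermediate value theorem applies up to the endpoint 0.
  set φ : ℝ → ℝ := fun t => f t - deriv f t * (scaleH f t - κ * t + c) with hφ
  have hcont : ContinuousOn φ (Icc 0 b) := fun t ht => by
    have ht' := hsub t ⟨ht.1, ht.2.trans_lt hbT.2⟩
    exact ((hf.hasDerivAt ht').sub ((hf.hasDerivAt_deriv ht').mul
      (((hf.hasDerivAt_scaleH ht').sub ((hasDerivAt_id t).const_mul κ)).add_const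
        c))).continuousAt.continuousWithinAt
  have hd := hf.deriv_pos hn ha hbT
  have h0 : 0 < φ 0 := by simp only [hφ, hf.deriv_zero, hf.value_zero]; linarith
  have hb0 : φ b < 0 := by
    have hb' : f b / deriv f b < scaleH f b - κ * b + c := by rw [jacobiRatio] at hb; linarith
    rw [div_lt_iff₀ hd] at hb'
    simp only [hφ]
    nlinarith
  obtain ⟨t, ht, hte⟩ := intermediate_value_Icc' hbT.1.le hcont ⟨hb0.le, h0.le⟩
  have ht0 : 0 < t := lt_of_le_of_ne ht.1 fun h => by rw [← h] at hte; exact h0.ne' hte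
  have htT : t ∈ Ioo 0 (catHalf n a) := ⟨ht0, ht.2.trans_lt hbT.2⟩
  refine ⟨t, htT, ?_⟩
  have hd := hf.deriv_pos hn ha htT
  have : f t / deriv f t = scaleH f t - κ * t + c := by
    rw [div_eq_iff hd.ne']
    simp only [hφ] at hte
    linarith
  rw [jacobiRatio]
  linarith

theorem exists_jacobiRatio_eq (hf : IsFullProfile n a f) (hn : 2 ≤ n) (ha : 0 < a) {H : ℝ}
    (hH : Filter.Tendsto (scaleH f) (nhdsWithin (catHalf n a) (Iio (catHalf n a))) (nhds H))
    {c : ℝ} (hc : -H < c) : ∃ t ∈ Ioo 0 (catHalf n a), jacobiRatio f t = c := by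
  simpa using hf.exists_jacobiRatio_add_eq hn ha (κ := 0) hH (c := c) (by linarith)

end IsProfile

/-! ## The complex structure of the horizontal space -/

section Geometry

variable {n : ℕ}

/-- The complex structure `(x, y) ↦ (-y, x)`. -/
def cplx : Hor n →L[ℝ] Hor n := LinearMap.toContinuousLinearMap
  { toFun := fun v => WithLp.toLp 2 (Sum.elim (fun i => -v (Sum.inr i)) (fun i => v (Sum.inl i)))
    map_add' := fun v w => by
      ext (i | i) <;> simp [add_comm]
    map_smul' := fun c v => by
      ext (i | i) <;> simp }

@[simp] theorem cplx_inl (v : Hor n) (i : Fin n) : cplx v (Sum.inl i) = -v (Sum.inr i) := rfl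

@[simp] theorem cplx_inr (v : Hor n) (i : Fin n) : cplx v (Sum.inr i) = v (Sum.inl i) := rfl

theorem cplx_cplx (v : Hor n) : cplx (cplx v) = -v := by
  ext (i | i) <;> simp

theorem inner_eq_sum (v w : Hor n) : inner ℝ v w = ∑ j, v j * w j := by
  simp [PiLp.inner_apply, mul_comm]

theorem inner_cplx_left (v w : Hor n) : inner ℝ (cplx v) w = -inner ℝ v (cplx w) := by
  simp only [inner_eq_sum, Fintype.sum_sum_type, cplx_inl, cplx_inr, neg_mul, mul_neg,
    Finset.sum_neg_distrib]
  ring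

theorem inner_cplx_cplx (v w : Hor n) : inner ℝ (cplx v) (cplx w) = inner ℝ v w := by
  rw [inner_cplx_left, cplx_cplx, inner_neg_right, neg_neg]

theorem inner_cplx_self (v : Hor n) : inner ℝ (cplx v) v = 0 := by
  have h := inner_cplx_left v v
  rw [real_inner_comm] at h
  linarith [real_inner_comm v (cplx v)]

theorem inner_self_cplx (v : Hor n) : inner ℝ v (cplx v) = 0 := by
  rw [real_inner_comm, inner_cplx_self]

theorem inner_single (v : Hor n) (j : Fin n ⊕ Fin n) :
    inner ℝ v (EuclideanSpace.single j (1 : ℝ)) = v j := by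
  simp [EuclideanSpace.inner_single_right]

/-- All later computations go through this form: the position enters only through J applied to it,
so skew-symmetry and J² = -1 replace coordinate sums. -/
theorem contactForm_eq (p v : Nil n) :
    contactForm p v = v.2 - 1 / 2 * inner ℝ (cplx p.1) v.1 := by
  rw [contactForm, inner_eq_sum, Fintype.sum_sum_type, Finset.sum_sub_distrib]
  simp only [cplx_inl, cplx_inr, neg_mul, Finset.sum_neg_distrib]
  ring

theorem contactForm_add (p v w : Nil n) :
    contactForm p (v + w) = contactForm p v + contactForm p w := by
  simp only [contactForm_eq, Prod.fst_add, Prod.snd_add, inner_add_right]; ring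

theorem contactForm_smul (p : Nil n) (c : ℝ) (v : Nil n) :
    contactForm p (c • v) = c * contactForm p v := by
  simp only [contactForm_eq, Prod.smul_fst, Prod.smul_snd, inner_smul_right, smul_eq_mul]; ring

theorem contactForm_sub (p v w : Nil n) :
    contactForm p (v - w) = contactForm p v - contactForm p w := by
  simp only [contactForm_eq, Prod.fst_sub, Prod.snd_sub, inner_sub_right]; ring

theorem metric_add_left (p u v w : Nil n) : metric p (u + v) w = metric p u w + metric p v w := by
  simp only [metric, contactForm_add, Prod.fst_add, inner_add_left]; ring

theorem metric_smul_left (p : Nil n) (c : ℝ) (v w : Nil n) :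
    metric p (c • v) w = c * metric p v w := by
  simp only [metric, contactForm_smul, Prod.smul_fst, real_inner_smul_left]; ring

theorem metric_comm (p v w : Nil n) : metric p v w = metric p w v := by
  rw [metric, metric, real_inner_comm, mul_comm]

theorem metric_sub_right (p u v w : Nil n) :
    metric p u (v - w) = metric p u v - metric p u w := by
  simp only [metric, contactForm_sub, Prod.fst_sub, inner_sub_right]; ring

theorem metric_smul_right (p : Nil n) (c : ℝ) (v w : Nil n) :
    metric p v (c • w) = c * metric p v w := by
  rw [metric_comm, metric_smul_left, metric_comm]

/-- The tangent vector with horizontal part `u` and vertical part `z`. -/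
def lift (p : Nil n) (u : Hor n) (z : ℝ) : Nil n := (u, z + 1 / 2 * inner ℝ (cplx p.1) u)

@[simp] theorem lift_fst (p : Nil n) (u : Hor n) (z : ℝ) : (lift p u z).1 = u := rfl

@[simp] theorem contactForm_lift (p : Nil n) (u : Hor n) (z : ℝ) :
    contactForm p (lift p u z) = z := by
  rw [contactForm_eq, lift]; ring

theorem lift_contactForm (p v : Nil n) : lift p v.1 (contactForm p v) = v := by
  ext1
  · rfl
  · rw [lift, contactForm_eq]; ring

theorem smul_lift (p : Nil n) (c : ℝ) (u : Hor n) (z : ℝ) :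
    c • lift p u z = lift p (c • u) (c * z) := by
  ext1
  · rfl
  · simp only [lift, Prod.smul_snd, smul_eq_mul, inner_smul_right]; ring

theorem lift_add (p : Nil n) (u u' : Hor n) (z z' : ℝ) :
    lift p u z + lift p u' z' = lift p (u + u') (z + z') := by
  ext1
  · rfl
  · simp only [lift, Prod.snd_add, inner_add_right]; ring

theorem lift_sub (p : Nil n) (u u' : Hor n) (z z' : ℝ) :
    lift p u z - lift p u' z' = lift p (u - u') (z - z') := by
  ext1
  · rfl
  · simp only [lift, Prod.snd_sub, inner_sub_right]; ring

theorem frame_inl (j : Fin n ⊕ Fin n) (p : Nil n) :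
    frame (Sum.inl j) p = lift p (EuclideanSpace.single j (1 : ℝ)) 0 := by
  rcases j with i | i <;> simp only [frame, lift, inner_single, cplx_inl, cplx_inr] <;> ring_nf

theorem frame_inr (p : Nil n) : frame (Sum.inr ()) p = lift p 0 1 := by
  simp [frame, lift]

theorem metric_frame_inl (p v : Nil n) (j : Fin n ⊕ Fin n) :
    metric p v (frame (Sum.inl j) p) = v.1 j := by
  rw [frame_inl, metric, contactForm_lift, mul_zero, add_zero, lift_fst, inner_single]

theorem metric_frame_inr (p v : Nil n) :
    metric p v (frame (Sum.inr ()) p) = contactForm p v := by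
  rw [frame_inr, metric, contactForm_lift, lift_fst, inner_zero_right]; ring

theorem sum_smul_single (c : Fin n ⊕ Fin n → ℝ) :
    ∑ j, c j • EuclideanSpace.single j (1 : ℝ) = (WithLp.toLp 2 c : Hor n) := by
  ext (i | i) <;> simp [Finset.sum_apply, Pi.single_apply]

theorem sum_smul_frame (p : Nil n) (c : (Fin n ⊕ Fin n) ⊕ Unit → ℝ) :
    ∑ k, c k • frame k p = lift p (WithLp.toLp 2 fun j => c (Sum.inl j)) (c (Sum.inr ())) := by
  rw [Fintype.sum_sum_type]
  simp only [Finset.univ_unique, Finset.sum_singleton, PUnit.default_eq_unit, frame_inl, frame_inr,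
    smul_lift, mul_zero, smul_zero, mul_one]
  have h : ∀ s : Finset (Fin n ⊕ Fin n), ∑ j ∈ s, lift p (c (Sum.inl j) •
      EuclideanSpace.single j (1 : ℝ)) 0 =
      lift p (∑ j ∈ s, c (Sum.inl j) • EuclideanSpace.single j (1 : ℝ)) 0 := by
    intro s
    induction s using Finset.induction_on with
    | empty => simp [lift, Prod.ext_iff]
    | insert j s hj ih => rw [Finset.sum_insert hj, Finset.sum_insert hj, ih, lift_add, add_zero]
  rw [h, sum_smul_single, lift_add, add_zero, zero_add]

theorem sum_metric_smul_frame (p v : Nil n) : ∑ k, metric p v (frame k p) • frame k p = v := by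
  rw [sum_smul_frame]
  simp only [metric_frame_inl, metric_frame_inr]
  exact lift_contactForm p v

/-! ## The Levi-Civita connection and the Ricci tensor -/

theorem hasFDerivAt_contactForm (p w : Nil n) :
    HasFDerivAt (fun q : Nil n => contactForm q w)
      ((-(1 / 2 : ℝ)) • ((innerSL ℝ w.1).comp (cplx.comp (ContinuousLinearMap.fst ℝ (Hor n) ℝ))))
      p := by
  have h := (((innerSL ℝ w.1).comp (cplx.comp
    (ContinuousLinearMap.fst ℝ (Hor n) ℝ))).hasFDerivAt (x := p)).const_smul (-(1 / 2 : ℝ))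
  refine (h.const_add w.2).congr_of_eventuallyEq (Filter.Eventually.of_forall fun q => ?_)
  simp only [contactForm_eq, Pi.smul_apply, ContinuousLinearMap.comp_apply, innerSL_apply_apply,
    ContinuousLinearMap.coe_fst', smul_eq_mul]
  rw [real_inner_comm]
  ring

theorem fderiv_metric (p v w e : Nil n) :
    fderiv ℝ (fun q => metric q w e) p v =
      -(1 / 2) * inner ℝ (cplx v.1) w.1 * contactForm p e
        - 1 / 2 * inner ℝ (cplx v.1) e.1 * contactForm p w := by
  have h := ((hasFDerivAt_contactForm p w).mul (hasFDerivAt_contactForm p e)).const_add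
    (inner ℝ w.1 e.1)
  have h' : HasFDerivAt (fun q => metric q w e) _ p := h
  rw [h'.fderiv]
  simp only [_root_.add_apply, _root_.smul_apply,
    ContinuousLinearMap.comp_apply, innerSL_apply_apply, ContinuousLinearMap.coe_fst', smul_eq_mul]
  rw [real_inner_comm w.1, real_inner_comm e.1]
  ring

/-- The metric depends on the point only through the contact form, which is affine in it. In the
Koszul sum the terms ⟨Jv, w⟩ and ⟨Jw, v⟩ multiplying the vertical component cancel by skew-symmetry,
while the remaining terms double. -/
theorem christoffel_eq (p v w : Nil n) : christoffel p v w =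
    lift p (-(1 / 2 : ℝ) • (contactForm p w • cplx v.1 + contactForm p v • cplx w.1)) 0 := by
  have h : ∀ k, (1 / 2 : ℝ) * (fderiv ℝ (fun q => metric q w (frame k p)) p v
      + fderiv ℝ (fun q => metric q v (frame k p)) p w
      - fderiv ℝ (fun q => metric q v w) p (frame k p)) =
      -(1 / 2) * (inner ℝ (cplx v.1) (frame k p).1 * contactForm p w
        + inner ℝ (cplx w.1) (frame k p).1 * contactForm p v) := by
    intro k
    rw [fderiv_metric, fderiv_metric, fderiv_metric, inner_cplx_left w.1 v.1,
      inner_cplx_left (frame k p).1, inner_cplx_left (frame k p).1,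
      real_inner_comm (cplx v.1) (frame k p).1, real_inner_comm (cplx w.1) (frame k p).1,
      real_inner_comm (cplx v.1) w.1]
    ring
  simp only [christoffel, h]
  rw [sum_smul_frame]
  congr 1
  · ext j
    simp only [frame_inl, lift_fst, inner_single]
    simp
    ring
  · simp [frame_inr]

theorem covDeriv_lift {U : Nil n → Hor n} {ζ : Nil n → ℝ} {U' : Nil n →L[ℝ] Hor n}
    {ζ' : Nil n →L[ℝ] ℝ} {p : Nil n} (hU : HasFDerivAt U U' p) (hζ : HasFDerivAt ζ ζ' p)
    {Y : Nil n → Nil n} (hY : Y =ᶠ[nhds p] fun q => lift q (U q) (ζ q)) (d : Nil n) :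
    covDeriv p d Y =
      lift p (U' d - (1 / 2 : ℝ) • (ζ p • cplx d.1 + contactForm p d • cplx (U p)))
        (ζ' d + 1 / 2 * inner ℝ (cplx d.1) (U p)) := by
  have hc : HasFDerivAt (fun q : Nil n => cplx q.1)
      (cplx.comp (ContinuousLinearMap.fst ℝ (Hor n) ℝ)) p :=
    (cplx.comp (ContinuousLinearMap.fst ℝ (Hor n) ℝ)).hasFDerivAt
  have h2 : HasFDerivAt (fun q => lift q (U q) (ζ q)) _ p :=
    hU.prodMk (hζ.add ((hc.inner ℝ hU).const_mul (1 / 2)))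
  rw [covDeriv, hY.fderiv_eq, h2.fderiv, hY.self_of_nhds, christoffel_eq, contactForm_lift]
  ext1
  · simp only [ContinuousLinearMap.prod_apply, Prod.fst_add, lift_fst]
    module
  · simp [lift, inner_add_right, inner_sub_right, inner_smul_right]
    ring

theorem covDeriv_christoffel (p d v w : Nil n) : covDeriv p d (fun q => christoffel q v w) =
    lift p ((1 / 4 : ℝ) • (inner ℝ w.1 (cplx d.1) • cplx v.1 + inner ℝ v.1 (cplx d.1) • cplx w.1)
      - (1 / 4 : ℝ) • (contactForm p d • (contactForm p w • v.1 + contactForm p v • w.1)))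
      (-(1 / 4) * (contactForm p w * inner ℝ d.1 v.1 + contactForm p v * inner ℝ d.1 w.1)) := by
  have hU := (((hasFDerivAt_contactForm p w).smul_const (cplx v.1)).add
    ((hasFDerivAt_contactForm p v).smul_const (cplx w.1))).const_smul (-(1 / 2 : ℝ))
  rw [covDeriv_lift hU (hasFDerivAt_const (0 : ℝ) p)
    (Filter.Eventually.of_forall fun q => christoffel_eq q v w)]
  congr 1
  · simp only [Pi.smul_apply, Pi.add_apply, map_smul, map_add, cplx_cplx,
      _root_.smul_apply, _root_.add_apply,
      ContinuousLinearMap.smulRight_apply, ContinuousLinearMap.comp_apply, innerSL_apply_apply,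
      ContinuousLinearMap.coe_fst', smul_eq_mul]
    module
  · simp only [Pi.smul_apply, Pi.add_apply, inner_smul_right, inner_add_right, inner_cplx_cplx,
      _root_.zero_apply]
    ring

/-- On horizontal vectors the horizontal frame contributes -3/4 and the vertical one 1/4; on the
vertical direction each of the 2n horizontal frame vectors contributes 1/4. -/
theorem ricci_eq (p v w : Nil n) : ricci p v w =
    -(1 / 2) * inner ℝ v.1 w.1 + (n : ℝ) / 2 * (contactForm p v * contactForm p w) := by
  have hsum : ∀ j : Fin n ⊕ Fin n,
      metric p (curvature p (frame (Sum.inl j) p) v w) (frame (Sum.inl j) p) =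
      -(3 / 4) * (cplx v.1 j * cplx w.1 j) + 1 / 4 * (contactForm p v * contactForm p w) := by
    intro j
    have h1 : (cplx (EuclideanSpace.single j (1 : ℝ)) : Hor n) j = 0 := by
      rw [← inner_single, inner_cplx_self]
    rw [metric_frame_inl, curvature, covDeriv_christoffel, covDeriv_christoffel, lift_sub,
      lift_fst, frame_inl, contactForm_lift, lift_fst]
    have h2 : ∀ u : Hor n, inner ℝ u (cplx (EuclideanSpace.single j (1 : ℝ))) = -cplx u j := by
      intro u
      rw [← inner_single (cplx u), inner_cplx_left, neg_neg]
    have h3 : ∀ u : Hor n, inner ℝ (EuclideanSpace.single j (1 : ℝ)) u = u j := by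
      intro u
      rw [real_inner_comm, inner_single]
    simp only [h2, h3, PiLp.sub_apply, PiLp.smul_apply, PiLp.add_apply, smul_eq_mul, h1,
      PiLp.single_apply]
    simp
    ring
  have hz : metric p (curvature p (frame (Sum.inr ()) p) v w) (frame (Sum.inr ()) p) =
      1 / 4 * inner ℝ v.1 w.1 := by
    rw [metric_frame_inr, curvature, covDeriv_christoffel, covDeriv_christoffel, lift_sub,
      contactForm_lift, frame_inr, contactForm_lift, lift_fst]
    simp
  rw [ricci, Fintype.sum_sum_type]
  simp only [hsum, Finset.univ_unique, Finset.sum_singleton, PUnit.default_eq_unit, hz]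
  rw [Finset.sum_add_distrib, ← Finset.mul_sum, ← inner_eq_sum, inner_cplx_cplx]
  simp
  ring

end Geometry

/-! ## The unit normal -/

section Hypersurface

variable {n : ℕ} {a : ℝ} {I : Set ℝ} {f : ℝ → ℝ}

theorem metric_grad (h : Nil n → ℝ) (p v : Nil n) : metric p (grad h p) v = fderiv ℝ h p v := by
  have h1 : ∀ s : Finset ((Fin n ⊕ Fin n) ⊕ Unit), metric p
      (∑ k ∈ s, fderiv ℝ h p (frame k p) • frame k p) v =
      ∑ k ∈ s, fderiv ℝ h p (frame k p) * metric p v (frame k p) := by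
    intro s
    induction s using Finset.induction_on with
    | empty => simp [metric, contactForm]
    | insert j s hj ih =>
      rw [Finset.sum_insert hj, Finset.sum_insert hj, metric_add_left, ih, metric_smul_left,
        metric_comm p (frame j p)]
  rw [grad, h1]
  conv_rhs => rw [← sum_metric_smul_frame p v, map_sum]
  refine Finset.sum_congr rfl fun k _ => ?_
  rw [map_smul, smul_eq_mul, mul_comm]

theorem hasFDerivAt_norm_fst {q : Nil n} (hq : q.1 ≠ 0) :
    HasFDerivAt (fun q : Nil n => ‖q.1‖)
      (‖q.1‖⁻¹ • (innerSL ℝ q.1).comp (ContinuousLinearMap.fst ℝ (Hor n) ℝ)) q := by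
  have h1 : HasFDerivAt (fun q : Nil n => q.1) (ContinuousLinearMap.fst ℝ (Hor n) ℝ) q :=
    (ContinuousLinearMap.fst ℝ (Hor n) ℝ).hasFDerivAt
  have hpos : 0 < ‖q.1‖ := norm_pos_iff.2 hq
  have h2 := h1.norm_sq.sqrt (by positivity)
  simp only [Real.sqrt_sq (norm_nonneg _)] at h2
  refine h2.congr_fderiv ?_
  ext v <;> (simp; try field_simp)

theorem hasFDerivAt_defining (hf : IsProfile n a I f) {q : Nil n} (hq : q.1 ≠ 0) (hqI : q.2 ∈ I) :
    HasFDerivAt (defining f)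
      (deriv f q.2 • ContinuousLinearMap.snd ℝ (Hor n) ℝ -
        ‖q.1‖⁻¹ • (innerSL ℝ q.1).comp (ContinuousLinearMap.fst ℝ (Hor n) ℝ)) q := by
  have h2 : HasFDerivAt (fun q : Nil n => q.2) (ContinuousLinearMap.snd ℝ (Hor n) ℝ) q :=
    (ContinuousLinearMap.snd ℝ (Hor n) ℝ).hasFDerivAt
  exact ((hf.hasDerivAt hqI).comp_hasFDerivAt q h2).sub (hasFDerivAt_norm_fst hq)

/-- The horizontal part of the gradient of the defining function. -/
def gradHor (f : ℝ → ℝ) (q : Nil n) : Hor n :=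
  -(‖q.1‖⁻¹ • q.1) + (deriv f q.2 / 2) • cplx q.1

theorem grad_defining (hf : IsProfile n a I f) {q : Nil n} (hq : q.1 ≠ 0) (hqI : q.2 ∈ I) :
    grad (defining f) q = lift q (gradHor f q) (deriv f q.2) := by
  rw [grad, sum_smul_frame, (hasFDerivAt_defining hf hq hqI).fderiv]
  congr 1
  · ext j
    simp [frame_inl, lift, gradHor, inner_single]
    ring
  · simp [frame_inr, lift]

theorem metric_grad_defining (hf : IsProfile n a I f) {q : Nil n} (hq : q.1 ≠ 0)
    (hqI : q.2 ∈ I) : metric q (grad (defining f) q) (grad (defining f) q) =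
      1 + deriv f q.2 ^ 2 * (1 + ‖q.1‖ ^ 2 / 4) := by
  have hpos : 0 < ‖q.1‖ := norm_pos_iff.2 hq
  rw [grad_defining hf hq hqI, metric, contactForm_lift, lift_fst, gradHor]
  simp only [inner_add_left, inner_add_right, inner_neg_left, inner_neg_right,
    real_inner_smul_left, real_inner_smul_right, inner_cplx_self, inner_self_cplx,
    inner_cplx_cplx]
  rw [real_inner_self_eq_norm_sq]
  field_simp
  ring

/-- The inverse of the norm of the gradient of the defining function. -/
def invNormGrad (f : ℝ → ℝ) (q : Nil n) : ℝ :=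
  (√(1 + deriv f q.2 ^ 2 * (1 + ‖q.1‖ ^ 2 / 4)))⁻¹

theorem normal_eq (hf : IsProfile n a I f) {q : Nil n} (hq : q.1 ≠ 0) (hqI : q.2 ∈ I) :
    normal f q =
      lift q (invNormGrad f q • gradHor f q) (invNormGrad f q * deriv f q.2) := by
  rw [normal, metric_grad_defining hf hq hqI, grad_defining hf hq hqI, smul_lift]
  rfl

theorem normal_eventuallyEq (hf : IsProfile n a I f) {p : Nil n} (hp : p.1 ≠ 0) (hpI : p.2 ∈ I) :
    normal f =ᶠ[nhds p] fun q =>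
      lift q (invNormGrad f q • gradHor f q) (invNormGrad f q * deriv f q.2) := by
  have h1 : ∀ᶠ q : Nil n in nhds p, q.1 ≠ 0 :=
    continuous_fst.continuousAt.eventually_ne hp
  have h2 : ∀ᶠ q : Nil n in nhds p, q.2 ∈ I :=
    continuous_snd.continuousAt.eventually (hf.isOpen.mem_nhds hpI)
  filter_upwards [h1, h2] with q hq1 hq2 using normal_eq hf hq1 hq2

theorem hasFDerivAt_deriv_snd (hf : IsProfile n a I f) {p : Nil n} (hpI : p.2 ∈ I) :
    HasFDerivAt (fun q : Nil n => deriv f q.2)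
      (deriv (deriv f) p.2 • ContinuousLinearMap.snd ℝ (Hor n) ℝ) p :=
  (hf.hasDerivAt_deriv hpI).comp_hasFDerivAt p (ContinuousLinearMap.snd ℝ (Hor n) ℝ).hasFDerivAt

/-- Only differentiability is needed, not the value of the derivative: it multiplies the gradient,
which is orthogonal to tangent vectors. -/
theorem differentiableAt_invNormGrad (hf : IsProfile n a I f) {p : Nil n} (hp : p.1 ≠ 0)
    (hpI : p.2 ∈ I) : DifferentiableAt ℝ (invNormGrad (n := n) f) p := by
  have h1 := (hasFDerivAt_deriv_snd hf hpI).differentiableAt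
  have h2 := (hasFDerivAt_norm_fst hp).differentiableAt
  unfold invNormGrad
  refine DifferentiableAt.inv (DifferentiableAt.sqrt (by fun_prop) (by positivity)) ?_
  positivity

theorem hasFDerivAt_gradHor (hf : IsProfile n a I f) {p : Nil n} (hp : p.1 ≠ 0)
    (hpI : p.2 ∈ I) : ∃ U' : Nil n →L[ℝ] Hor n, HasFDerivAt (gradHor f) U' p ∧
      ∀ d, U' d = -(‖p.1‖⁻¹ • d.1) + (inner ℝ p.1 d.1 / ‖p.1‖ ^ 3) • p.1
        + (deriv (deriv f) p.2 * d.2 / 2) • cplx p.1 + (deriv f p.2 / 2) • cplx d.1 := by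
  have hpos : 0 < ‖p.1‖ := norm_pos_iff.2 hp
  have h1 : HasFDerivAt (fun q : Nil n => q.1) (ContinuousLinearMap.fst ℝ (Hor n) ℝ) p :=
    (ContinuousLinearMap.fst ℝ (Hor n) ℝ).hasFDerivAt
  have h2 : HasFDerivAt (fun q : Nil n => cplx q.1)
      (cplx.comp (ContinuousLinearMap.fst ℝ (Hor n) ℝ)) p :=
    (cplx.comp (ContinuousLinearMap.fst ℝ (Hor n) ℝ)).hasFDerivAt
  have h3 := (((hasDerivAt_inv hpos.ne').comp_hasFDerivAt p (hasFDerivAt_norm_fst hp)).smul h1).neg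
  have h4 := ((hasFDerivAt_deriv_snd hf hpI).mul_const (1 / 2)).smul h2
  refine ⟨_, (h3.add h4).congr_of_eventuallyEq (Filter.Eventually.of_forall fun q => ?_),
    fun d => ?_⟩
  · simp [gradHor, div_eq_mul_inv]
  · simp [smul_smul]
    have e1 : (‖p.1‖ ^ 2)⁻¹ * ‖p.1‖⁻¹ * inner ℝ p.1 d.1 = inner ℝ p.1 d.1 / ‖p.1‖ ^ 3 := by
      field_simp
    rw [e1]
    module

/-- The second fundamental form on vectors `v` and tangent vectors `w`. -/
theorem secondFF_eq (hf : IsProfile n a I f) {p : Nil n} (hp : p.1 ≠ 0) (hpI : p.2 ∈ I)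
    (v w : Nil n) (hw : fderiv ℝ (defining f) p w = 0) :
    secondFF f p v w = -invNormGrad f p *
      (-(inner ℝ v.1 w.1 / ‖p.1‖) + inner ℝ p.1 v.1 * inner ℝ p.1 w.1 / ‖p.1‖ ^ 3
        + deriv (deriv f) p.2 * v.2 / 2 * inner ℝ (cplx p.1) w.1
        - 1 / 2 * contactForm p v * inner ℝ (cplx (gradHor f p)) w.1
        + (deriv (deriv f) p.2 * v.2 + 1 / 2 * inner ℝ (cplx v.1) (gradHor f p))
          * contactForm p w) := by
  obtain ⟨U', hU, hU'⟩ := hasFDerivAt_gradHor hf hp hpI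
  have hs := (differentiableAt_invNormGrad hf hp hpI).hasFDerivAt
  have h := covDeriv_lift (hs.smul hU) (hs.mul (hasFDerivAt_deriv_snd hf hpI))
    (normal_eventuallyEq hf hp hpI) v
  rw [secondFF, h]
  have ht : inner ℝ (gradHor f p) w.1 + deriv f p.2 * contactForm p w = 0 := by
    rw [← hw, ← metric_grad, grad_defining hf hp hpI, metric, contactForm_lift, lift_fst]
  rw [metric, contactForm_lift, lift_fst]
  simp only [_root_.add_apply, _root_.smul_apply, ContinuousLinearMap.smulRight_apply, hU',
    Pi.smul_apply', Pi.mul_apply,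
    inner_add_left, inner_sub_left, inner_neg_left, real_inner_smul_left, map_smul,
    real_inner_smul_right, ContinuousLinearMap.coe_snd', smul_eq_mul]
  -- The derivative of the normalizing factor drops out here, because w is orthogonal to the
  -- gradient.
  linear_combination -(fderiv ℝ (invNormGrad f) p v) * ht

/-! ### At a point of the hypersurface -/

variable {t : ℝ} {θ : Sph n}

theorem revol_fst (f : ℝ → ℝ) (t : ℝ) (θ : Sph n) : (revol f (t, θ)).1 = f t • (θ : Hor n) := rfl

theorem revol_snd (f : ℝ → ℝ) (t : ℝ) (θ : Sph n) : (revol f (t, θ)).2 = t := rfl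

theorem norm_revol_fst (h : 0 < f t) (θ : Sph n) : ‖(revol f (t, θ)).1‖ = f t := by
  rw [revol_fst, norm_smul, norm_eq_of_mem_sphere, mul_one, Real.norm_of_nonneg h.le]

theorem revol_fst_ne (h : 0 < f t) (θ : Sph n) : (revol f (t, θ)).1 ≠ 0 := by
  rw [← norm_pos_iff, norm_revol_fst h]; exact h

theorem inner_sph_self (θ : Sph n) : inner ℝ (θ : Hor n) (θ : Hor n) = 1 := by
  rw [real_inner_self_eq_norm_sq, norm_eq_of_mem_sphere, one_pow]

theorem invNormGrad_revol (hf : IsProfile n a I f) (hn : 2 ≤ n) (ha : 0 < a) (ht : t ∈ I) :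
    invNormGrad f (revol f (t, θ)) = (weightW n a f t)⁻¹ := by
  rw [invNormGrad, norm_revol_fst (hf.pos t ht), revol_snd,
    ← Real.sqrt_sq (hf.weightW_pos ha ht).le, hf.weightW_sq hn ha ht, weightP]

theorem gradHor_revol (h : 0 < f t) : gradHor f (revol f (t, θ)) =
    -(θ : Hor n) + (f t * deriv f t / 2) • cplx (θ : Hor n) := by
  rw [gradHor, norm_revol_fst h, revol_fst, revol_snd, smul_smul, inv_mul_cancel₀ h.ne',
    one_smul, map_smul, smul_smul]
  congr 2
  ring

theorem normal_revol (hf : IsProfile n a I f) (hn : 2 ≤ n) (ha : 0 < a) (ht : t ∈ I) :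
    normal f (revol f (t, θ)) = lift (revol f (t, θ))
      ((weightW n a f t)⁻¹ • (-(θ : Hor n) + (f t * deriv f t / 2) • cplx (θ : Hor n)))
      ((weightW n a f t)⁻¹ * deriv f t) := by
  have h := hf.pos t ht
  rw [normal_eq hf (revol_fst_ne h θ) ht, invNormGrad_revol hf hn ha ht, gradHor_revol h,
    revol_snd]

theorem metric_normal_self (hf : IsProfile n a I f) (hn : 2 ≤ n) (ha : 0 < a) (ht : t ∈ I) :
    metric (revol f (t, θ)) (normal f (revol f (t, θ))) (normal f (revol f (t, θ))) = 1 := by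
  have hW := hf.weightW_pos ha ht
  have hW2 := hf.weightW_sq hn ha ht
  rw [normal_revol hf hn ha ht, metric, contactForm_lift, lift_fst]
  simp only [inner_add_left, inner_add_right, inner_neg_left, inner_neg_right,
    real_inner_smul_left, real_inner_smul_right, inner_cplx_self, inner_self_cplx,
    inner_cplx_cplx, inner_sph_self]
  field_simp
  rw [hW2, weightP]
  ring

theorem normal_eq_smul_grad (hf : IsProfile n a I f) (hn : 2 ≤ n) (ha : 0 < a) (ht : t ∈ I) :
    normal f (revol f (t, θ)) =
      (weightW n a f t)⁻¹ • grad (defining f) (revol f (t, θ)) := by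
  have h := hf.pos t ht
  rw [normal_eq hf (revol_fst_ne h θ) ht, grad_defining hf (revol_fst_ne h θ) ht, smul_lift,
    invNormGrad_revol hf hn ha ht]

theorem fderiv_defining_eq (hf : IsProfile n a I f) (hn : 2 ≤ n) (ha : 0 < a) (ht : t ∈ I)
    (v : Nil n) : fderiv ℝ (defining f) (revol f (t, θ)) v =
      weightW n a f t * metric (revol f (t, θ)) v (normal f (revol f (t, θ))) := by
  have hW := hf.weightW_pos ha ht
  rw [normal_eq_smul_grad hf hn ha ht, metric_comm, metric_smul_left, metric_grad]
  field_simp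

theorem fderiv_defining_tangential (hf : IsProfile n a I f) (hn : 2 ≤ n) (ha : 0 < a)
    (ht : t ∈ I) (v : Nil n) :
    fderiv ℝ (defining f) (revol f (t, θ)) (tangential f (revol f (t, θ)) v) = 0 := by
  rw [fderiv_defining_eq hf hn ha ht, tangential, metric_comm, metric_sub_right,
    metric_smul_right, metric_normal_self hf hn ha ht, metric_comm]
  ring

end Hypersurface

/-! ## The potential of the Jacobi operator -/

theorem sum_sq_orthonormal {ι : Type*} [Fintype ι] {θ ξ : ι → ℝ} (h1 : ∑ j, θ j * θ j = 1)
    (h2 : ∑ j, ξ j * ξ j = 1) (h3 : ∑ j, θ j * ξ j = 0) (u v : ℝ) :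
    ∑ j, (u * θ j + v * ξ j) ^ 2 = u ^ 2 + v ^ 2 := by
  have : ∀ j, (u * θ j + v * ξ j) ^ 2 =
      u ^ 2 * (θ j * θ j) + v ^ 2 * (ξ j * ξ j) + 2 * u * v * (θ j * ξ j) := fun j => by ring
  simp only [this, Finset.sum_add_distrib, ← Finset.mul_sum, h1, h2, h3]
  ring

/-- Squared Hilbert–Schmidt norm of a block form: k times the identity on the complement of the
plane of θ and ξ, and a 2×2 block on the plane. -/
theorem sum_sum_sq_orthonormal {ι : Type*} [Fintype ι] [DecidableEq ι] {θ ξ : ι → ℝ}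
    (h1 : ∑ j, θ j * θ j = 1) (h2 : ∑ j, ξ j * ξ j = 1) (h3 : ∑ j, θ j * ξ j = 0)
    (k m₁ m₂ m₃ m₄ : ℝ) :
    ∑ j, ∑ l, (k * ((if j = l then 1 else 0) - θ j * θ l - ξ j * ξ l)
      + m₁ * (θ j * θ l) + m₂ * (θ j * ξ l) + m₃ * (ξ j * θ l) + m₄ * (ξ j * ξ l)) ^ 2 =
    k ^ 2 * (Fintype.card ι - 2) + m₁ ^ 2 + m₂ ^ 2 + m₃ ^ 2 + m₄ ^ 2 := by
  have e : ∀ j l, (k * ((if j = l then 1 else 0) - θ j * θ l - ξ j * ξ l)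
      + m₁ * (θ j * θ l) + m₂ * (θ j * ξ l) + m₃ * (ξ j * θ l) + m₄ * (ξ j * ξ l)) ^ 2 =
      (if j = l then k ^ 2 + 2 * k * ((m₁ - k) * (θ j * θ l) + m₂ * (θ j * ξ l)
        + m₃ * (ξ j * θ l) + (m₄ - k) * (ξ j * ξ l)) else 0)
      + (((m₁ - k) * θ j + m₃ * ξ j) * θ l + (m₂ * θ j + (m₄ - k) * ξ j) * ξ l) ^ 2 := by
    intro j l
    split_ifs <;> ring
  simp only [e, Finset.sum_add_distrib, sum_sq_orthonormal h1 h2 h3, Finset.sum_ite_eq,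
    Finset.mem_univ, if_true, ← Finset.mul_sum, h1, h2, h3]
  simp only [mul_comm (ξ _) (θ _), h3]
  simp
  ring

/-- The second fundamental form, up to normalization, on the span of `θ`, `Jθ` and `Z`, where
`F`, `d`, `q` are the values of `f`, `f'`, `f''`. -/
def radialForm (F d q : ℝ) (x y : Fin 3 → ℝ) : ℝ :=
  F * d / 4 * (x 0 * y 2 + x 2 * y 0) + (-1 / F + q * F ^ 2 / 4) * (x 1 * y 1)
    + (F * q / 2 + 1 / 2) * (x 1 * y 2 + x 2 * y 1) + q * (x 2 * y 2)

/-- The squared norm of the projection of a symmetric form to the orthogonal complement of a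
unit vector. -/
theorem sum_sq_proj (A B C D E G : ℝ) {x y z : ℝ} (h : x ^ 2 + y ^ 2 + z ^ 2 = 1) :
    (A - 2 * x * (A * x + D * y + E * z) + x * x * (A * x ^ 2 + B * y ^ 2 + C * z ^ 2
        + 2 * D * x * y + 2 * E * x * z + 2 * G * y * z)) ^ 2
    + (B - 2 * y * (D * x + B * y + G * z) + y * y * (A * x ^ 2 + B * y ^ 2 + C * z ^ 2
        + 2 * D * x * y + 2 * E * x * z + 2 * G * y * z)) ^ 2
    + (C - 2 * z * (E * x + G * y + C * z) + z * z * (A * x ^ 2 + B * y ^ 2 + C * z ^ 2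
        + 2 * D * x * y + 2 * E * x * z + 2 * G * y * z)) ^ 2
    + 2 * (D - x * (D * x + B * y + G * z) - y * (A * x + D * y + E * z)
        + x * y * (A * x ^ 2 + B * y ^ 2 + C * z ^ 2
        + 2 * D * x * y + 2 * E * x * z + 2 * G * y * z)) ^ 2
    + 2 * (E - x * (E * x + G * y + C * z) - z * (A * x + D * y + E * z)
        + x * z * (A * x ^ 2 + B * y ^ 2 + C * z ^ 2
        + 2 * D * x * y + 2 * E * x * z + 2 * G * y * z)) ^ 2
    + 2 * (G - y * (E * x + G * y + C * z) - z * (D * x + B * y + G * z)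
        + y * z * (A * x ^ 2 + B * y ^ 2 + C * z ^ 2
        + 2 * D * x * y + 2 * E * x * z + 2 * G * y * z)) ^ 2
    = A ^ 2 + B ^ 2 + C ^ 2 + 2 * D ^ 2 + 2 * E ^ 2 + 2 * G ^ 2
      - 2 * ((A * x + D * y + E * z) ^ 2 + (D * x + B * y + G * z) ^ 2
        + (E * x + G * y + C * z) ^ 2)
      + (A * x ^ 2 + B * y ^ 2 + C * z ^ 2
        + 2 * D * x * y + 2 * E * x * z + 2 * G * y * z) ^ 2 := by
  -- For the matrix B of the form and the unit vector ν, with Π = 1 - ννᵀ, this is |ΠBΠ|² = |B|² -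
  -- 2|Bν|² + ⟨Bν, ν⟩². The two sides differ by a multiple of |ν|² - 1.
  linear_combination (2 * ((A * x + D * y + E * z) ^ 2 + (D * x + B * y + G * z) ^ 2
        + (E * x + G * y + C * z) ^ 2) + (A * x ^ 2 + B * y ^ 2 + C * z ^ 2
        + 2 * D * x * y + 2 * E * x * z + 2 * G * y * z) ^ 2 * (x ^ 2 + y ^ 2 + z ^ 2 - 3)) * h

section Potential

variable {n : ℕ} {a : ℝ} {I : Set ℝ} {f : ℝ → ℝ} {t : ℝ} {θ : Sph n}

/-- The coordinates with respect to `θ`, `Jθ` and `Z`. -/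
def radialCoord (f : ℝ → ℝ) (t : ℝ) (θ : Sph n) (v : Nil n) : Fin 3 → ℝ :=
  ![inner ℝ (θ : Hor n) v.1, inner ℝ (cplx (θ : Hor n)) v.1, contactForm (revol f (t, θ)) v]

/-- By symmetry the form splits: it is a multiple of the identity on the horizontal vectors
orthogonal to θ and Jθ, which are all tangent, and the rest lives on the three-dimensional span of
θ, Jθ and Z containing the normal. -/
theorem secondFF_revol (hf : IsProfile n a I f) (hn : 2 ≤ n) (ha : 0 < a) (ht : t ∈ I)
    (v w : Nil n) (hw : fderiv ℝ (defining f) (revol f (t, θ)) w = 0) :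
    secondFF f (revol f (t, θ)) v w = -(weightW n a f t)⁻¹ *
      (-1 / f t * (inner ℝ v.1 w.1 - inner ℝ (θ : Hor n) v.1 * inner ℝ (θ : Hor n) w.1
        - inner ℝ (cplx (θ : Hor n)) v.1 * inner ℝ (cplx (θ : Hor n)) w.1)
      + radialForm (f t) (deriv f t) (deriv (deriv f) t) (radialCoord f t θ v)
        (radialCoord f t θ w)) := by
  have h := hf.pos t ht
  have hv2 : v.2 = contactForm (revol f (t, θ)) v
      + 1 / 2 * (f t * inner ℝ (cplx (θ : Hor n)) v.1) := by
    rw [contactForm_eq, revol_fst, map_smul, real_inner_smul_left]; ring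
  rw [secondFF_eq hf (revol_fst_ne h θ) ht v w hw, invNormGrad_revol hf hn ha ht,
    norm_revol_fst h, gradHor_revol h, revol_snd, hv2, revol_fst]
  simp only [map_smul, map_add, map_neg, cplx_cplx, real_inner_smul_left, real_inner_smul_right,
    inner_add_left, inner_add_right, inner_neg_left, inner_neg_right,
    inner_cplx_left v.1, radialForm, radialCoord, Matrix.cons_val_zero, Matrix.cons_val_one,
    Matrix.cons_val, real_inner_comm v.1]
  field_simp
  ring

/-- The components of the unit normal along `θ`, `Jθ` and `Z`. -/
def normalCoord (n : ℕ) (a : ℝ) (f : ℝ → ℝ) (t : ℝ) : Fin 3 → ℝ :=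
  ![-(weightW n a f t)⁻¹, f t * deriv f t / 2 * (weightW n a f t)⁻¹,
    deriv f t * (weightW n a f t)⁻¹]

/-- The projections of the basis vectors `θ`, `Jθ` and `Z` to the complement of the normal. -/
def projCoord (N : Fin 3 → ℝ) (i : Fin 3) : Fin 3 → ℝ :=
  fun k => (if k = i then 1 else 0) - N i * N k

theorem normal_revol' (hf : IsProfile n a I f) (hn : 2 ≤ n) (ha : 0 < a) (ht : t ∈ I) :
    normal f (revol f (t, θ)) = lift (revol f (t, θ))
      (normalCoord n a f t 0 • (θ : Hor n) + normalCoord n a f t 1 • cplx (θ : Hor n))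
      (normalCoord n a f t 2) := by
  rw [normal_revol hf hn ha ht]
  simp only [normalCoord, Matrix.cons_val_zero, Matrix.cons_val_one, Matrix.cons_val]
  congr 1
  · module
  · ring

theorem tangential_inl (hf : IsProfile n a I f) (hn : 2 ≤ n) (ha : 0 < a) (ht : t ∈ I)
    (j : Fin n ⊕ Fin n) :
    tangential f (revol f (t, θ)) (frame (Sum.inl j) (revol f (t, θ))) =
      lift (revol f (t, θ)) (EuclideanSpace.single j (1 : ℝ) -
        (normalCoord n a f t 0 * (θ : Hor n) j + normalCoord n a f t 1 * cplx (θ : Hor n) j) •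
        (normalCoord n a f t 0 • (θ : Hor n) + normalCoord n a f t 1 • cplx (θ : Hor n)))
      (-((normalCoord n a f t 0 * (θ : Hor n) j + normalCoord n a f t 1 * cplx (θ : Hor n) j)
        * normalCoord n a f t 2)) := by
  rw [tangential, metric_comm, metric_frame_inl, normal_revol' hf hn ha ht, frame_inl, smul_lift,
    lift_sub, zero_sub]
  simp

theorem tangential_inr (hf : IsProfile n a I f) (hn : 2 ≤ n) (ha : 0 < a) (ht : t ∈ I) :
    tangential f (revol f (t, θ)) (frame (Sum.inr ()) (revol f (t, θ))) =
      lift (revol f (t, θ)) (-(normalCoord n a f t 2 •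
        (normalCoord n a f t 0 • (θ : Hor n) + normalCoord n a f t 1 • cplx (θ : Hor n))))
      (1 - normalCoord n a f t 2 * normalCoord n a f t 2) := by
  rw [tangential, metric_comm, metric_frame_inr, normal_revol' hf hn ha ht, frame_inr, smul_lift,
    lift_sub, zero_sub]
  simp

theorem radialCoord_tangential_inl (hf : IsProfile n a I f) (hn : 2 ≤ n) (ha : 0 < a)
    (ht : t ∈ I) (j : Fin n ⊕ Fin n) :
    radialCoord f t θ (tangential f (revol f (t, θ)) (frame (Sum.inl j) (revol f (t, θ)))) =
      (θ : Hor n) j • projCoord (normalCoord n a f t) 0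
        + cplx (θ : Hor n) j • projCoord (normalCoord n a f t) 1 := by
  rw [tangential_inl hf hn ha ht, radialCoord]
  ext i
  fin_cases i <;>
  simp only [projCoord, contactForm_lift, lift_fst, inner_sub_right, inner_add_right,
    real_inner_smul_right, inner_single, inner_sph_self, inner_self_cplx, inner_cplx_self,
    inner_cplx_cplx, Pi.add_apply, Pi.smul_apply, smul_eq_mul, Fin.zero_eta, Fin.mk_one,
    Fin.reduceFinMk, Matrix.cons_val_zero, Matrix.cons_val_one, Matrix.cons_val, Fin.reduceEq,
    if_true, if_false] <;> ring

theorem radialCoord_tangential_inr (hf : IsProfile n a I f) (hn : 2 ≤ n) (ha : 0 < a)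
    (ht : t ∈ I) :
    radialCoord f t θ (tangential f (revol f (t, θ)) (frame (Sum.inr ()) (revol f (t, θ)))) =
      projCoord (normalCoord n a f t) 2 := by
  rw [tangential_inr hf hn ha ht, radialCoord]
  ext i
  fin_cases i <;>
  simp only [projCoord, contactForm_lift, lift_fst, inner_neg_right, inner_add_right,
    real_inner_smul_right, inner_sph_self, inner_self_cplx, inner_cplx_self,
    inner_cplx_cplx, Fin.zero_eta, Fin.mk_one,
    Fin.reduceFinMk, Matrix.cons_val_zero, Matrix.cons_val_one, Matrix.cons_val, Fin.reduceEq,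
    if_true, if_false] <;> ring

theorem radialForm_comb (F d q : ℝ) (A B : Fin 3 → ℝ) (x y x' y' : ℝ) :
    radialForm F d q (x • A + y • B) (x' • A + y' • B) = radialForm F d q A A * (x * x')
      + radialForm F d q A B * (x * y') + radialForm F d q B A * (y * x')
      + radialForm F d q B B * (y * y') := by
  simp only [radialForm, Pi.add_apply, Pi.smul_apply, smul_eq_mul]; ring

theorem radialForm_comb_right (F d q : ℝ) (A B C : Fin 3 → ℝ) (x y : ℝ) :
    radialForm F d q C (x • A + y • B) =
      radialForm F d q C A * x + radialForm F d q C B * y := by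
  simp only [radialForm, Pi.add_apply, Pi.smul_apply, smul_eq_mul]; ring

theorem radialForm_comm (F d q : ℝ) (A B : Fin 3 → ℝ) :
    radialForm F d q A B = radialForm F d q B A := by
  simp only [radialForm]; ring

theorem inner_perp (θ : Sph n) (e e' : Hor n) (x y x' y' : ℝ) :
    inner ℝ (e - (x • (θ : Hor n) + y • cplx (θ : Hor n)))
        (e' - (x' • (θ : Hor n) + y' • cplx (θ : Hor n)))
      - inner ℝ (θ : Hor n) (e - (x • (θ : Hor n) + y • cplx (θ : Hor n)))
        * inner ℝ (θ : Hor n) (e' - (x' • (θ : Hor n) + y' • cplx (θ : Hor n)))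
      - inner ℝ (cplx (θ : Hor n)) (e - (x • (θ : Hor n) + y • cplx (θ : Hor n)))
        * inner ℝ (cplx (θ : Hor n)) (e' - (x' • (θ : Hor n) + y' • cplx (θ : Hor n))) =
    inner ℝ e e' - inner ℝ (θ : Hor n) e * inner ℝ (θ : Hor n) e'
      - inner ℝ (cplx (θ : Hor n)) e * inner ℝ (cplx (θ : Hor n)) e' := by
  simp only [inner_sub_left, inner_sub_right, inner_add_left, inner_add_right,
    real_inner_smul_left, real_inner_smul_right, inner_sph_self, inner_self_cplx, inner_cplx_self,
    inner_cplx_cplx, real_inner_comm (θ : Hor n) e, real_inner_comm (cplx (θ : Hor n)) e]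
  ring

/-- The sum over the left-invariant frame is converted to one adapted to θ and Jθ: the block-norm
identities absorb the change of basis. The 2n - 2 directions orthogonal to θ, Jθ and Z contribute
the first term. -/
theorem normSqSecondFF_revol (hf : IsProfile n a I f) (hn : 2 ≤ n) (ha : 0 < a) (ht : t ∈ I) :
    normSqSecondFF f (revol f (t, θ)) = (weightW n a f t)⁻¹ ^ 2 *
      ((2 * n - 2) / f t ^ 2 + ∑ i, ∑ k, radialForm (f t) (deriv f t) (deriv (deriv f) t)
        (projCoord (normalCoord n a f t) i) (projCoord (normalCoord n a f t) k) ^ 2) := by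
  have hθ1 : ∑ j, (θ : Hor n) j * (θ : Hor n) j = 1 := by rw [← inner_eq_sum, inner_sph_self]
  have hθ2 : ∑ j, cplx (θ : Hor n) j * cplx (θ : Hor n) j = 1 := by
    rw [← inner_eq_sum, inner_cplx_cplx, inner_sph_self]
  have hθ3 : ∑ j, (θ : Hor n) j * cplx (θ : Hor n) j = 0 := by
    rw [← inner_eq_sum, inner_self_cplx]
  set b := radialForm (f t) (deriv f t) (deriv (deriv f) t) with hb
  set N := normalCoord n a f t with hN
  set W := weightW n a f t with hW
  have htan := fun k => fderiv_defining_tangential (θ := θ) hf hn ha ht (frame k (revol f (t, θ)))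
  have h11 : ∀ j l, secondFF f (revol f (t, θ))
      (tangential f (revol f (t, θ)) (frame (Sum.inl j) (revol f (t, θ))))
      (tangential f (revol f (t, θ)) (frame (Sum.inl l) (revol f (t, θ)))) ^ 2 = W⁻¹ ^ 2 *
      (-1 / f t * ((if j = l then 1 else 0) - (θ : Hor n) j * (θ : Hor n) l
          - cplx (θ : Hor n) j * cplx (θ : Hor n) l)
        + b (projCoord N 0) (projCoord N 0) * ((θ : Hor n) j * (θ : Hor n) l)
        + b (projCoord N 0) (projCoord N 1) * ((θ : Hor n) j * cplx (θ : Hor n) l)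
        + b (projCoord N 1) (projCoord N 0) * (cplx (θ : Hor n) j * (θ : Hor n) l)
        + b (projCoord N 1) (projCoord N 1) * (cplx (θ : Hor n) j * cplx (θ : Hor n) l)) ^ 2 := by
    intro j l
    rw [secondFF_revol hf hn ha ht _ _ (htan _), radialCoord_tangential_inl hf hn ha ht,
      radialCoord_tangential_inl hf hn ha ht, radialForm_comb, tangential_inl hf hn ha ht,
      tangential_inl hf hn ha ht]
    simp only [lift_fst, smul_add, smul_smul]
    rw [inner_perp, inner_single, inner_single, inner_single, inner_single, inner_single,
      PiLp.single_apply]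
    simp only [eq_comm (a := l)]
    ring
  have h12 : ∀ j, secondFF f (revol f (t, θ))
      (tangential f (revol f (t, θ)) (frame (Sum.inl j) (revol f (t, θ))))
      (tangential f (revol f (t, θ)) (frame (Sum.inr ()) (revol f (t, θ)))) ^ 2 = W⁻¹ ^ 2 *
      (b (projCoord N 2) (projCoord N 0) * (θ : Hor n) j
        + b (projCoord N 2) (projCoord N 1) * cplx (θ : Hor n) j) ^ 2 := by
    intro j
    rw [secondFF_revol hf hn ha ht _ _ (htan _), radialCoord_tangential_inl hf hn ha ht,
      radialCoord_tangential_inr hf hn ha ht, radialForm_comm, radialForm_comb_right,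
      tangential_inl hf hn ha ht, tangential_inr hf hn ha ht]
    simp only [lift_fst, smul_add, smul_smul]
    rw [← zero_sub (_ + _), inner_perp]
    simp only [inner_zero_right]
    ring
  have h21 : ∀ j, secondFF f (revol f (t, θ))
      (tangential f (revol f (t, θ)) (frame (Sum.inr ()) (revol f (t, θ))))
      (tangential f (revol f (t, θ)) (frame (Sum.inl j) (revol f (t, θ)))) ^ 2 = W⁻¹ ^ 2 *
      (b (projCoord N 2) (projCoord N 0) * (θ : Hor n) j
        + b (projCoord N 2) (projCoord N 1) * cplx (θ : Hor n) j) ^ 2 := by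
    intro j
    rw [secondFF_revol hf hn ha ht _ _ (htan _), radialCoord_tangential_inl hf hn ha ht,
      radialCoord_tangential_inr hf hn ha ht, radialForm_comb_right,
      tangential_inl hf hn ha ht, tangential_inr hf hn ha ht]
    simp only [lift_fst, smul_add, smul_smul]
    rw [← zero_sub (_ + _), inner_perp]
    simp only [inner_zero_right, inner_zero_left]
    ring
  have h22 : secondFF f (revol f (t, θ))
      (tangential f (revol f (t, θ)) (frame (Sum.inr ()) (revol f (t, θ))))
      (tangential f (revol f (t, θ)) (frame (Sum.inr ()) (revol f (t, θ)))) ^ 2 = W⁻¹ ^ 2 *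
      b (projCoord N 2) (projCoord N 2) ^ 2 := by
    rw [secondFF_revol hf hn ha ht _ _ (htan _),
      radialCoord_tangential_inr hf hn ha ht, tangential_inr hf hn ha ht]
    simp only [lift_fst, smul_add, smul_smul]
    rw [← zero_sub (_ + _), inner_perp]
    simp only [inner_zero_right]
    ring
  rw [normSqSecondFF]
  simp only [Fintype.sum_sum_type (α₁ := Fin n ⊕ Fin n), Finset.univ_unique,
    Finset.sum_singleton, PUnit.default_eq_unit, h11, h12, h21, h22, Finset.sum_add_distrib,
    ← Finset.mul_sum, sum_sum_sq_orthonormal hθ1 hθ2 hθ3, sum_sq_orthonormal hθ1 hθ2 hθ3]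
  simp only [Fin.sum_univ_three, hb, radialForm_comm _ _ _ (projCoord N 0) (projCoord N 2),
    radialForm_comm _ _ _ (projCoord N 1) (projCoord N 2)]
  simp
  ring

/-- The potential of the Jacobi operator as a function of the height, multiplied by `W²`. -/
def jacobiPotential (n : ℕ) (f : ℝ → ℝ) (t : ℝ) : ℝ :=
  (2 * f t ^ 2 * deriv f t ^ 2 + 2 * f t ^ 3 * deriv (deriv f) t
    + 2 * n * (4 * (2 * (n : ℝ) - 1) - f t ^ 2 * deriv f t ^ 2)) / (4 * f t ^ 2)

theorem sum_sq_radialForm (F d q : ℝ) {N : Fin 3 → ℝ}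
    (h : N 0 ^ 2 + N 1 ^ 2 + N 2 ^ 2 = 1) :
    ∑ i, ∑ k, radialForm F d q (projCoord N i) (projCoord N k) ^ 2 =
      (-1 / F + q * F ^ 2 / 4) ^ 2 + q ^ 2 + 2 * (F * d / 4) ^ 2 + 2 * (F * q / 2 + 1 / 2) ^ 2
      - 2 * ((F * d / 4 * N 2) ^ 2
        + ((-1 / F + q * F ^ 2 / 4) * N 1 + (F * q / 2 + 1 / 2) * N 2) ^ 2
        + (F * d / 4 * N 0 + (F * q / 2 + 1 / 2) * N 1 + q * N 2) ^ 2)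
      + ((-1 / F + q * F ^ 2 / 4) * N 1 ^ 2 + q * N 2 ^ 2 + 2 * (F * d / 4) * N 0 * N 2
        + 2 * (F * q / 2 + 1 / 2) * N 1 * N 2) ^ 2 := by
  have hproj := sum_sq_proj 0 (-1 / F + q * F ^ 2 / 4) q 0 (F * d / 4) (F * q / 2 + 1 / 2) h
  refine Eq.trans ?_ (hproj.trans ?_)
  · simp only [Fin.sum_univ_three, radialForm, projCoord, Fin.reduceEq, if_true, if_false]
    generalize -1 / F + q * F ^ 2 / 4 = B
    generalize F * q / 2 + 1 / 2 = G
    generalize F * d / 4 = E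
    ring
  · ring

theorem potential_identity {F d q m w : ℝ} (hF : 0 < F) (hw : w = 1 + d ^ 2 * (1 + F ^ 2 / 4))
    (hq : q = (4 * (2 * m - 1) * (1 + d ^ 2) + (2 * m - 2) * F ^ 2 * d ^ 2)
      / (F * (4 + F ^ 2))) :
    (2 * m - 2) / F ^ 2 + ((-1 / F + q * F ^ 2 / 4) ^ 2 + q ^ 2 + 2 * (F * d / 4) ^ 2
        + 2 * (F * q / 2 + 1 / 2) ^ 2
      - 2 * ((F * d / 4 * d) ^ 2
        + ((-1 / F + q * F ^ 2 / 4) * (F * d / 2) + (F * q / 2 + 1 / 2) * d) ^ 2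
        + (-(F * d / 4) + (F * q / 2 + 1 / 2) * (F * d / 2) + q * d) ^ 2) / w
      + ((-1 / F + q * F ^ 2 / 4) * (F * d / 2) ^ 2 + q * d ^ 2 - 2 * (F * d / 4) * d
        + 2 * (F * q / 2 + 1 / 2) * (F * d / 2) * d) ^ 2 / w ^ 2)
      - 1 / 2 * (w - d ^ 2) + m / 2 * d ^ 2 =
    (2 * F ^ 2 * d ^ 2 + 2 * F ^ 3 * q + 2 * m * (4 * (2 * m - 1) - F ^ 2 * d ^ 2))
      / (4 * F ^ 2) := by
  have hw0 : 0 < w := by rw [hw]; positivity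
  -- This is minimality: the value of the form on the unit normal equals its full trace, -(2m-2)/F
  -- included, so the trace over the tangent space is zero. It removes the quartic term in the
  -- normal.
  have hk : (-1 / F + q * F ^ 2 / 4) * (F * d / 2) ^ 2 + q * d ^ 2 - 2 * (F * d / 4) * d
        + 2 * (F * q / 2 + 1 / 2) * (F * d / 2) * d =
      w * (-1 / F + q * F ^ 2 / 4 + q - (2 * m - 2) / F) := by
    rw [hw, hq]; field_simp; ring
  rw [hk, mul_pow w, mul_div_cancel_left₀ _ (by positivity : w ^ 2 ≠ 0), hq, hw]
  field_simp
  ring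

theorem potential_revol (hf : IsProfile n a I f) (hn : 2 ≤ n) (ha : 0 < a) (ht : t ∈ I) :
    potential f (revol f (t, θ)) = jacobiPotential n f t / weightW n a f t ^ 2 := by
  have h := hf.pos t ht
  have hW := hf.weightW_pos ha ht
  have hW2 := hf.weightW_sq hn ha ht
  have hunit : normalCoord n a f t 0 ^ 2 + normalCoord n a f t 1 ^ 2
      + normalCoord n a f t 2 ^ 2 = 1 := by
    simp only [normalCoord, Matrix.cons_val_zero, Matrix.cons_val_one, Matrix.cons_val]
    field_simp
    rw [hW2, weightP]; ring
  rw [potential, normSqSecondFF_revol hf hn ha ht, sum_sq_radialForm _ _ _ hunit, ricci_eq,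
    normal_revol hf hn ha ht, contactForm_lift, lift_fst, jacobiPotential,
    ← potential_identity h (hW2.trans (by rw [weightP])) (hf.ode' ht)]
  simp only [normalCoord, Matrix.cons_val_zero, Matrix.cons_val_one, Matrix.cons_val,
    inner_add_left, inner_add_right, inner_neg_left, inner_neg_right,
    real_inner_smul_left, real_inner_smul_right, inner_cplx_self, inner_self_cplx,
    inner_cplx_cplx, inner_sph_self]
  rw [show weightW n a f t ^ 2 - deriv f t ^ 2 = 1 + (f t * deriv f t / 2) ^ 2 by
    rw [hW2, weightP]; ring]
  field_simp
  ring

end Potential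

/-! ## The density of the Riemannian measure -/

section Density

variable {n : ℕ} {a : ℝ} {I : Set ℝ} {f : ℝ → ℝ} {t : ℝ} {θ : Sph n}

/-- The Gram matrix is diagonal plus the rank-one contribution of the contact form. The
factorization extracts the scale F and the column c, leaving a middle factor with identity block,
whose determinant is a scalar Schur complement. -/
theorem det_gram {ι : Type*} [Fintype ι] [DecidableEq ι] (c : ι → ℝ) {F d : ℝ} (hF : F ≠ 0) :
    Matrix.det (Matrix.fromBlocks (Matrix.of fun _ _ : Unit => 1 + d ^ 2)
      (Matrix.of fun (_ : Unit) i => c i) (Matrix.of fun i (_ : Unit) => c i)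
      (Matrix.of fun i j => (if i = j then F ^ 2 else 0) + c i * c j)) =
    (F ^ Fintype.card ι) ^ 2 * (1 + d ^ 2 + d ^ 2 * (∑ i, c i ^ 2) / F ^ 2) := by
  have h : Matrix.fromBlocks (Matrix.of fun _ _ : Unit => 1 + d ^ 2)
      (Matrix.of fun (_ : Unit) i => c i) (Matrix.of fun i (_ : Unit) => c i)
      (Matrix.of fun i j => (if i = j then F ^ 2 else 0) + c i * c j) =
    Matrix.fromBlocks (1 : Matrix Unit Unit ℝ) 0 (Matrix.of fun i (_ : Unit) => c i)
      (F • (1 : Matrix ι ι ℝ)) *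
    (Matrix.fromBlocks (Matrix.of fun _ _ : Unit => 1 + d ^ 2)
      (Matrix.of fun (_ : Unit) i => c i / F) (Matrix.of fun i (_ : Unit) => -(d ^ 2 * c i / F))
      (1 : Matrix ι ι ℝ) *
    Matrix.fromBlocks (1 : Matrix Unit Unit ℝ) 0 0 (F • (1 : Matrix ι ι ℝ))) := by
    rw [Matrix.fromBlocks_multiply, Matrix.fromBlocks_multiply]
    congr 1
    · simp
    · ext i j
      simp
      field_simp
    · ext i j
      simp [Matrix.mul_apply]
      field_simp
      ring
    · ext i j
      simp [Matrix.mul_apply, Matrix.one_apply]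
      split_ifs <;> field_simp <;> ring
  rw [h, Matrix.det_mul, Matrix.det_mul, Matrix.det_fromBlocks_zero₁₂, Matrix.det_fromBlocks_one₂₂,
    Matrix.det_fromBlocks_zero₁₂, Matrix.det_one, Matrix.det_smul, Matrix.det_one,
    Matrix.det_unique]
  simp only [Matrix.sub_apply, Matrix.mul_apply, Matrix.of_apply]
  have : ∀ i, c i / F * -(d ^ 2 * c i / F) = -(d ^ 2 / F ^ 2) * c i ^ 2 := fun i => by
    field_simp
  simp only [this, ← Finset.mul_sum]
  ring

theorem tangentMap_eq (hf : IsProfile n a I f) (ht : t ∈ I) (ξ : ℝ × Hor n) :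
    tangentMap f (t, θ) ξ = ((deriv f t * ξ.1) • (θ : Hor n) + f t • ξ.2, ξ.1) := by
  have h1 : HasFDerivAt (fun r : ℝ × Hor n => r.1) (ContinuousLinearMap.fst ℝ ℝ (Hor n))
      (t, (θ : Hor n)) := (ContinuousLinearMap.fst ℝ ℝ (Hor n)).hasFDerivAt
  have h2 : HasFDerivAt (fun r : ℝ × Hor n => r.2) (ContinuousLinearMap.snd ℝ ℝ (Hor n))
      (t, (θ : Hor n)) := (ContinuousLinearMap.snd ℝ ℝ (Hor n)).hasFDerivAt
  have h3 : HasFDerivAt (fun r : ℝ × Hor n => f r.1)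
      (deriv f t • ContinuousLinearMap.fst ℝ ℝ (Hor n)) (t, (θ : Hor n)) :=
    (hf.hasDerivAt ht).comp_hasFDerivAt (t, (θ : Hor n)) h1
  have h := (h3.smul h2).prodMk h1
  have h' : HasFDerivAt (fun r : ℝ × Hor n => ((f r.1 • r.2, r.1) : Nil n)) _
      (t, (θ : Hor n)) := h
  rw [tangentMap, h'.fderiv]
  ext1
  · simp [add_comm]
  · simp

theorem finrank_orthogonal_sph (θ : Sph n) (hn : 2 ≤ n) :
    Module.finrank ℝ (Submodule.span ℝ {(θ : Hor n)})ᗮ = 2 * n - 1 := by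
  have hdim : Module.finrank ℝ (Hor n) = (2 * n - 1) + 1 := by
    simp; omega
  have : Fact (Module.finrank ℝ (Hor n) = (2 * n - 1) + 1) := ⟨hdim⟩
  refine Submodule.finrank_orthogonal_span_singleton ?_
  rw [← norm_pos_iff, norm_eq_of_mem_sphere]
  exact one_pos

/-- The determinant is (f^(2n-1))² W² by the first integral, and f^(2n-1) = a^(2n-1) W. The second
factor W is what later cancels the W² in the denominators of the potential and of the gradient. -/
theorem density_eq (hf : IsProfile n a I f) (hn : 2 ≤ n) (ha : 0 < a) (ht : t ∈ I) :
    density f (t, θ) = a ^ (2 * n - 1) * weightW n a f t ^ 2 := by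
  have h := hf.pos t ht
  have hW := hf.weightW_pos ha ht
  set V := (Submodule.span ℝ {(θ : Hor n)})ᗮ
  set b := stdOrthonormalBasis ℝ V with hb
  set c : Fin (Module.finrank ℝ V) → ℝ :=
    fun i => -(f t ^ 2 / 2 * inner ℝ (cplx (θ : Hor n)) (b i : Hor n)) with hc
  have horth : ∀ v : V, inner ℝ (θ : Hor n) (v : Hor n) = 0 := fun v =>
    (Submodule.mem_orthogonal_singleton_iff_inner_right).1 v.2
  have horth' : ∀ v : V, inner ℝ (v : Hor n) (θ : Hor n) = 0 := fun v => by
    rw [real_inner_comm, horth]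
  let e : Unit ⊕ Fin (Module.finrank ℝ V) ≃ Option (Fin (Module.finrank ℝ V)) :=
    (Equiv.sumComm _ _).trans (Equiv.optionEquivSumPUnit _).symm
  have hG : (Matrix.of fun i j => metric (revol f (t, θ)) (tangentMap f (t, θ) (productFrame θ i))
      (tangentMap f (t, θ) (productFrame θ j))).submatrix e e =
      Matrix.fromBlocks (Matrix.of fun _ _ : Unit => 1 + deriv f t ^ 2)
      (Matrix.of fun (_ : Unit) i => c i) (Matrix.of fun i (_ : Unit) => c i)
      (Matrix.of fun i j => (if i = j then f t ^ 2 else 0) + c i * c j) := by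
    ext i j
    rcases i with i | i <;> rcases j with j | j <;>
    simp only [e, Matrix.submatrix_apply, Matrix.of_apply, Equiv.trans_apply, Equiv.sumComm_apply,
      Sum.swap_inl, Sum.swap_inr, Equiv.optionEquivSumPUnit_symm_inr,
      Equiv.optionEquivSumPUnit_symm_inl, productFrame, tangentMap_eq hf ht, metric,
      contactForm_eq, revol_fst, map_smul, Matrix.fromBlocks_apply₁₁, Matrix.fromBlocks_apply₁₂,
      Matrix.fromBlocks_apply₂₁, Matrix.fromBlocks_apply₂₂, mul_one, mul_zero, zero_smul, zero_add,
      smul_zero, add_zero, real_inner_smul_left, real_inner_smul_right, inner_cplx_self,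
      inner_sph_self]
    · ring
    · change _ * (_ * inner ℝ (θ : Hor n) (b j : Hor n)) + _ = c j
      rw [horth, hc]
      change _ + (1 - _) * (0 - 1 / 2 * (f t * (f t * inner ℝ (cplx (θ : Hor n)) (b j : Hor n))))
        = _
      ring
    · change _ * (_ * inner ℝ (b i : Hor n) (θ : Hor n)) + _ = c i
      rw [horth', hc]
      change _ + (0 - 1 / 2 * (f t * (f t * inner ℝ (cplx (θ : Hor n)) (b i : Hor n)))) * _ = _
      ring
    · have hbb : inner ℝ (b i : Hor n) (b j : Hor n) = if i = j then 1 else 0 := by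
        rw [← Submodule.coe_inner]
        exact orthonormal_iff_ite.1 b.orthonormal i j
      change f t * (f t * inner ℝ (b i : Hor n) (b j : Hor n)) + _ = _
      rw [hbb, hc]
      change _ + (0 - 1 / 2 * (f t * (f t * inner ℝ (cplx (θ : Hor n)) (b i : Hor n)))) *
        (0 - 1 / 2 * (f t * (f t * inner ℝ (cplx (θ : Hor n)) (b j : Hor n)))) = _
      split_ifs <;> ring
  -- The contact form restricted to the sphere is pairing with Jθ, itself a unit tangent vector of
  -- the sphere, so Parseval evaluates the sum of the squares of c.
  have hJ : cplx (θ : Hor n) ∈ V := by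
    rw [Submodule.mem_orthogonal_singleton_iff_inner_right, inner_self_cplx]
  have hsum : ∑ i, c i ^ 2 = f t ^ 4 / 4 := by
    have h1 := b.sum_sq_inner_left (⟨cplx (θ : Hor n), hJ⟩ : V)
    have h2 : ‖(⟨cplx (θ : Hor n), hJ⟩ : V)‖ ^ 2 = 1 := by
      rw [← real_inner_self_eq_norm_sq, Submodule.coe_inner, inner_cplx_cplx, inner_sph_self]
    rw [h2] at h1
    have h3 : ∀ i, c i ^ 2 =
        f t ^ 4 / 4 * inner ℝ (⟨cplx (θ : Hor n), hJ⟩ : V) (b i) ^ 2 := fun i => by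
      rw [hc, Submodule.coe_inner]; ring
    simp only [h3, ← Finset.mul_sum, h1, mul_one]
  have hk : Module.finrank ℝ V = 2 * n - 1 := finrank_orthogonal_sph θ hn
  rw [density, ← Matrix.det_submatrix_equiv_self e]
  change √(Matrix.det (Matrix.submatrix (Matrix.of fun i j => metric (revol f (t, θ))
    (tangentMap f (t, θ) (productFrame θ i)) (tangentMap f (t, θ) (productFrame θ j))) e e)) = _
  rw [hG, det_gram c h.ne', hsum, Fintype.card_fin, hk]
  have e1 : 1 + deriv f t ^ 2 + deriv f t ^ 2 * (f t ^ 4 / 4) / f t ^ 2 = weightW n a f t ^ 2 := by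
    rw [hf.weightW_sq hn ha ht, weightP]; field_simp; ring
  have e2 : f t ^ (2 * n - 1) = a ^ (2 * n - 1) * weightW n a f t := by
    rw [weightW, div_pow]; field_simp
  rw [e1, ← mul_pow, Real.sqrt_sq (by positivity), e2]
  ring

end Density

/-! ## Gradients on the hypersurface -/

section Gradient

variable {n : ℕ} {a : ℝ} {I : Set ℝ} {f : ℝ → ℝ} {t : ℝ} {θ : Sph n}

theorem sum_metric_mul_metric (p v w : Nil n) :
    ∑ k, metric p v (frame k p) * metric p w (frame k p) = metric p v w := by
  rw [Fintype.sum_sum_type]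
  simp only [metric_frame_inl, Finset.univ_unique, Finset.sum_singleton, PUnit.default_eq_unit,
    metric_frame_inr]
  rw [← inner_eq_sum, metric]

theorem sum_metric_mul_apply (p v : Nil n) (L : Nil n →L[ℝ] ℝ) :
    ∑ k, metric p v (frame k p) * L (frame k p) = L v := by
  conv_rhs => rw [← sum_metric_smul_frame p v, map_sum]
  simp

/-- The tangent vector orthogonal to the slices `t = const` with vertical component `1`. -/
def slopeVec (f : ℝ → ℝ) (t : ℝ) (θ : Sph n) : Nil n :=
  (deriv f t • (θ : Hor n) + (2 / (4 + f t ^ 2) * f t) • cplx (θ : Hor n), 1)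

theorem metric_slopeVec_self (hf : IsProfile n a I f) (hn : 2 ≤ n) (ha : 0 < a) (ht : t ∈ I) :
    metric (revol f (t, θ)) (slopeVec f t θ) (slopeVec f t θ) =
      weightW n a f t ^ 2 / weightP f t := by
  rw [hf.weightW_sq hn ha ht, metric, contactForm_eq, slopeVec, revol_fst, weightP]
  simp only [map_smul, inner_add_left, inner_add_right,
    real_inner_smul_left, real_inner_smul_right, inner_cplx_self, inner_self_cplx,
    inner_cplx_cplx, inner_sph_self]
  field_simp
  ring

theorem metric_slopeVec_normal (hf : IsProfile n a I f) (hn : 2 ≤ n) (ha : 0 < a) (ht : t ∈ I) :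
    metric (revol f (t, θ)) (slopeVec f t θ) (normal f (revol f (t, θ))) = 0 := by
  rw [normal_revol hf hn ha ht, metric, contactForm_lift, contactForm_eq, slopeVec, revol_fst,
    lift_fst]
  simp only [map_smul, inner_add_left, inner_add_right, inner_neg_right,
    real_inner_smul_left, real_inner_smul_right, inner_cplx_self, inner_self_cplx,
    inner_cplx_cplx, inner_sph_self]
  field_simp
  ring

/-- The derivative along `slopeVec` bounds the gradient from below. -/
theorem sq_apply_slopeVec_le (hf : IsProfile n a I f) (hn : 2 ≤ n) (ha : 0 < a) (ht : t ∈ I)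
    (u : Nil n → ℝ) : weightP f t * (fderiv ℝ u (revol f (t, θ)) (slopeVec f t θ)) ^ 2 ≤
      weightW n a f t ^ 2 * normSqTangentialGrad f u (revol f (t, θ)) := by
  set p := revol f (t, θ) with hp
  set L := fderiv ℝ u p
  have h1 : L (slopeVec f t θ) =
      ∑ k, metric p (slopeVec f t θ) (frame k p) * L (tangential f p (frame k p)) := by
    have : ∀ k, metric p (slopeVec f t θ) (frame k p) * L (tangential f p (frame k p)) =
        metric p (slopeVec f t θ) (frame k p) * L (frame k p) - metric p (slopeVec f t θ)
          (frame k p) * metric p (normal f p) (frame k p) * L (normal f p) := fun k => by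
      rw [tangential, map_sub, map_smul, smul_eq_mul, metric_comm p (normal f p)]; ring
    simp only [this, Finset.sum_sub_distrib, ← Finset.sum_mul, sum_metric_mul_metric,
      sum_metric_mul_apply]
    rw [metric_slopeVec_normal hf hn ha ht]
    ring
  -- Cauchy–Schwarz against a tangent vector of squared length W²/P. For functions of the height it
  -- is an equality, so nothing is lost on the fields that matter.
  have h2 := Finset.sum_mul_sq_le_sq_mul_sq Finset.univ
    (fun k => metric p (slopeVec f t θ) (frame k p)) (fun k => L (tangential f p (frame k p)))
  rw [← h1] at h2
  simp only [sq (metric _ _ _), sum_metric_mul_metric] at h2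
  rw [metric_slopeVec_self hf hn ha ht] at h2
  have hP := weightP_pos f t
  calc weightP f t * L (slopeVec f t θ) ^ 2
      ≤ weightP f t * (weightW n a f t ^ 2 / weightP f t *
        ∑ k, L (tangential f p (frame k p)) ^ 2) := by gcongr
    _ = _ := by rw [normSqTangentialGrad]; field_simp; rfl

/-- The gradient of a function of the height. -/
theorem normSqTangentialGrad_height (hf : IsProfile n a I f) (hn : 2 ≤ n) (ha : 0 < a)
    (ht : t ∈ I) {χ : ℝ → ℝ} (hχ : DifferentiableAt ℝ χ t) :
    weightW n a f t ^ 2 * normSqTangentialGrad f (fun p => χ p.2) (revol f (t, θ)) =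
      weightP f t * deriv χ t ^ 2 := by
  have h := hf.pos t ht
  have hW := hf.weightW_pos ha ht
  set p := revol f (t, θ) with hp
  have hu : HasFDerivAt (fun p : Nil n => χ p.2)
      (deriv χ t • ContinuousLinearMap.snd ℝ (Hor n) ℝ) p :=
    HasDerivAt.comp_hasFDerivAt p (by exact hχ.hasDerivAt)
      (ContinuousLinearMap.snd ℝ (Hor n) ℝ).hasFDerivAt
  have hf2 : ∀ k, (tangential f p (frame k p)).2 =
      (frame k p).2 - metric p (normal f p) (frame k p) * (normal f p).2 := fun k => by
    rw [metric_comm]; rfl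
  have h1 : ∑ k, metric p (normal f p) (frame k p) * (frame k p).2 = (normal f p).2 :=
    sum_metric_mul_apply p _ (ContinuousLinearMap.snd ℝ (Hor n) ℝ)
  have h2 : ∑ k, metric p (normal f p) (frame k p) * metric p (normal f p) (frame k p) = 1 := by
    rw [sum_metric_mul_metric, metric_normal_self hf hn ha ht]
  have h3 : ∑ k, (frame k p).2 ^ 2 = weightP f t := by
    rw [Fintype.sum_sum_type]
    simp only [frame_inl, frame_inr, Finset.univ_unique, Finset.sum_singleton,
      PUnit.default_eq_unit, lift, inner_single, inner_zero_right, zero_add, mul_pow,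
      ← Finset.mul_sum]
    have : ∑ j, cplx p.1 j ^ 2 = f t ^ 2 := by
      simp only [sq (cplx _ _)]
      rw [← inner_eq_sum, inner_cplx_cplx, real_inner_self_eq_norm_sq, norm_revol_fst h]
    rw [this, weightP]
    ring
  have h4 : (normal f p).2 = deriv f t * weightP f t / weightW n a f t := by
    rw [normal_revol hf hn ha ht, lift, revol_fst, map_smul, real_inner_smul_left]
    simp only [inner_add_right, inner_neg_right,
      real_inner_smul_right, inner_cplx_self, inner_cplx_cplx, inner_sph_self]
    rw [weightP]
    field_simp
    ring
  have h5 : ∀ k, ((frame k p).2 - metric p (normal f p) (frame k p) * (normal f p).2) ^ 2 =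
      (frame k p).2 ^ 2 - 2 * (normal f p).2 * (metric p (normal f p) (frame k p) * (frame k p).2)
      + (normal f p).2 ^ 2 * (metric p (normal f p) (frame k p) * metric p (normal f p)
        (frame k p)) := fun k => by ring
  rw [normSqTangentialGrad, hu.fderiv]
  simp only [_root_.smul_apply, ContinuousLinearMap.coe_snd', smul_eq_mul, hf2, mul_pow,
    ← Finset.mul_sum, h5, Finset.sum_add_distrib, Finset.sum_sub_distrib, h1, h2, h3]
  rw [h4]
  have hW2 := hf.weightW_sq hn ha ht
  have hd : deriv f t ^ 2 * weightP f t = weightW n a f t ^ 2 - 1 := by rw [hW2]; ring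
  field_simp
  linear_combination (-weightP f t * deriv χ t ^ 2) * hd

/-- The tangential derivatives of a function vanish where it vanishes on the hypersurface. -/
theorem fderiv_apply_eq_zero (hf : IsProfile n a I f) (ht : t ∈ I) {u : Nil n → ℝ}
    (hu : DifferentiableAt ℝ u (revol f (t, θ)))
    (hz : ∀ᶠ p in nhds (revol f (t, θ)), p ∈ revol f '' (I ×ˢ univ) → u p = 0) {v : Nil n}
    (hv : fderiv ℝ (defining f) (revol f (t, θ)) v = 0) :
    fderiv ℝ u (revol f (t, θ)) v = 0 := by
  have h := hf.pos t ht
  have hne := revol_fst_ne h θ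
  set p := revol f (t, θ) with hp
  have hv' : deriv f t * v.2 = inner ℝ (θ : Hor n) v.1 := by
    rw [(hasFDerivAt_defining hf hne ht).fderiv] at hv
    simp only [sub_apply, _root_.smul_apply, ContinuousLinearMap.coe_snd', smul_eq_mul,
      ContinuousLinearMap.comp_apply, ContinuousLinearMap.coe_fst', innerSL_apply_apply] at hv
    rw [norm_revol_fst h, revol_fst, real_inner_smul_left, revol_snd,
      inv_mul_cancel_left₀ h.ne'] at hv
    linarith
  -- The straight line through p in direction v, projected radially back to the hypersurface;
  -- tangency of v makes its velocity at 0 equal to v. The detour is needed because u is controlled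
  -- only on the hypersurface.
  set γ : ℝ → Nil n := fun s =>
    (f (t + s * v.2) • (‖p.1 + s • v.1‖⁻¹ • (p.1 + s • v.1)), t + s * v.2) with hγ
  have hγ0 : γ 0 = p := by
    simp only [hγ, zero_mul, add_zero, zero_smul]
    rw [norm_revol_fst h, revol_fst, smul_smul, smul_smul, mul_inv_cancel₀ h.ne', one_mul]
    rfl
  have hline : HasDerivAt (fun s : ℝ => p.1 + s • v.1) v.1 0 := by
    simpa using ((hasDerivAt_id (0 : ℝ)).smul_const v.1).const_add p.1
  have hline2 : HasDerivAt (fun s : ℝ => t + s * v.2) v.2 0 := by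
    simpa using ((hasDerivAt_id (0 : ℝ)).mul_const v.2).const_add t
  have hnorm : HasDerivAt (fun s : ℝ => ‖p.1 + s • v.1‖) (inner ℝ (θ : Hor n) v.1) 0 := by
    have h1 := hline.norm_sq.sqrt (by simpa using hne)
    simp only [Real.sqrt_sq (norm_nonneg _), zero_smul, add_zero] at h1
    refine h1.congr_deriv ?_
    rw [norm_revol_fst h, revol_fst, real_inner_smul_left]
    field_simp
  have hγd : HasDerivAt γ v 0 := by
    have h1 : HasDerivAt (fun s : ℝ => f (t + s * v.2)) (deriv f t * v.2) 0 :=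
      HasDerivAt.comp 0 (by simpa using hf.hasDerivAt ht) hline2
    have h2 := (h1.smul ((hnorm.inv (by simpa using hne)).smul hline)).prodMk hline2
    refine HasDerivAt.congr_deriv h2 ?_
    ext1
    · simp only [zero_smul, add_zero, zero_mul, Pi.smul_apply', Pi.inv_apply]
      rw [norm_revol_fst h, revol_fst, hv']
      simp only [smul_add, smul_smul]
      rw [mul_inv_cancel₀ h.ne', one_smul,
        show f t * (-inner ℝ (θ : Hor n) v.1 / f t ^ 2 * f t) = -inner ℝ (θ : Hor n) v.1 by
          field_simp, show inner ℝ (θ : Hor n) v.1 * ((f t)⁻¹ * f t) = inner ℝ (θ : Hor n) v.1 by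
          field_simp]
      module
    · rfl
  have hmem : ∀ᶠ s in nhds (0 : ℝ), γ s ∈ revol f '' (I ×ˢ univ) := by
    have h1 : ∀ᶠ s in nhds (0 : ℝ), t + s * v.2 ∈ I :=
      hline2.continuousAt.eventually (by simpa using hf.isOpen.mem_nhds ht)
    have h2 : ∀ᶠ s in nhds (0 : ℝ), p.1 + s • v.1 ≠ 0 :=
      hline.continuousAt.eventually_ne (by simpa using hne)
    filter_upwards [h1, h2] with s hs1 hs2
    refine ⟨(t + s * v.2, ⟨‖p.1 + s • v.1‖⁻¹ • (p.1 + s • v.1), ?_⟩), ⟨hs1, mem_univ _⟩, rfl⟩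
    rw [mem_sphere_zero_iff_norm, norm_smul, norm_inv, norm_norm,
      inv_mul_cancel₀ (norm_ne_zero_iff.2 hs2)]
  have hcomp : HasDerivAt (u ∘ γ) (fderiv ℝ u p v) 0 :=
    HasFDerivAt.comp_hasDerivAt 0 (by rw [hγ0]; exact hu.hasFDerivAt) hγd
  have hzero : u ∘ γ =ᶠ[nhds 0] fun _ => 0 := by
    have hz' : ∀ᶠ s in nhds (0 : ℝ), γ s ∈ revol f '' (I ×ˢ univ) → u (γ s) = 0 :=
      hγd.continuousAt.eventually (by rw [hγ0]; exact hz)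
    filter_upwards [hz', hmem] with s h1 h2 using h1 h2
  rw [← hcomp.deriv, hzero.deriv_eq, deriv_const]

theorem continuousOn_revol (hf : IsProfile n a I f) :
    ContinuousOn (revol (n := n) f) (I ×ˢ univ) := by
  have h1 : ContinuousOn (fun q : ℝ × Sph n => f q.1) (I ×ˢ univ) :=
    hf.continuousOn.comp continuousOn_fst fun q hq => hq.1
  unfold revol
  have h2 : Continuous fun q : ℝ × Sph n => (q.2 : Hor n) :=
    continuous_subtype_val.comp continuous_snd
  exact (h1.smul h2.continuousOn).prodMk continuousOn_fst

theorem continuousOn_normSqTangentialGrad (hf : IsProfile n a I f) (hn : 2 ≤ n) (ha : 0 < a)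
    {u : Nil n → ℝ} (hu : ContDiff ℝ 1 u) :
    ContinuousOn (fun q : ℝ × Sph n => normSqTangentialGrad f u (revol f q)) (I ×ˢ univ) := by
  have hrev := continuousOn_revol hf
  have hrev1 := continuous_fst.comp_continuousOn hrev
  have hfd : ContinuousOn (fun q : ℝ × Sph n => fderiv ℝ u (revol f q)) (I ×ˢ univ) :=
    (hu.continuous_fderiv (by norm_num)).comp_continuousOn hrev
  have hc1 : ContinuousOn (fun q : ℝ × Sph n => f q.1) (I ×ˢ univ) :=
    hf.continuousOn.comp continuousOn_fst fun q hq => hq.1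
  have hc2 : ContinuousOn (fun q : ℝ × Sph n => deriv f q.1) (I ×ˢ univ) :=
    hf.contDiffOn_deriv.continuousOn.comp continuousOn_fst fun q hq => hq.1
  have hθ : Continuous fun q : ℝ × Sph n => (q.2 : Hor n) :=
    continuous_subtype_val.comp continuous_snd
  have hW : ContinuousOn (fun q : ℝ × Sph n => (weightW n a f q.1)⁻¹) (I ×ˢ univ) := by
    refine ContinuousOn.inv₀ ?_ fun q hq => (hf.weightW_pos ha hq.1).ne'
    unfold weightW
    exact (hc1.div_const a).pow _
  have hlift : ∀ {U : ℝ × Sph n → Hor n} {z : ℝ × Sph n → ℝ}, ContinuousOn U (I ×ˢ univ) →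
      ContinuousOn z (I ×ˢ univ) →
      ContinuousOn (fun q => lift (revol f q) (U q) (z q)) (I ×ˢ univ) := by
    intro U z hU hz
    unfold lift
    refine hU.prodMk (hz.add (ContinuousOn.mul continuousOn_const ?_))
    exact ContinuousOn.inner (𝕜 := ℝ) (cplx.continuous.comp_continuousOn hrev1) hU
  have hN : ContinuousOn (fun q : ℝ × Sph n => normal f (revol f q)) (I ×ˢ univ) := by
    refine ContinuousOn.congr (f := fun q : ℝ × Sph n => lift (revol f q)
      ((weightW n a f q.1)⁻¹ • (-(q.2 : Hor n) + (f q.1 * deriv f q.1 / 2) • cplx (q.2 : Hor n)))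
      ((weightW n a f q.1)⁻¹ * deriv f q.1)) (hlift ?_ (hW.mul hc2))
      fun q hq => normal_revol hf hn ha hq.1
    have hJ : Continuous fun q : ℝ × Sph n => cplx (q.2 : Hor n) := cplx.continuous.comp hθ
    exact hW.smul (hθ.continuousOn.neg.add
      (((hc1.mul hc2).div_const 2).smul hJ.continuousOn))
  unfold normSqTangentialGrad
  refine continuousOn_finsetSum _ fun k _ => ContinuousOn.pow (hfd.clm_apply ?_) 2
  have hE : ContinuousOn (fun q : ℝ × Sph n => frame k (revol f q)) (I ×ˢ univ) := by
    rcases k with j | ⟨⟨⟩⟩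
    · simp only [frame_inl]
      exact hlift continuousOn_const continuousOn_const
    · simp only [frame_inr]
      exact hlift continuousOn_const continuousOn_const
  unfold tangential
  have hm : ∀ {A B : ℝ × Sph n → Nil n}, ContinuousOn A (I ×ˢ univ) →
      ContinuousOn B (I ×ˢ univ) →
      ContinuousOn (fun q => metric (revol f q) (A q) (B q)) (I ×ˢ univ) := by
    intro A B hA hB
    simp only [metric, contactForm_eq]
    have hA1 := continuous_fst.comp_continuousOn hA
    have hB1 := continuous_fst.comp_continuousOn hB
    have hA2 := continuous_snd.comp_continuousOn hA
    have hB2 := continuous_snd.comp_continuousOn hB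
    have hJ := cplx.continuous.comp_continuousOn hrev1
    exact (ContinuousOn.inner (𝕜 := ℝ) hA1 hB1).add
      ((hA2.sub (continuousOn_const.mul (ContinuousOn.inner (𝕜 := ℝ) hJ hA1))).mul
        (hB2.sub (continuousOn_const.mul (ContinuousOn.inner (𝕜 := ℝ) hJ hB1))))
  exact hE.sub ((hm hE hN).smul hN)

end Gradient

/-! ## Rotations of the sphere -/

section Rotation

variable {n : ℕ}

/-- The rotation `exp(s J)` of the horizontal space. -/
def rot (s : ℝ) : Hor n ≃ₗᵢ[ℝ] Hor n :=
  { toFun := fun v => Real.cos s • v + Real.sin s • cplx v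
    invFun := fun v => Real.cos s • v - Real.sin s • cplx v
    map_add' := fun v w => by simp only [map_add]; module
    map_smul' := fun c v => by simp only [map_smul, RingHom.id_apply]; module
    left_inv := fun v => by
      simp only [map_add, map_smul, cplx_cplx, smul_add, smul_smul, smul_neg]
      have h := Real.cos_sq_add_sin_sq s
      calc _ = (Real.cos s ^ 2 + Real.sin s ^ 2) • v := by module
        _ = v := by rw [h, one_smul]
    right_inv := fun v => by
      simp only [map_sub, map_smul, cplx_cplx, smul_sub, smul_smul, smul_neg]
      have h := Real.cos_sq_add_sin_sq s
      calc _ = (Real.cos s ^ 2 + Real.sin s ^ 2) • v := by module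
        _ = v := by rw [h, one_smul]
    norm_map' := fun v => by
      have h := Real.cos_sq_add_sin_sq s
      change ‖Real.cos s • v + Real.sin s • cplx v‖ = ‖v‖
      rw [← sq_eq_sq₀ (norm_nonneg _) (norm_nonneg _), ← real_inner_self_eq_norm_sq,
        ← real_inner_self_eq_norm_sq]
      simp only [inner_add_left, inner_add_right, real_inner_smul_left, real_inner_smul_right,
        inner_cplx_self, inner_self_cplx, inner_cplx_cplx]
      linear_combination inner ℝ v v * h }

theorem rot_apply (s : ℝ) (v : Hor n) : rot s v = Real.cos s • v + Real.sin s • cplx v := rfl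

theorem hasDerivAt_rot {α : ℝ → ℝ} {α' t : ℝ} (h : HasDerivAt α α' t) (v : Hor n) :
    HasDerivAt (fun t => rot (α t) v) (α' • cplx (rot (α t) v)) t := by
  have h1 := (h.cos.smul_const v).add (h.sin.smul_const (cplx v))
  refine h1.congr_deriv ?_
  simp only [rot_apply, map_add, map_smul, cplx_cplx]
  module

/-- A linear isometry acting on the sphere. -/
def sphMap (L : Hor n ≃ₗᵢ[ℝ] Hor n) (θ : Sph n) : Sph n :=
  ⟨L θ, by rw [mem_sphere_zero_iff_norm, L.norm_map, norm_eq_of_mem_sphere]⟩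

theorem continuous_sphMap (L : Hor n ≃ₗᵢ[ℝ] Hor n) : Continuous (sphMap L) :=
  (L.continuous.comp continuous_subtype_val).subtype_mk _

/-- The measure of a subset of the sphere is, up to a factor, the volume of the cone over it, and a
linear isometry maps cones to cones and preserves volume. -/
theorem map_sphMap (L : Hor n ≃ₗᵢ[ℝ] Hor n) :
    ((volume : Measure (Hor n)).toSphere).map (sphMap L) = (volume : Measure (Hor n)).toSphere := by
  ext s hs
  rw [Measure.map_apply (continuous_sphMap L).measurable hs, Measure.toSphere_apply' _ hs,
    Measure.toSphere_apply' _ ((continuous_sphMap L).measurable hs)]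
  congr 1
  refine Eq.trans ?_ (L.measurePreserving.measure_preimage_equiv (f := L.toMeasurableEquiv) _)
  congr 1
  ext v
  simp only [mem_preimage, Set.mem_smul, mem_image, Subtype.exists, exists_and_right,
    exists_eq_right]
  constructor
  · rintro ⟨r, hr, w, ⟨hw, hws⟩, rfl⟩
    exact ⟨r, hr, L w, ⟨(sphMap L ⟨w, hw⟩).2, hws⟩, (L.map_smul r w).symm⟩
  · rintro ⟨r, hr, w, ⟨hw, hws⟩, hrw⟩
    refine ⟨r, hr, L.symm w, ⟨?_, ?_⟩, ?_⟩
    · rw [mem_sphere_zero_iff_norm, L.symm.norm_map]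
      exact mem_sphere_zero_iff_norm.1 hw
    · have : sphMap L ⟨L.symm w, by
          rw [mem_sphere_zero_iff_norm, L.symm.norm_map]
          exact mem_sphere_zero_iff_norm.1 hw⟩ = ⟨w, hw⟩ := Subtype.ext (L.apply_symm_apply w)
      rw [this]
      exact hws
    · apply L.injective
      rw [L.map_smul, L.apply_symm_apply]
      exact hrw

end Rotation

/-! ## Integration over the hypersurface -/

section Integration

variable {n : ℕ} {a T : ℝ} {f : ℝ → ℝ}

/-- The product measure on `ℝ × S^{2n-1}`. -/
abbrev cylMeasure (n : ℕ) : Measure (ℝ × Sph n) :=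
  (volume : Measure ℝ).prod (volume : Measure (Hor n)).toSphere

/-- The angle by which the curves orthogonal to the slices turn. -/
def twistAngle (T : ℝ) (f : ℝ → ℝ) : ℝ → ℝ :=
  open Classical in (Ioo (-T) T).piecewise (fun t => t - scaleH f t / 2) fun _ => 0

theorem measurable_twistAngle (hf : IsProfile n a (Ioo (-T) T) f) :
    Measurable (twistAngle T f) := by
  classical
  refine ContinuousOn.measurable_piecewise (fun t ht => ?_) continuousOn_const measurableSet_Ioo
  exact ((hasDerivAt_id t).sub ((hf.hasDerivAt_scaleH ht).div_const 2)).continuousAt.continuousWithinAt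

/-- Since h' = 2 - 4/(4 + f²), the function t - h/2 is a primitive of the angular speed of
`slopeVec`, and no further integral is needed. -/
theorem hasDerivAt_twistAngle (hf : IsProfile n a (Ioo (-T) T) f) {t : ℝ}
    (ht : t ∈ Ioo (-T) T) : HasDerivAt (twistAngle T f) (2 / (4 + f t ^ 2)) t := by
  have h := (hasDerivAt_id t).sub ((hf.hasDerivAt_scaleH ht).div_const 2)
  have heq : twistAngle T f =ᶠ[nhds t] id - fun x => scaleH f x / 2 := by
    filter_upwards [isOpen_Ioo.mem_nhds ht] with s hs
    simp [twistAngle, hs]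
  refine (h.congr_of_eventuallyEq heq).congr_deriv ?_
  field_simp
  ring

/-- The twist along the curves orthogonal to the slices. -/
def twist (T : ℝ) (f : ℝ → ℝ) (q : ℝ × Sph n) : ℝ × Sph n :=
  (q.1, sphMap (rot (twistAngle T f q.1)) q.2)

theorem measurePreserving_twist (hf : IsProfile n a (Ioo (-T) T) f) :
    MeasurePreserving (twist (n := n) T f) ((cylMeasure n).restrict (Ioo (-T) T ×ˢ univ))
      ((cylMeasure n).restrict (Ioo (-T) T ×ˢ univ)) := by
  rw [← Measure.prod_restrict, Measure.restrict_univ]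
  have hα := measurable_twistAngle hf
  refine (MeasurePreserving.id (volume.restrict (Ioo (-T) T))).skew_product
    (g := fun t θ => sphMap (rot (twistAngle T f t)) θ) ?_
    (Filter.Eventually.of_forall fun t => map_sphMap _)
  have hθ : Measurable fun q : ℝ × Sph n => (q.2 : Hor n) :=
    measurable_subtype_coe.comp measurable_snd
  have hα1 : Measurable fun q : ℝ × Sph n => twistAngle T f q.1 := hα.comp measurable_fst
  refine Measurable.subtype_mk ?_
  exact (hα1.cos.smul hθ).add (hα1.sin.smul (cplx.measurable.comp hθ))

theorem hasDerivAt_revol_twist (hf : IsProfile n a (Ioo (-T) T) f) {t : ℝ}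
    (ht : t ∈ Ioo (-T) T) (θ : Sph n) :
    HasDerivAt (fun t => revol f (twist T f (t, θ))) (slopeVec f t (twist T f (t, θ)).2) t := by
  have h1 := (hf.hasDerivAt ht).smul (hasDerivAt_rot (hasDerivAt_twistAngle hf ht) (θ : Hor n))
  refine (h1.prodMk (hasDerivAt_id t)).congr_deriv ?_
  rw [slopeVec]
  ext1
  · change f t • (2 / (4 + f t ^ 2)) • cplx (rot (twistAngle T f t) (θ : Hor n))
      + deriv f t • rot (twistAngle T f t) (θ : Hor n) =
      deriv f t • rot (twistAngle T f t) (θ : Hor n)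
      + (2 / (4 + f t ^ 2) * f t) • cplx (rot (twistAngle T f t) (θ : Hor n))
    module
  · rfl

theorem integrableOn_cyl {g : ℝ × Sph n → ℝ} {α β : ℝ}
    (hg : ContinuousOn g (Icc α β ×ˢ univ))
    (h0 : ∀ q ∈ Ioo (-T) T ×ˢ (univ : Set (Sph n)), q.1 ∉ Icc α β → g q = 0) :
    IntegrableOn g (Ioo (-T) T ×ˢ univ) (cylMeasure n) := by
  refine IntegrableOn.of_forall_sdiff_eq_zero
    (hg.integrableOn_compact (isCompact_Icc.prod isCompact_univ))
    (measurableSet_Ioo.prod MeasurableSet.univ) fun q hq => h0 q hq.1 fun h => hq.2 ⟨h, mem_univ _⟩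

theorem Icc_prod_subset {α β : ℝ} (hα : -T < α) (hβ : β < T) :
    Icc α β ×ˢ (univ : Set (Sph n)) ⊆ Ioo (-T) T ×ˢ univ :=
  prod_mono_left fun _ ht => ⟨hα.trans_le ht.1, ht.2.trans_lt hβ⟩

theorem continuousOn_slopeVec (hf : IsProfile n a (Ioo (-T) T) f) :
    ContinuousOn (fun q : ℝ × Sph n => slopeVec f q.1 q.2) (Ioo (-T) T ×ˢ univ) := by
  have hc1 : ContinuousOn (fun q : ℝ × Sph n => f q.1) (Ioo (-T) T ×ˢ univ) :=
    hf.continuousOn.comp continuousOn_fst fun q hq => hq.1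
  have hc2 : ContinuousOn (fun q : ℝ × Sph n => deriv f q.1) (Ioo (-T) T ×ˢ univ) :=
    hf.contDiffOn_deriv.continuousOn.comp continuousOn_fst fun q hq => hq.1
  have hθ : Continuous fun q : ℝ × Sph n => (q.2 : Hor n) :=
    continuous_subtype_val.comp continuous_snd
  have hJ : Continuous fun q : ℝ × Sph n => cplx (q.2 : Hor n) := cplx.continuous.comp hθ
  unfold slopeVec
  have hq : ContinuousOn (fun q : ℝ × Sph n => 2 / (4 + f q.1 ^ 2) * f q.1)
      (Ioo (-T) T ×ˢ univ) :=
    (continuousOn_const.div (continuousOn_const.add (hc1.pow 2)) fun q _ =>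
      (by positivity : 4 + f q.1 ^ 2 ≠ 0)).mul hc1
  exact ((hc2.smul hθ.continuousOn).add (hq.smul hJ.continuousOn)).prodMk continuousOn_const

/-- The derivative of `ρ u²` along the curves orthogonal to the slices. -/
def slopeDeriv (f ρ ρ' : ℝ → ℝ) (u : Nil n → ℝ) (q : ℝ × Sph n) : ℝ :=
  ρ' q.1 * u (revol f q) ^ 2
    + ρ q.1 * (2 * u (revol f q) * fderiv ℝ u (revol f q) (slopeVec f q.1 q.2))

variable {α β : ℝ} {ρ ρ' : ℝ → ℝ} {u : Nil n → ℝ}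

theorem integrableOn_slopeDeriv (hf : IsProfile n a (Ioo (-T) T) f) (hα : -T < α) (hβ : β < T)
    (hρ : ∀ t ∈ Icc α β, HasDerivAt ρ (ρ' t) t) (hρ' : ContinuousOn ρ' (Icc α β))
    (hu : ContDiff ℝ 1 u)
    (h0 : ∀ q ∈ Ioo (-T) T ×ˢ (univ : Set (Sph n)), q.1 ∉ Ioo α β → u (revol f q) = 0) :
    ContinuousOn (slopeDeriv f ρ ρ' u) (Icc α β ×ˢ univ) ∧
    IntegrableOn (slopeDeriv f ρ ρ' u) (Ioo (-T) T ×ˢ univ) (cylMeasure n) := by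
  have hsub := Icc_prod_subset (n := n) hα hβ
  have hrev := (continuousOn_revol hf).mono hsub
  have hu1 := hu.continuous.comp_continuousOn hrev
  have hfd := ((hu.continuous_fderiv (by norm_num)).comp_continuousOn hrev).clm_apply
    ((continuousOn_slopeVec hf).mono hsub)
  have hρc : ContinuousOn ρ (Icc α β) := fun t ht => (hρ t ht).continuousAt.continuousWithinAt
  have hρ1 : ContinuousOn (fun q : ℝ × Sph n => ρ q.1) (Icc α β ×ˢ univ) :=
    hρc.comp continuousOn_fst fun q hq => hq.1
  have hρ2 : ContinuousOn (fun q : ℝ × Sph n => ρ' q.1) (Icc α β ×ˢ univ) :=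
    hρ'.comp continuousOn_fst fun q hq => hq.1
  have hc : ContinuousOn (slopeDeriv f ρ ρ' u) (Icc α β ×ˢ univ) :=
    (hρ2.mul (hu1.pow 2)).add (hρ1.mul ((continuousOn_const.mul hu1).mul hfd))
  refine ⟨hc, integrableOn_cyl hc fun q hq hq1 => ?_⟩
  rw [slopeDeriv, h0 q hq fun h => hq1 (Ioo_subset_Icc_self h)]
  ring

/-- The twist preserves the measure and straightens the curves orthogonal to the slices. By Fubini
the integrand becomes, for each θ, the derivative of a function of t that vanishes at both ends. -/
theorem integral_slopeDeriv (hf : IsProfile n a (Ioo (-T) T) f) (hα : -T < α) (hαβ : α ≤ β)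
    (hβ : β < T) (hρ : ∀ t ∈ Icc α β, HasDerivAt ρ (ρ' t) t) (hρ' : ContinuousOn ρ' (Icc α β))
    (hu : ContDiff ℝ 1 u)
    (h0 : ∀ q ∈ Ioo (-T) T ×ˢ (univ : Set (Sph n)), q.1 ∉ Ioo α β → u (revol f q) = 0) :
    ∫ q in Ioo (-T) T ×ˢ univ, slopeDeriv f ρ ρ' u q ∂(cylMeasure n) = 0 := by
  obtain ⟨hcont, hint⟩ := integrableOn_slopeDeriv hf hα hβ hρ hρ' hu h0
  have hsub : Icc α β ⊆ Ioo (-T) T := fun t ht => ⟨hα.trans_le ht.1, ht.2.trans_lt hβ⟩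
  have hΨ := measurePreserving_twist (n := n) hf
  have h1 := integral_map (f := slopeDeriv f ρ ρ' u) hΨ.measurable.aemeasurable
    (by rw [hΨ.map_eq]; exact hint.1)
  rw [hΨ.map_eq] at h1
  have h2 : Integrable (fun q => slopeDeriv f ρ ρ' u (twist T f q))
      ((cylMeasure n).restrict (Ioo (-T) T ×ˢ univ)) := (hΨ.integrable_comp hint.1).2 hint
  rw [h1]
  rw [← Measure.prod_restrict, Measure.restrict_univ] at h2 ⊢
  rw [integral_prod_symm _ h2]
  refine integral_eq_zero_of_ae (Filter.Eventually.of_forall fun θ => ?_)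
  simp only [Pi.zero_apply]
  rw [setIntegral_eq_of_subset_of_forall_sdiff_eq_zero measurableSet_Ioo hsub fun t ht => by
    rw [slopeDeriv, h0 _ (show twist T f (t, θ) ∈ Ioo (-T) T ×ˢ univ from ⟨ht.1, mem_univ _⟩)
      fun h => ht.2 (Ioo_subset_Icc_self h)]
    ring]
  rw [integral_Icc_eq_integral_Ioc, ← intervalIntegral.integral_of_le hαβ]
  have hd : ∀ t ∈ uIcc α β, HasDerivAt (fun t => ρ t * u (revol f (twist T f (t, θ))) ^ 2)
      (slopeDeriv f ρ ρ' u (twist T f (t, θ))) t := by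
    intro t ht
    rw [uIcc_of_le hαβ] at ht
    have h3 : HasDerivAt (fun t => u (revol f (twist T f (t, θ)))) _ t :=
      (hu.differentiable (by norm_num) (revol f (twist T f (t, θ)))).hasFDerivAt.comp_hasDerivAt
        (f := fun t => revol f (twist T f (t, θ))) t (hasDerivAt_revol_twist hf (hsub ht) θ)
    refine ((hρ t ht).mul (h3.pow 2)).congr_deriv ?_
    rw [slopeDeriv, show (twist T f (t, θ)).1 = t from rfl]
    simp
  rw [intervalIntegral.integral_eq_sub_of_hasDerivAt hd]
  · rw [h0 (twist T f (β, θ)) ⟨hsub (right_mem_Icc.2 hαβ), mem_univ _⟩ fun h => lt_irrefl _ h.2,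
      h0 (twist T f (α, θ)) ⟨hsub (left_mem_Icc.2 hαβ), mem_univ _⟩ fun h => lt_irrefl _ h.1]
    ring
  · refine ContinuousOn.intervalIntegrable ?_
    rw [uIcc_of_le hαβ]
    refine ContinuousOn.comp hcont (fun t ht => ?_) fun t ht => ⟨ht, mem_univ _⟩
    refine ContinuousAt.continuousWithinAt (continuousAt_id.prodMk ?_)
    refine Topology.IsInducing.subtypeVal.continuousAt_iff.2 ?_
    exact (hasDerivAt_rot (hasDerivAt_twistAngle hf (hsub ht)) (θ : Hor n)).continuousAt

end Integration

/-! ## The quadratic form of the Jacobi operator -/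

section Form

variable {n : ℕ} {a T : ℝ} {f : ℝ → ℝ} {α β : ℝ} {u : Nil n → ℝ} {K : Set (Nil n)}

namespace IsProfile

theorem continuousOn_deriv {I : Set ℝ} (hf : IsProfile n a I f) : ContinuousOn (deriv f) I :=
  hf.contDiffOn_deriv.continuousOn

theorem continuousOn_deriv_deriv {I : Set ℝ} (hf : IsProfile n a I f) :
    ContinuousOn (deriv (deriv f)) I := by
  have h1 := hf.continuousOn
  have h2 := hf.continuousOn_deriv
  refine ContinuousOn.congr (f := fun t => (4 * (2 * (n : ℝ) - 1) * (1 + deriv f t ^ 2)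
      + (2 * (n : ℝ) - 2) * f t ^ 2 * deriv f t ^ 2) / (f t * (4 + f t ^ 2))) ?_
    fun t ht => hf.ode' ht
  refine ContinuousOn.div (by fun_prop) (by fun_prop) fun t ht => ?_
  have := hf.pos t ht
  positivity

theorem continuousOn_jacobiPotential {I : Set ℝ} (hf : IsProfile n a I f) :
    ContinuousOn (jacobiPotential n f) I := by
  have h1 := hf.continuousOn
  have h2 := hf.continuousOn_deriv
  have h3 := hf.continuousOn_deriv_deriv
  unfold jacobiPotential
  refine ContinuousOn.div (by fun_prop) (by fun_prop) fun t ht => ?_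
  have := hf.pos t ht
  positivity

theorem continuousOn_weightW {I : Set ℝ} (hf : IsProfile n a I f) :
    ContinuousOn (weightW n a f) I := (hf.continuousOn.div_const a).pow _

theorem continuousOn_weightP {I : Set ℝ} (hf : IsProfile n a I f) :
    ContinuousOn (weightP f) I := continuousOn_const.add ((hf.continuousOn.pow 2).div_const 4)

end IsProfile

theorem revol_mem_piece_iff {r s : ℝ} (q : ℝ × Sph n) :
    revol f q ∈ piece n f r s ↔ q.1 ∈ Ioo r s := by
  constructor
  · rintro ⟨q', hq', h⟩
    have : q'.1 = q.1 := congrArg Prod.snd h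
    rw [← this]
    exact hq'.1
  · exact fun h => ⟨q, ⟨h, mem_univ _⟩, rfl⟩

theorem apply_revol_eq_zero (hK : K ⊆ piece n f α β)
    (h0 : ∀ p ∈ piece n f (-T) T, p ∉ K → u p = 0) :
    ∀ q ∈ Ioo (-T) T ×ˢ (univ : Set (Sph n)), q.1 ∉ Ioo α β → u (revol f q) = 0 :=
  fun q hq hq1 => h0 _ ((revol_mem_piece_iff q).2 hq.1) fun h =>
    hq1 ((revol_mem_piece_iff q).1 (hK h))

theorem normSqTangentialGrad_eq_zero (hf : IsProfile n a (Ioo (-T) T) f) (hn : 2 ≤ n)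
    (ha : 0 < a) (hu : ContDiff ℝ 1 u) (hKc : IsCompact K) (hK : K ⊆ piece n f α β)
    (h0 : ∀ p ∈ piece n f (-T) T, p ∉ K → u p = 0) :
    ∀ q ∈ Ioo (-T) T ×ˢ (univ : Set (Sph n)), q.1 ∉ Ioo α β →
      normSqTangentialGrad f u (revol f q) = 0 := by
  rintro ⟨t, θ⟩ hq hq1
  refine Finset.sum_eq_zero fun k _ => ?_
  rw [fderiv_apply_eq_zero hf hq.1 (hu.differentiable (by norm_num) _) ?_
    (fderiv_defining_tangential hf hn ha hq.1 _), zero_pow two_ne_zero]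
  have hnot : revol f (t, θ) ∉ K := fun h => hq1 ((revol_mem_piece_iff _).1 (hK h))
  filter_upwards [hKc.isClosed.isOpen_compl.mem_nhds hnot] with p hp hpM using h0 p hpM hp

/-- The density cancels the denominator W² of the potential, leaving weights that depend on the
height only. -/
theorem integrand_eq (hf : IsProfile n a (Ioo (-T) T) f) (hn : 2 ≤ n) (ha : 0 < a)
    {q : ℝ × Sph n} (hq : q.1 ∈ Ioo (-T) T) (x y : ℝ) :
    (x - potential f (revol f q) * y) * density f q =
      a ^ (2 * n - 1) * (weightW n a f q.1 ^ 2 * x - jacobiPotential n f q.1 * y) := by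
  obtain ⟨t, θ⟩ := q
  have hW := hf.weightW_pos ha hq
  rw [density_eq hf hn ha hq, potential_revol hf hn ha hq]
  field_simp

theorem integrableOn_form (hf : IsProfile n a (Ioo (-T) T) f) (hn : 2 ≤ n) (ha : 0 < a)
    (hα : -T < α) (hβ : β < T) (hu : ContDiff ℝ 1 u) (hKc : IsCompact K)
    (hK : K ⊆ piece n f α β) (h0 : ∀ p ∈ piece n f (-T) T, p ∉ K → u p = 0) :
    IntegrableOn (fun q : ℝ × Sph n => weightW n a f q.1 ^ 2 * normSqTangentialGrad f u (revol f q)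
      - jacobiPotential n f q.1 * u (revol f q) ^ 2) (Ioo (-T) T ×ˢ univ) (cylMeasure n) := by
  have hsub := Icc_prod_subset (n := n) hα hβ
  have hrev := (continuousOn_revol hf).mono hsub
  have hu1 := hu.continuous.comp_continuousOn hrev
  have hW : ContinuousOn (fun q : ℝ × Sph n => weightW n a f q.1) (Icc α β ×ˢ univ) :=
    (hf.continuousOn_weightW.comp continuousOn_fst fun q hq => hq.1).mono hsub
  have hV : ContinuousOn (fun q : ℝ × Sph n => jacobiPotential n f q.1) (Icc α β ×ˢ univ) :=
    (hf.continuousOn_jacobiPotential.comp continuousOn_fst fun q hq => hq.1).mono hsub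
  have hG := (continuousOn_normSqTangentialGrad hf hn ha hu).mono hsub
  refine integrableOn_cyl (((hW.pow 2).mul hG).sub (hV.mul (hu1.pow 2))) fun q hq hq1 => ?_
  have hq1' : q.1 ∉ Ioo α β := fun h => hq1 (Ioo_subset_Icc_self h)
  rw [normSqTangentialGrad_eq_zero hf hn ha hu hKc hK h0 q hq hq1',
    apply_revol_eq_zero hK h0 q hq hq1']
  ring

theorem integrableOn_sq (hf : IsProfile n a (Ioo (-T) T) f)
    (hα : -T < α) (hβ : β < T) (hu : Continuous u)
    (hK : K ⊆ piece n f α β) (h0 : ∀ p ∈ piece n f (-T) T, p ∉ K → u p = 0) :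
    IntegrableOn (fun q : ℝ × Sph n => weightW n a f q.1 ^ 2 * u (revol f q) ^ 2)
      (Ioo (-T) T ×ˢ univ) (cylMeasure n) := by
  have hsub := Icc_prod_subset (n := n) hα hβ
  have hrev := (continuousOn_revol hf).mono hsub
  have hu1 := hu.comp_continuousOn hrev
  have hW : ContinuousOn (fun q : ℝ × Sph n => weightW n a f q.1) (Icc α β ×ˢ univ) :=
    (hf.continuousOn_weightW.comp continuousOn_fst fun q hq => hq.1).mono hsub
  refine integrableOn_cyl ((hW.pow 2).mul (hu1.pow 2)) fun q hq hq1 => ?_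
  rw [apply_revol_eq_zero hK h0 q hq fun h => hq1 (Ioo_subset_Icc_self h)]
  ring

theorem jacobiForm_eq (hf : IsProfile n a (Ioo (-T) T) f) (hn : 2 ≤ n) (ha : 0 < a)
    (u : Nil n → ℝ) : jacobiForm n f T u = a ^ (2 * n - 1) * ∫ q in Ioo (-T) T ×ˢ univ,
      (weightW n a f q.1 ^ 2 * normSqTangentialGrad f u (revol f q)
        - jacobiPotential n f q.1 * u (revol f q) ^ 2) ∂(cylMeasure n) := by
  rw [jacobiForm, areaIntegral, ← integral_const_mul]
  exact setIntegral_congr_fun (measurableSet_Ioo.prod MeasurableSet.univ) fun q hq =>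
    integrand_eq hf hn ha hq.1 _ _

theorem areaIntegral_sq_eq (hf : IsProfile n a (Ioo (-T) T) f) (hn : 2 ≤ n) (ha : 0 < a)
    (u : Nil n → ℝ) : areaIntegral n f T (fun p => u p ^ 2) = a ^ (2 * n - 1) *
      ∫ q in Ioo (-T) T ×ˢ univ, weightW n a f q.1 ^ 2 * u (revol f q) ^ 2 ∂(cylMeasure n) := by
  rw [areaIntegral, ← integral_const_mul]
  refine setIntegral_congr_fun (measurableSet_Ioo.prod MeasurableSet.univ) fun q hq => ?_
  rw [density_eq (t := q.1) (θ := q.2) hf hn ha hq.1]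
  ring

/-- The form is bounded below where a Riccati inequality holds. -/
theorem le_jacobiForm (hf : IsProfile n a (Ioo (-T) T) f) (hn : 2 ≤ n) (ha : 0 < a)
    (hα : -T < α) (hαβ : α ≤ β) (hβ : β < T) (hu : ContDiff ℝ 1 u) (hKc : IsCompact K)
    (hK : K ⊆ piece n f α β) (h0 : ∀ p ∈ piece n f (-T) T, p ∉ K → u p = 0)
    {ρ ρ' : ℝ → ℝ} (hρ : ∀ t ∈ Icc α β, HasDerivAt ρ (ρ' t) t) (hρ' : ContinuousOn ρ' (Icc α β))
    {c : ℝ} (hc : ∀ t ∈ Icc α β,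
      c * weightW n a f t ^ 2 ≤ ρ' t - ρ t ^ 2 / weightP f t - jacobiPotential n f t) :
    c * areaIntegral n f T (fun p => u p ^ 2) ≤ jacobiForm n f T u := by
  have h0' := apply_revol_eq_zero hK h0
  have hint := (integrableOn_slopeDeriv hf hα hβ hρ hρ' hu h0').2
  rw [jacobiForm_eq hf hn ha, areaIntegral_sq_eq hf hn ha, mul_left_comm]
  refine mul_le_mul_of_nonneg_left ?_ (by positivity)
  -- The integral of the derivative of ρu² is zero, so it may be subtracted freely; the inequality
  -- then holds pointwise.
  rw [← sub_zero (c * _), ← integral_slopeDeriv hf hα hαβ hβ hρ hρ' hu h0', ← integral_const_mul,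
    ← integral_sub ((integrableOn_sq hf hα hβ hu.continuous hK h0).const_mul c) hint]
  refine setIntegral_mono_on (((integrableOn_sq hf hα hβ hu.continuous hK h0).const_mul c).sub hint)
    (integrableOn_form hf hn ha hα hβ hu hKc hK h0)
    (measurableSet_Ioo.prod MeasurableSet.univ) ?_
  rintro ⟨t, θ⟩ hq
  have ht : t ∈ Ioo (-T) T := hq.1
  have hle := sq_apply_slopeVec_le (θ := θ) hf hn ha ht u
  have hP := weightP_pos f t
  simp only [slopeDeriv]
  by_cases htI : t ∈ Icc α β
  · set x := fderiv ℝ u (revol f (t, θ)) (slopeVec f t θ)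
    set y := u (revol f (t, θ))
    -- Completing the square produces the term ρ²/P of the Riccati inequality.
    have h1 : 0 ≤ weightP f t * x ^ 2 + 2 * ρ t * y * x + ρ t ^ 2 / weightP f t * y ^ 2 := by
      have : weightP f t * x ^ 2 + 2 * ρ t * y * x + ρ t ^ 2 / weightP f t * y ^ 2 =
          (weightP f t * x + ρ t * y) ^ 2 / weightP f t := by
        field_simp
        ring
      rw [this]
      positivity
    have h2 := mul_le_mul_of_nonneg_right (hc t htI) (sq_nonneg y)
    nlinarith
  · rw [h0' (t, θ) hq fun h => htI (Ioo_subset_Icc_self h)]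
    have : 0 ≤ weightP f t * fderiv ℝ u (revol f (t, θ)) (slopeVec f t θ) ^ 2 := by positivity
    nlinarith

theorem areaIntegral_sq_pos (hf : IsProfile n a (Ioo (-T) T) f) (hn : 2 ≤ n) (ha : 0 < a)
    (hα : -T < α) (hβ : β < T) (hu : Continuous u)
    (hK : K ⊆ piece n f α β) (h0 : ∀ p ∈ piece n f (-T) T, p ∉ K → u p = 0)
    (hne : ∃ p ∈ piece n f (-T) T, u p ≠ 0) : 0 < areaIntegral n f T (fun p => u p ^ 2) := by
  rw [areaIntegral_sq_eq hf hn ha]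
  refine mul_pos (by positivity) ?_
  rw [setIntegral_pos_iff_support_of_nonneg_ae (Filter.Eventually.of_forall fun q => by
    simp only [Pi.zero_apply]; positivity) (integrableOn_sq hf hα hβ hu hK h0)]
  obtain ⟨_, ⟨q, hq, rfl⟩, hq0⟩ := hne
  have hopen : IsOpen (Ioo (-T) T ×ˢ (univ : Set (Sph n))) := isOpen_Ioo.prod isOpen_univ
  have hc : ContinuousOn (fun q : ℝ × Sph n => u (revol f q)) (Ioo (-T) T ×ˢ univ) :=
    hu.comp_continuousOn (continuousOn_revol hf)
  have hU := hc.isOpen_inter_preimage hopen (isOpen_compl_singleton (x := (0 : ℝ)))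
  have : ((volume : Measure (Hor n)).toSphere).IsOpenPosMeasure :=
    Measure.toSphere.instIsOpenPosMeasure _
  have : (cylMeasure n).IsOpenPosMeasure := inferInstance
  refine (hU.measure_pos _ ⟨q, hq, hq0⟩).trans_le (measure_mono ?_)
  rintro q' ⟨hq', hq0'⟩
  refine ⟨?_, hq'⟩
  have hW := hf.weightW_pos ha hq'.1
  exact mul_ne_zero (pow_ne_zero 2 hW.ne') (pow_ne_zero 2 hq0')

/-- The total mass of the sphere. -/
def sphereArea (n : ℕ) : ℝ := ((volume : Measure (Hor n)).toSphere).real univ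

theorem sphereArea_pos (hn : 2 ≤ n) : 0 < sphereArea n := by
  have : Nontrivial (Hor n) := by
    refine Module.nontrivial_of_finrank_pos (R := ℝ) ?_
    simp
    omega
  have : Nonempty (Sph n) := (NormedSpace.sphere_nonempty.2 zero_le_one).to_subtype
  rw [sphereArea, measureReal_def, ENNReal.toReal_pos_iff]
  exact ⟨isOpen_univ.measure_pos _ univ_nonempty, measure_lt_top _ _⟩

theorem integral_cyl (T : ℝ) (φ : ℝ → ℝ) :
    ∫ q in Ioo (-T) T ×ˢ univ, φ q.1 ∂(cylMeasure n) =
      sphereArea n * ∫ t in Ioo (-T) T, φ t := by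
  rw [← Measure.prod_restrict, Measure.restrict_univ, integral_fun_fst, smul_eq_mul, sphereArea]

theorem jacobiForm_height (hf : IsProfile n a (Ioo (-T) T) f) (hn : 2 ≤ n) (ha : 0 < a)
    {χ : ℝ → ℝ} (hχ : Differentiable ℝ χ) :
    jacobiForm n f T (fun p => χ p.2) = a ^ (2 * n - 1) * (sphereArea n *
      ∫ t in Ioo (-T) T, (weightP f t * deriv χ t ^ 2 - jacobiPotential n f t * χ t ^ 2)) := by
  rw [jacobiForm_eq hf hn ha, ← integral_cyl]
  congr 1
  refine setIntegral_congr_fun (measurableSet_Ioo.prod MeasurableSet.univ) ?_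
  rintro ⟨t, θ⟩ hq
  simp only
  rw [normSqTangentialGrad_height hf hn ha hq.1 (hχ t), revol_snd]

theorem areaIntegral_height (hf : IsProfile n a (Ioo (-T) T) f) (hn : 2 ≤ n) (ha : 0 < a)
    (χ : ℝ → ℝ) : areaIntegral n f T (fun p => χ p.2 ^ 2) = a ^ (2 * n - 1) * (sphereArea n *
      ∫ t in Ioo (-T) T, weightW n a f t ^ 2 * χ t ^ 2) := by
  rw [areaIntegral_sq_eq hf hn ha (fun p => χ p.2), ← integral_cyl]
  rfl

end Form

/-! ## Jacobi fields depending on the height -/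

/-- The function `(f - f' H) / W`: the normal component of the variation `f - f' H` of the
profile, up to sign. -/
def fieldW (n : ℕ) (a : ℝ) (f H : ℝ → ℝ) (t : ℝ) : ℝ :=
  (f t - deriv f t * H t) / weightW n a f t

/-- The product of `1 + f² / 4` with the derivative of `fieldW`, when `H' = h'`. -/
def fieldY (n : ℕ) (a : ℝ) (f H : ℝ → ℝ) (t : ℝ) : ℝ :=
  (-(deriv f t * ((2 * (n : ℝ) - 2) * (4 + f t ^ 2) + 4 + 2 * f t ^ 2) / 4)
    - H t * (4 * (2 * (n : ℝ) - 1) - f t ^ 2 * deriv f t ^ 2) / (4 * f t)) / weightW n a f t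

namespace IsProfile

variable {n : ℕ} {a : ℝ} {I : Set ℝ} {f H : ℝ → ℝ} {t κ : ℝ}

theorem hasDerivAt_fieldW (hf : IsProfile n a I f) (hn : 2 ≤ n) (ha : 0 < a) (ht : t ∈ I)
    (hH : HasDerivAt H ((4 + 2 * f t ^ 2) / (4 + f t ^ 2) - κ) t) :
    HasDerivAt (fieldW n a f H)
      (fieldY n a f H t / weightP f t + κ * (deriv f t / weightW n a f t)) t := by
  have hp := hf.pos t ht
  have hW := hf.weightW_pos ha ht
  have h := ((hf.hasDerivAt ht).sub ((hf.hasDerivAt_deriv ht).mul hH)).div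
    (hf.hasDerivAt_weightW hn ha ht) hW.ne'
  refine HasDerivAt.congr_deriv h ?_
  simp only [Pi.sub_apply, Pi.mul_apply]
  rw [fieldY, weightP, hf.ode' ht]
  generalize weightW n a f t = W at *
  field_simp
  ring

/-- For κ = 0 this is the Jacobi equation (P w')' = -V w, checked directly from the profile
equation. The factor of κ is P(f'/W)', so a linear term in H only adds multiples of the translation
field. -/
theorem hasDerivAt_fieldY (hf : IsProfile n a I f) (hn : 2 ≤ n) (ha : 0 < a) (ht : t ∈ I)
    (hH : HasDerivAt H ((4 + 2 * f t ^ 2) / (4 + f t ^ 2) - κ) t) :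
    HasDerivAt (fieldY n a f H)
      (-(jacobiPotential n f t * fieldW n a f H t) + κ *
        ((4 * (2 * (n : ℝ) - 1) - f t ^ 2 * deriv f t ^ 2) / (4 * f t * weightW n a f t))) t := by
  have hp := hf.pos t ht
  have hW := hf.weightW_pos ha ht
  have hf1 := hf.hasDerivAt ht
  have hf2 := hf.hasDerivAt_deriv ht
  have h := (((hf2.mul ((((hf1.pow 2).const_add 4).const_mul (2 * (n : ℝ) - 2)).add_const 4 |>.add
    ((hf1.pow 2).const_mul 2))).div_const 4).neg.sub ((hH.mul
    (((hf1.pow 2).mul (hf2.pow 2)).const_sub (4 * (2 * (n : ℝ) - 1)))).div (hf1.const_mul 4)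
      (by positivity))).div (hf.hasDerivAt_weightW hn ha ht) hW.ne'
  refine HasDerivAt.congr_deriv h ?_
  simp only [Pi.sub_apply, Pi.mul_apply, Pi.neg_apply, Pi.pow_apply, Pi.div_apply, Pi.add_apply]
  rw [fieldW, jacobiPotential, hf.ode' ht]
  generalize weightW n a f t = W at *
  simp only [Nat.cast_ofNat, Nat.add_one_sub_one, pow_one]
  field_simp
  ring

/-- The Wronskian of the translation and of the scaling fields. -/
theorem wronskian_field (hf : IsProfile n a I f) (hn : 2 ≤ n) (ha : 0 < a) (ht : t ∈ I)
    (H : ℝ → ℝ) : (4 * (2 * (n : ℝ) - 1) - f t ^ 2 * deriv f t ^ 2) / (4 * f t * weightW n a f t)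
      * fieldW n a f H t - fieldY n a f H t * (deriv f t / weightW n a f t) =
    2 * (n : ℝ) - 1 := by
  have hp := hf.pos t ht
  have hW := hf.weightW_pos ha ht
  have hW2 := hf.weightW_sq hn ha ht
  rw [fieldW, fieldY]
  field_simp
  rw [hW2, weightP]
  ring

/-- Subtracting a constant from H adds a multiple of the translation field, so the Wronskian is the
constant of `wronskian_field` times c - d. In particular, distinct constants give independent
solutions. -/
theorem wronskian_sub (hf : IsProfile n a I f) (hn : 2 ≤ n) (ha : 0 < a) (ht : t ∈ I)
    (H : ℝ → ℝ) (c d : ℝ) :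
    fieldY n a f (fun t => H t - c) t * fieldW n a f (fun t => H t - d) t
      - fieldY n a f (fun t => H t - d) t * fieldW n a f (fun t => H t - c) t =
    (c - d) * (2 * (n : ℝ) - 1) := by
  have hp := hf.pos t ht
  have hW := hf.weightW_pos ha ht
  rw [← hf.wronskian_field hn ha ht H]
  simp only [fieldW, fieldY]
  field_simp
  ring

theorem contDiffOn_field {T : ℝ} (hf : IsProfile n a (Ioo (-T) T) f) (ha : 0 < a)
    (hH : ∀ t ∈ Ioo (-T) T, HasDerivAt H ((4 + 2 * f t ^ 2) / (4 + f t ^ 2) - κ) t) :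
    ContDiffOn ℝ ∞ (fieldW n a f H) (Ioo (-T) T) := by
  have h1 := hf.contDiffOn_infty
  have h2 := hf.contDiffOn_deriv_infty
  have h3 : ContDiffOn ℝ ∞ H (Ioo (-T) T) := by
    rw [contDiffOn_infty_iff_deriv_of_isOpen isOpen_Ioo]
    refine ⟨fun t ht => (hH t ht).differentiableAt.differentiableWithinAt, ?_⟩
    refine ContDiffOn.congr ?_ fun t ht => (hH t ht).deriv
    refine ContDiffOn.sub (ContDiffOn.div (by fun_prop) (by fun_prop) fun t _ => ?_)
      contDiffOn_const
    positivity
  unfold fieldW weightW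
  refine ContDiffOn.div (h1.sub (h2.mul h3)) (by fun_prop) fun t ht => ?_
  have := hf.pos t ht
  positivity

/-- With y the `fieldY`, the derivative of w·y is the integrand of the form up to κ-terms. These
combine through the constant Wronskian and the identity P(f'/W)² = 1 - 1/W²; the boundary terms
vanish with w. -/
theorem integral_form_field {T : ℝ} (hf : IsProfile n a (Ioo (-T) T) f) (hn : 2 ≤ n) (ha : 0 < a)
    (hH : ∀ t ∈ Ioo (-T) T, HasDerivAt H ((4 + 2 * f t ^ 2) / (4 + f t ^ 2) - κ) t)
    {α β : ℝ} (hα : -T < α) (hαβ : α ≤ β) (hβ : β < T) (h0 : fieldW n a f H α = 0)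
    (h1 : fieldW n a f H β = 0) :
    ∫ t in Ioo α β, (weightP f t * deriv (fieldW n a f H) t ^ 2
      - jacobiPotential n f t * fieldW n a f H t ^ 2) =
    ∫ t in Ioo α β, κ * (κ * (1 - 1 / weightW n a f t ^ 2) - (2 * (n : ℝ) - 1)) := by
  have hsub : Icc α β ⊆ Ioo (-T) T := fun t ht => ⟨hα.trans_le ht.1, ht.2.trans_lt hβ⟩
  have hw := fun t ht => hf.hasDerivAt_fieldW hn ha ht (hH t ht)
  have hy := fun t ht => hf.hasDerivAt_fieldY hn ha ht (hH t ht)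
  set R := fun t => κ * (κ * (1 - 1 / weightW n a f t ^ 2) - (2 * (n : ℝ) - 1)) with hR
  set G := fun t => weightP f t * deriv (fieldW n a f H) t ^ 2
      - jacobiPotential n f t * fieldW n a f H t ^ 2 with hG
  have hd : ∀ t ∈ Icc α β,
      HasDerivAt (fun t => fieldW n a f H t * fieldY n a f H t) (G t - R t) t := by
    intro t ht
    have hp := hf.pos t (hsub ht)
    have hW := hf.weightW_pos ha (hsub ht)
    have hP := weightP_pos f t
    refine ((hw t (hsub ht)).mul (hy t (hsub ht))).congr_deriv ?_
    have hwr := hf.wronskian_field hn ha (hsub ht) H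
    have hW2 := hf.weightW_sq hn ha (hsub ht)
    have hd : 1 - 1 / weightW n a f t ^ 2 =
        weightP f t * (deriv f t / weightW n a f t) ^ 2 := by
      rw [div_pow, eq_comm, mul_div_assoc', div_eq_iff (by positivity), sub_mul, one_mul,
        div_mul_cancel₀ _ (by positivity), hW2]
      ring
    simp only [hG, hR]
    rw [(hw t (hsub ht)).deriv, hd]
    generalize (4 * (2 * (n : ℝ) - 1) - f t ^ 2 * deriv f t ^ 2) / (4 * f t * weightW n a f t) = z
      at hwr ⊢
    generalize deriv f t / weightW n a f t = x at hwr ⊢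
    generalize fieldW n a f H t = w at hwr ⊢
    generalize fieldY n a f H t = y at hwr ⊢
    have e : weightP f t * (y / weightP f t + κ * x) ^ 2 =
        y * y / weightP f t + 2 * κ * x * y + κ ^ 2 * weightP f t * x ^ 2 := by
      field_simp
      ring
    rw [e]
    linear_combination κ * hwr
  have hcw : ContDiffOn ℝ ∞ (fieldW n a f H) (Ioo (-T) T) := hf.contDiffOn_field ha hH
  have hcw' : ContinuousOn (deriv (fieldW n a f H)) (Ioo (-T) T) :=
    ((contDiffOn_infty_iff_deriv_of_isOpen isOpen_Ioo).1 hcw).2.continuousOn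
  have hGc : ContinuousOn G (Icc α β) := by
    have := hf.continuousOn_weightP
    have := hf.continuousOn_jacobiPotential
    have := hcw.continuousOn
    exact (ContinuousOn.sub (by fun_prop) (by fun_prop)).mono hsub
  have hRc : ContinuousOn R (Icc α β) := by
    have := hf.continuousOn_weightW
    have h : ContinuousOn (fun t => 1 / weightW n a f t ^ 2) (Ioo (-T) T) :=
      continuousOn_const.div (this.pow 2) fun t ht => pow_ne_zero 2 (hf.weightW_pos ha ht).ne'
    exact ContinuousOn.mono (by fun_prop) hsub
  have hGi := hGc.integrableOn_Icc.mono_set (μ := volume) Ioo_subset_Icc_self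
  have hRi := hRc.integrableOn_Icc.mono_set (μ := volume) Ioo_subset_Icc_self
  rw [← sub_eq_zero, ← integral_sub hGi hRi, ← integral_Ioc_eq_integral_Ioo,
    ← intervalIntegral.integral_of_le hαβ, intervalIntegral.integral_eq_sub_of_hasDerivAt
    (f := fun t => fieldW n a f H t * fieldY n a f H t)
    (fun t ht => hd t (by rwa [uIcc_of_le hαβ] at ht))]
  · simp [h0, h1]
  · refine ContinuousOn.intervalIntegrable ?_
    rw [uIcc_of_le hαβ]
    exact hGc.sub hRc

end IsProfile

/-! ## Cutting off a function near its zeros -/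

/-- A smooth function which vanishes for `y ≤ 1` and equals `y` for `y ≥ 2`. -/
def softId (y : ℝ) : ℝ := y * Real.smoothTransition (y - 1)

theorem contDiff_softId : ContDiff ℝ ∞ softId :=
  contDiff_id.mul (Real.smoothTransition.contDiff.comp (contDiff_id.sub contDiff_const))

theorem softId_of_le {y : ℝ} (h : y ≤ 1) : softId y = 0 := by
  rw [softId, Real.smoothTransition.zero_of_nonpos (by linarith), mul_zero]

theorem softId_of_ge {y : ℝ} (h : 2 ≤ y) : softId y = y := by
  rw [softId, Real.smoothTransition.one_of_one_le (by linarith), mul_one]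

theorem abs_softId_le (y : ℝ) : |softId y| ≤ |y| := by
  rw [softId, abs_mul, abs_of_nonneg (Real.smoothTransition.nonneg _)]
  exact mul_le_of_le_one_right (abs_nonneg _) (Real.smoothTransition.le_one _)

theorem deriv_softId_of_gt {y : ℝ} (h : 2 < y) : deriv softId y = 1 := by
  have : softId =ᶠ[nhds y] id := by
    filter_upwards [lt_mem_nhds h] with z hz using softId_of_ge hz.le
  rw [this.deriv_eq, deriv_id]

theorem deriv_softId_of_lt {y : ℝ} (h : y < 1) : deriv softId y = 0 := by
  have : softId =ᶠ[nhds y] fun _ => 0 := by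
    filter_upwards [gt_mem_nhds h] with z hz using softId_of_le (le_of_lt hz)
  rw [this.deriv_eq, deriv_const]

theorem continuous_deriv_softId : Continuous (deriv softId) :=
  contDiff_softId.continuous_deriv (by simp)

theorem exists_deriv_softId_le : ∃ C, ∀ y, |deriv softId y| ≤ C := by
  obtain ⟨C, hC⟩ := (isCompact_Icc (a := (1 : ℝ)) (b := 2)).exists_bound_of_continuousOn
    continuous_deriv_softId.continuousOn
  refine ⟨max C 1, fun y => ?_⟩
  rcases lt_or_ge y 1 with h | h
  · rw [deriv_softId_of_lt h, abs_zero]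
    exact zero_le_one.trans (le_max_right _ _)
  · rcases lt_or_ge 2 y with h' | h'
    · rw [deriv_softId_of_gt h', abs_one]
      exact le_max_right _ _
    · exact (hC y ⟨h, h'⟩).trans (le_max_left _ _)

/-- The function `w` on `(α, β)`, cut off where it is smaller than `δ`. -/
def cutoff (α β : ℝ) (w : ℝ → ℝ) (δ t : ℝ) : ℝ :=
  open Classical in if t ∈ Ioo α β then δ * softId (w t / δ) else 0

section Cutoff

variable {α β δ t : ℝ} {w : ℝ → ℝ} {U : Set ℝ}

theorem cutoff_eq_zero (hδ : 0 < δ) (h : ¬ (t ∈ Icc α β ∧ δ ≤ w t)) : cutoff α β w δ t = 0 := by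
  rw [cutoff]
  split_ifs with ht
  · rw [softId_of_le, mul_zero]
    rw [div_le_one hδ]
    by_contra hw
    exact h ⟨Ioo_subset_Icc_self ht, (not_le.1 hw).le⟩
  · rfl

theorem cutoff_eventuallyEq (ht : t ∈ Ioo α β) :
    cutoff α β w δ =ᶠ[nhds t] fun t => δ * softId (w t / δ) := by
  filter_upwards [isOpen_Ioo.mem_nhds ht] with s hs
  rw [cutoff, if_pos hs]

/-- Near the zeros α and β the function is below δ, so the cut-off vanishes there identically and
the extension by zero is smooth. -/
theorem contDiff_cutoff (hU : IsOpen U) (hw : ContDiffOn ℝ ∞ w U) (hsub : Icc α β ⊆ U)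
    (hα : w α = 0) (hβ : w β = 0) (hδ : 0 < δ) : ContDiff ℝ ∞ (cutoff α β w δ) := by
  rw [contDiff_iff_contDiffAt]
  intro t
  by_cases ht : t ∈ Ioo α β
  · refine ContDiffAt.congr_of_eventuallyEq ?_ (cutoff_eventuallyEq ht)
    have h1 : ContDiffAt ℝ ∞ w t := hw.contDiffAt (hU.mem_nhds (hsub (Ioo_subset_Icc_self ht)))
    exact contDiffAt_const.mul (contDiff_softId.contDiffAt.comp t (h1.div_const δ))
  · have hz : cutoff α β w δ =ᶠ[nhds t] fun _ => 0 := by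
      by_cases ht' : t ∈ Icc α β
      · have hw0 : w t = 0 := by
          rcases eq_or_lt_of_le ht'.1 with h | h
          · rw [← h, hα]
          · rcases eq_or_lt_of_le ht'.2 with h' | h'
            · rw [h', hβ]
            · exact absurd ⟨h, h'⟩ ht
        have hc := hw.continuousOn.continuousAt (hU.mem_nhds (hsub ht'))
        have : ∀ᶠ s in nhds t, w s < δ := hc.eventually_lt_const (by rwa [hw0])
        filter_upwards [this] with s hs
        exact cutoff_eq_zero hδ fun h => h.2.not_gt hs
      · filter_upwards [isClosed_Icc.isOpen_compl.mem_nhds ht'] with s hs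
        exact cutoff_eq_zero hδ fun h => hs h.1
    exact contDiffAt_const.congr_of_eventuallyEq hz

theorem isCompact_cutoff_support (hw : ContinuousOn w (Icc α β)) :
    IsCompact {t | t ∈ Icc α β ∧ δ ≤ w t} :=
  isCompact_Icc.of_isClosed_subset
    (hw.preimage_isClosed_of_isClosed isClosed_Icc (isClosed_Ici (a := δ))) inter_subset_left

theorem cutoff_support_subset (hα : w α = 0) (hβ : w β = 0) (hδ : 0 < δ) :
    {t | t ∈ Icc α β ∧ δ ≤ w t} ⊆ Ioo α β := by
  rintro t ⟨ht, hw⟩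
  refine ⟨lt_of_le_of_ne ht.1 ?_, lt_of_le_of_ne ht.2 ?_⟩
  · rintro rfl; linarith
  · rintro rfl; linarith

theorem deriv_cutoff (hw : DifferentiableAt ℝ w t) (ht : t ∈ Ioo α β) (hδ : 0 < δ) :
    deriv (cutoff α β w δ) t = deriv softId (w t / δ) * deriv w t := by
  rw [(cutoff_eventuallyEq ht).deriv_eq]
  have h1 := ((contDiff_softId.differentiable (by simp)) (w t / δ)).hasDerivAt.comp t
    (hw.hasDerivAt.div_const δ)
  have h2 : HasDerivAt (fun t => δ * softId (w t / δ)) _ t := h1.const_mul δ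
  rw [h2.deriv]
  field_simp

/-- Dominated convergence: at a fixed interior t the cut-off and its derivative agree with w and w'
as soon as 2δ < w(t), and they are bounded by |w| and C|w'|. The weights A and B are free so that
the form and the mass are both covered. -/
theorem tendsto_integral_cutoff {T : ℝ} (hU : IsOpen U) (hw : ContDiffOn ℝ ∞ w U)
    (hsub : Icc α β ⊆ U) (hT : Icc α β ⊆ Ioo (-T) T) (hα : w α = 0) (hβ : w β = 0)
    (hpos : ∀ t ∈ Ioo α β, 0 < w t) {A B : ℝ → ℝ} (hA : ContinuousOn A (Icc α β))
    (hB : ContinuousOn B (Icc α β)) :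
    Filter.Tendsto (fun k : ℕ => ∫ t in Ioo (-T) T,
      (A t * deriv (cutoff α β w (1 / ((k : ℝ) + 1))) t ^ 2
        - B t * cutoff α β w (1 / ((k : ℝ) + 1)) t ^ 2)) Filter.atTop
      (nhds (∫ t in Ioo α β, (A t * deriv w t ^ 2 - B t * w t ^ 2))) := by
  have hδ : ∀ k : ℕ, (0 : ℝ) < 1 / ((k : ℝ) + 1) := fun k => by positivity
  have hsm := fun k : ℕ => contDiff_cutoff hU hw hsub hα hβ (hδ k)
  have hsub' : Ioo α β ⊆ Icc α β := Ioo_subset_Icc_self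
  have hwd : ∀ t ∈ Ioo α β, DifferentiableAt ℝ w t := fun t ht =>
    (hw.differentiableOn (by simp)).differentiableAt (hU.mem_nhds (hsub (hsub' ht)))
  have hwc := hw.continuousOn.mono hsub
  have hwc' : ContinuousOn (deriv w) (Icc α β) :=
    ((contDiffOn_infty_iff_deriv_of_isOpen hU).1 hw).2.continuousOn.mono hsub
  obtain ⟨C, hC⟩ := exists_deriv_softId_le
  have hred : ∀ k : ℕ, ∫ t in Ioo (-T) T,
      (A t * deriv (cutoff α β w (1 / ((k : ℝ) + 1))) t ^ 2
        - B t * cutoff α β w (1 / ((k : ℝ) + 1)) t ^ 2) = ∫ t in Ioo α β,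
      (A t * deriv (cutoff α β w (1 / ((k : ℝ) + 1))) t ^ 2
        - B t * cutoff α β w (1 / ((k : ℝ) + 1)) t ^ 2) := by
    intro k
    refine setIntegral_eq_of_subset_of_forall_sdiff_eq_zero measurableSet_Ioo
      (hsub'.trans hT) fun t ht => ?_
    have hS := cutoff_support_subset hα hβ (hδ k)
    have hSc := (isCompact_cutoff_support (δ := 1 / ((k : ℝ) + 1)) hwc).isClosed
    have hz : cutoff α β w (1 / ((k : ℝ) + 1)) =ᶠ[nhds t] fun _ => 0 := by
      filter_upwards [hSc.isOpen_compl.mem_nhds fun h => ht.2 (hS h)] with s hs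
      exact cutoff_eq_zero (hδ k) hs
    rw [hz.deriv_eq, hz.self_of_nhds]
    simp
  simp only [hred]
  refine tendsto_integral_of_dominated_convergence
    (fun t => |A t| * (C * deriv w t) ^ 2 + |B t| * w t ^ 2) (fun k => ?_) ?_ (fun k => ?_) ?_
  · have h1 := (hsm k).continuous
    have h2 : Continuous (deriv (cutoff α β w (1 / ((k : ℝ) + 1)))) :=
      (hsm k).continuous_deriv (by simp)
    refine ContinuousOn.aestronglyMeasurable ?_ measurableSet_Ioo
    exact ((hA.mono hsub').mul (h2.pow 2).continuousOn).sub
      ((hB.mono hsub').mul (h1.pow 2).continuousOn)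
  · have hc : ContinuousOn (fun t => |A t| * (C * deriv w t) ^ 2 + |B t| * w t ^ 2) (Icc α β) :=
      (hA.abs.mul ((continuousOn_const.mul hwc').pow 2)).add (hB.abs.mul (hwc.pow 2))
    exact hc.integrableOn_Icc.mono_set hsub'
  · refine (ae_restrict_mem measurableSet_Ioo).mono fun t ht => ?_
    rw [deriv_cutoff (hwd t ht) ht (hδ k), Real.norm_eq_abs]
    refine (abs_sub _ _).trans (add_le_add ?_ ?_)
    · rw [abs_mul, abs_sq, mul_pow, mul_pow, ← sq_abs (deriv softId _)]
      have := hC (w t / (1 / ((k : ℝ) + 1)))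
      gcongr
    · rw [abs_mul, abs_sq, cutoff, if_pos ht, ← sq_abs (_ * _), ← sq_abs (w t)]
      have h1 := abs_softId_le (w t / (1 / ((k : ℝ) + 1)))
      have h2 : |1 / ((k : ℝ) + 1) * softId (w t / (1 / ((k : ℝ) + 1)))| ≤ |w t| := by
        rw [abs_mul, abs_of_pos (hδ k)]
        refine (mul_le_mul_of_nonneg_left h1 (hδ k).le).trans (le_of_eq ?_)
        rw [abs_div, abs_of_pos (hδ k)]
        field_simp
      gcongr
  · refine (ae_restrict_mem measurableSet_Ioo).mono fun t ht => ?_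
    refine tendsto_const_nhds.congr' ?_
    have hlim : Filter.Tendsto (fun k : ℕ => 1 / ((k : ℝ) + 1)) Filter.atTop (nhds 0) :=
      tendsto_one_div_add_atTop_nhds_zero_nat
    filter_upwards [hlim.eventually_lt_const (show (0 : ℝ) < w t / 2 from half_pos (hpos t ht))]
      with k hk
    have h2 : 2 < w t / (1 / ((k : ℝ) + 1)) := by
      rw [lt_div_iff₀ (hδ k)]
      linarith
    rw [deriv_cutoff (hwd t ht) ht (hδ k), deriv_softId_of_gt h2, one_mul, cutoff, if_pos ht,
      softId_of_ge h2.le, mul_div_cancel₀ _ (hδ k).ne']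

end Cutoff

/-! ## The signs of the Jacobi fields -/

/-- The function `h - κ t - c`. -/
def shiftH (f : ℝ → ℝ) (κ c t : ℝ) : ℝ := scaleH f t - κ * t - c

namespace IsProfile

variable {n : ℕ} {a : ℝ} {f : ℝ → ℝ} {t κ c d : ℝ}

theorem hasDerivAt_shiftH {T : ℝ} (hf : IsProfile n a (Ioo (-T) T) f) (κ c : ℝ)
    (ht : t ∈ Ioo (-T) T) :
    HasDerivAt (shiftH f κ c) ((4 + 2 * f t ^ 2) / (4 + f t ^ 2) - κ) t := by
  have h := ((hf.hasDerivAt_scaleH ht).sub ((hasDerivAt_id t).const_mul κ)).sub_const c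
  rw [mul_one] at h
  exact h

theorem fieldW_shiftH_pos_of_pos (hf : IsFullProfile n a f) (hn : 2 ≤ n) (ha : 0 < a)
    (ht : t ∈ Ioo 0 (catHalf n a)) :
    fieldW n a f (shiftH f κ c) t =
      deriv f t * (jacobiRatio f t + κ * t + c) / weightW n a f t := by
  have hd := (hf.deriv_pos hn ha ht).ne'
  rw [fieldW, shiftH, jacobiRatio]
  congr 1
  field_simp
  ring

theorem fieldW_shiftH_neg (hf : IsFullProfile n a f) (hn : 2 ≤ n) (ha : 0 < a)
    (ht : t ∈ Ioo 0 (catHalf n a)) :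
    fieldW n a f (shiftH f κ c) (-t) =
      deriv f t * (jacobiRatio f t + κ * t - c) / weightW n a f (-t) := by
  have ht' : t ∈ Ioo (-catHalf n a) (catHalf n a) := ⟨by linarith [ht.1, ht.2], ht.2⟩
  have hd := (hf.deriv_pos hn ha ht).ne'
  rw [fieldW, shiftH, jacobiRatio, hf.even hn ha ht', hf.deriv_neg hn ha ht',
    hf.scaleH_neg hn ha ht']
  congr 1
  field_simp
  ring

/-- On t > 0 the field has the sign of the ratio plus c, at -t that of the ratio minus c, and at t =
0 it equals a > 0 divided by the weight. Positivity thus becomes two one-sided bounds on the ratio.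
-/
theorem fieldW_shiftH_pos (hf : IsFullProfile n a f) (hn : 2 ≤ n) (ha : 0 < a) {D : Set ℝ}
    (hD : D ⊆ Ioo (-catHalf n a) (catHalf n a))
    (h1 : ∀ t ∈ Ioo 0 (catHalf n a), -t ∈ D → c < jacobiRatio f t + κ * t)
    (h2 : ∀ t ∈ Ioo 0 (catHalf n a), t ∈ D → -c < jacobiRatio f t + κ * t) :
    ∀ t ∈ D, 0 < fieldW n a f (shiftH f κ c) t := by
  intro t ht
  have hW := hf.weightW_pos ha (hD ht)
  rcases lt_trichotomy t 0 with h | h | h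
  · have ht' : -t ∈ Ioo 0 (catHalf n a) := ⟨by linarith, by linarith [(hD ht).1]⟩
    have := h1 (-t) ht' (by rwa [neg_neg])
    have hd := hf.deriv_pos hn ha ht'
    have e := hf.fieldW_shiftH_neg hn ha ht' (κ := κ) (c := c)
    rw [neg_neg] at e
    rw [e]
    exact div_pos (mul_pos hd (by linarith)) hW
  · rw [fieldW, h, hf.deriv_zero, hf.value_zero, zero_mul, sub_zero]
    rw [h] at hW
    exact div_pos ha hW
  · have ht' : t ∈ Ioo 0 (catHalf n a) := ⟨h, (hD ht).2⟩
    have := h2 t ht' ht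
    have hd := hf.deriv_pos hn ha ht'
    rw [hf.fieldW_shiftH_pos_of_pos hn ha ht']
    exact div_pos (mul_pos hd (by linarith)) hW

theorem fieldW_shiftH_nodal (hf : IsFullProfile n a f) (hn : 2 ≤ n) (ha : 0 < a) (hκ : κ ≤ 1)
    {r s : ℝ} (hr : r ∈ Ioo 0 (catHalf n a)) (hs : s ∈ Ioo 0 (catHalf n a))
    (hcr : jacobiRatio f r + κ * r = c) (hcs : jacobiRatio f s + κ * s = -c) :
    fieldW n a f (shiftH f κ c) (-r) = 0 ∧ fieldW n a f (shiftH f κ c) s = 0 ∧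
      ∀ t ∈ Ioo (-r) s, 0 < fieldW n a f (shiftH f κ c) t := by
  have hanti := hf.strictAntiOn_jacobiRatio_add hn ha hκ
  refine ⟨?_, ?_, hf.fieldW_shiftH_pos hn ha ?_ ?_ ?_⟩
  · rw [hf.fieldW_shiftH_neg hn ha hr, hcr, sub_self, mul_zero, zero_div]
  · rw [hf.fieldW_shiftH_pos_of_pos hn ha hs, hcs, neg_add_cancel, mul_zero, zero_div]
  · exact Ioo_subset_Ioo (by linarith [hr.2]) hs.2.le
  · intro t ht h
    rw [← hcr]
    exact hanti ht hr (by linarith [h.1])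
  · intro t ht h
    rw [← hcs]
    exact hanti ht hs h.2

/-- The logarithmic derivative of a Jacobi field satisfies a Riccati equation. -/
theorem hasDerivAt_riccati {T : ℝ} (hf : IsProfile n a (Ioo (-T) T) f) (hn : 2 ≤ n) (ha : 0 < a)
    (ht : t ∈ Ioo (-T) T) (hw : fieldW n a f (shiftH f 0 c) t ≠ 0) :
    HasDerivAt (fun t => fieldY n a f (shiftH f 0 c) t / fieldW n a f (shiftH f 0 c) t)
      (-jacobiPotential n f t -
        (fieldY n a f (shiftH f 0 c) t / fieldW n a f (shiftH f 0 c) t) ^ 2 / weightP f t) t := by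
  have hH := hf.hasDerivAt_shiftH 0 c ht
  have hP := (weightP_pos f t).ne'
  refine ((hf.hasDerivAt_fieldY hn ha ht hH).div (hf.hasDerivAt_fieldW hn ha ht hH)
    hw).congr_deriv ?_
  field_simp
  ring

/-- Two positive Jacobi fields on `[α, β]` bound the quadratic form from below. -/
theorem exists_pos_le_jacobiForm {T : ℝ} (hf : IsProfile n a (Ioo (-T) T) f) (hn : 2 ≤ n)
    (ha : 0 < a) {α β : ℝ} (hα : -T < α) (hαβ : α ≤ β) (hβ : β < T) (hcd : c ≠ d)
    (hc : ∀ t ∈ Icc α β, 0 < fieldW n a f (shiftH f 0 c) t)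
    (hd : ∀ t ∈ Icc α β, 0 < fieldW n a f (shiftH f 0 d) t) :
    ∃ l, 0 < l ∧ ∀ (u : Nil n → ℝ) (K : Set (Nil n)), ContDiff ℝ 1 u → IsCompact K →
      K ⊆ piece n f α β → (∀ p ∈ piece n f (-T) T, p ∉ K → u p = 0) →
      l * areaIntegral n f T (fun p => u p ^ 2) ≤ jacobiForm n f T u := by
  have hsub : Icc α β ⊆ Ioo (-T) T := fun t ht => ⟨hα.trans_le ht.1, ht.2.trans_lt hβ⟩
  set p := fun t => fieldY n a f (shiftH f 0 c) t / fieldW n a f (shiftH f 0 c) t with hp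
  set q := fun t => fieldY n a f (shiftH f 0 d) t / fieldW n a f (shiftH f 0 d) t with hq
  have hpd : ∀ t ∈ Icc α β, HasDerivAt p (-jacobiPotential n f t - p t ^ 2 / weightP f t) t :=
    fun t ht => hf.hasDerivAt_riccati hn ha (hsub ht) (hc t ht).ne'
  have hqd : ∀ t ∈ Icc α β, HasDerivAt q (-jacobiPotential n f t - q t ^ 2 / weightP f t) t :=
    fun t ht => hf.hasDerivAt_riccati hn ha (hsub ht) (hd t ht).ne'
  have hpc : ContinuousOn p (Icc α β) := fun t ht => (hpd t ht).continuousAt.continuousWithinAt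
  have hqc : ContinuousOn q (Icc α β) := fun t ht => (hqd t ht).continuousAt.continuousWithinAt
  have hPc := hf.continuousOn_weightP.mono hsub
  have hWc := hf.continuousOn_weightW.mono hsub
  have hVc := hf.continuousOn_jacobiPotential.mono hsub
  have hgap : ContinuousOn (fun t => (p t - q t) ^ 2 / (4 * weightP f t * weightW n a f t ^ 2))
      (Icc α β) := by
    refine ContinuousOn.div (by fun_prop) (by fun_prop) fun t ht => ?_
    have := hf.weightW_pos ha (hsub ht)
    have := weightP_pos f t
    positivity
  obtain ⟨t₀, ht₀, hmin⟩ := isCompact_Icc.exists_isMinOn (nonempty_Icc.2 hαβ) hgap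
  refine ⟨_, ?_, fun u K hu hKc hK h0 => le_jacobiForm hf hn ha hα hαβ hβ hu hKc hK h0
    -- By strict convexity of the square, the average of two Riccati solutions gains (p - q)²/(4P),
    -- which is nonzero by the Wronskian. Compactness turns this into the uniform constant at `t₀`.
    (ρ := fun t => -((p t + q t) / 2))
    (ρ' := fun t => jacobiPotential n f t + (p t ^ 2 + q t ^ 2) / (2 * weightP f t))
    (c := (p t₀ - q t₀) ^ 2 / (4 * weightP f t₀ * weightW n a f t₀ ^ 2))
    (fun t ht => ?_) ?_ fun t ht => ?_⟩
  · have h1 := hf.wronskian_sub hn ha (hsub ht₀) (fun t => scaleH f t - 0 * t) c d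
    have hne : p t₀ - q t₀ ≠ 0 := by
      rw [hp, hq]
      simp only
      rw [div_sub_div _ _ (hc t₀ ht₀).ne' (hd t₀ ht₀).ne']
      refine div_ne_zero ?_ (mul_ne_zero (hc t₀ ht₀).ne' (hd t₀ ht₀).ne')
      have h2 : (c - d) * (2 * (n : ℝ) - 1) ≠ 0 :=
        mul_ne_zero (sub_ne_zero.2 hcd) (by linarith [exponent_pos hn])
      rw [← h1] at h2
      rw [mul_comm (fieldW n a f (shiftH f 0 c) t₀)]
      exact h2
    have := hf.weightW_pos ha (hsub ht₀)
    have := weightP_pos f t₀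
    positivity
  · have hP := (weightP_pos f t).ne'
    refine (((hpd t ht).add (hqd t ht)).div_const 2).neg.congr_deriv ?_
    field_simp
    ring
  · refine hVc.add (ContinuousOn.div (by fun_prop) (by fun_prop) fun t _ => ?_)
    have := weightP_pos f t
    positivity
  · have hP := weightP_pos f t
    have hW := hf.weightW_pos ha (hsub ht)
    have hm := mul_le_mul_of_nonneg_right (hmin ht) (sq_nonneg (weightW n a f t))
    refine hm.trans (le_of_eq ?_)
    simp only
    field_simp
    ring

/-- A positive Jacobi field on `[α, β]` makes the quadratic form nonnegative. -/
theorem jacobiForm_nonneg {T : ℝ} (hf : IsProfile n a (Ioo (-T) T) f) (hn : 2 ≤ n)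
    (ha : 0 < a) {α β : ℝ} (hα : -T < α) (hαβ : α ≤ β) (hβ : β < T)
    (hc : ∀ t ∈ Icc α β, 0 < fieldW n a f (shiftH f 0 c) t) {u : Nil n → ℝ} {K : Set (Nil n)}
    (hu : ContDiff ℝ 1 u) (hKc : IsCompact K) (hK : K ⊆ piece n f α β)
    (h0 : ∀ p ∈ piece n f (-T) T, p ∉ K → u p = 0) : 0 ≤ jacobiForm n f T u := by
  have hsub : Icc α β ⊆ Ioo (-T) T := fun t ht => ⟨hα.trans_le ht.1, ht.2.trans_lt hβ⟩
  set p := fun t => fieldY n a f (shiftH f 0 c) t / fieldW n a f (shiftH f 0 c) t with hp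
  have hpd : ∀ t ∈ Icc α β, HasDerivAt p (-jacobiPotential n f t - p t ^ 2 / weightP f t) t :=
    fun t ht => hf.hasDerivAt_riccati hn ha (hsub ht) (hc t ht).ne'
  have hpc : ContinuousOn p (Icc α β) := fun t ht => (hpd t ht).continuousAt.continuousWithinAt
  have hPc := hf.continuousOn_weightP.mono hsub
  have hVc := hf.continuousOn_jacobiPotential.mono hsub
  have h := le_jacobiForm hf hn ha hα hαβ hβ hu hKc hK h0 (ρ := fun t => -p t)
    (ρ' := fun t => -(-jacobiPotential n f t - p t ^ 2 / weightP f t)) (c := 0)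
    (fun t ht => (hpd t ht).neg)
    ((hVc.neg.sub ((hpc.pow 2).div hPc fun t _ => (weightP_pos f t).ne')).neg)
    fun t ht => by simp only [neg_sq]; linarith
  rwa [zero_mul] at h

end IsProfile

/-! ## Compact subsets and test functions -/

section Test

variable {n : ℕ} {f : ℝ → ℝ} {r s T : ℝ}

theorem piece_mono {r' s' : ℝ} (h1 : r' ≤ r) (h2 : s ≤ s') : piece n f r s ⊆ piece n f r' s' :=
  image_mono (prod_mono (Ioo_subset_Ioo h1 h2) Subset.rfl)

theorem exists_subset_piece {K : Set (Nil n)} (hrs : r < s) (hKc : IsCompact K)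
    (hK : K ⊆ piece n f r s) : ∃ α β, r < α ∧ α ≤ β ∧ β < s ∧ K ⊆ piece n f α β := by
  -- The midpoint is inserted so that the extrema exist and α ≤ β even if K is empty.
  have hsnd : IsCompact (insert ((r + s) / 2) (Prod.snd '' K)) :=
    (hKc.image continuous_snd).insert _
  have hne : (insert ((r + s) / 2) (Prod.snd '' K)).Nonempty := insert_nonempty _ _
  have hmem : ∀ t ∈ insert ((r + s) / 2) (Prod.snd '' K), r < t ∧ t < s := by
    rintro t (rfl | ⟨p, hp, rfl⟩)
    · constructor <;> linarith
    · obtain ⟨q, hq, rfl⟩ := hK hp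
      exact hq.1
  obtain ⟨x, hx, hxm⟩ := hsnd.exists_isLeast hne
  obtain ⟨y, hy, hym⟩ := hsnd.exists_isGreatest hne
  have h1 := hmem x hx
  have h2 := hmem y hy
  refine ⟨(r + x) / 2, (y + s) / 2, by linarith, by linarith [hxm hy], by linarith, ?_⟩
  intro p hp
  have hp' : p.2 ∈ insert ((r + s) / 2) (Prod.snd '' K) := Or.inr ⟨p, hp, rfl⟩
  have h3 := hxm hp'
  have h4 := hym hp'
  obtain ⟨q, hq, rfl⟩ := hK hp
  have h3 : x ≤ q.1 := h3
  have h4 : q.1 ≤ y := h4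
  exact (revol_mem_piece_iff q).2 ⟨by linarith, by linarith⟩

theorem le_firstEigenvalue {Ω : Set (Nil n)} {l : ℝ}
    (h : ∀ u, IsTestFunction n f T Ω u → (∃ p ∈ piece n f (-T) T, u p ≠ 0) →
      l ≤ jacobiForm n f T u / areaIntegral n f T (fun p => u p ^ 2)) :
    (l : EReal) ≤ firstEigenvalue n f T Ω :=
  le_iInf fun u => le_iInf fun hu => le_iInf fun hne => EReal.coe_le_coe_iff.2 (h u hu hne)

theorem isRelCompactOpen_piece {n : ℕ} {a : ℝ} (hf : IsProfile n a (Ioo (-T) T) f) (hr : -T < r)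
    (hs : s < T) : IsRelCompactOpen n f T (piece n f r s) := by
  have hsub : Icc r s ⊆ Ioo (-T) T := fun t ht => ⟨hr.trans_le ht.1, ht.2.trans_lt hs⟩
  refine ⟨⟨{p | p.2 ∈ Ioo r s}, isOpen_Ioo.preimage continuous_snd, ?_⟩,
    revol f '' (Icc r s ×ˢ univ), (isCompact_Icc.prod isCompact_univ).image_of_continuousOn
      ((continuousOn_revol hf).mono (prod_mono hsub Subset.rfl)),
    image_mono (prod_mono hsub Subset.rfl), image_mono (prod_mono Ioo_subset_Icc_self Subset.rfl)⟩
  ext p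
  constructor
  · rintro ⟨q, hq, rfl⟩
    exact ⟨(revol_mem_piece_iff q).2 (hsub (Ioo_subset_Icc_self hq.1)), hq.1⟩
  · rintro ⟨⟨q, -, rfl⟩, hq⟩
    exact (revol_mem_piece_iff q).2 hq

/-- Subdomains are relatively compact in the whole hypersurface, not in the piece, so they may touch
its finite boundary slices. Hence α = r and β = s are allowed, and two positive fields are required
up to and including such ends. -/
theorem isRStable_piece {a : ℝ} (hf : IsProfile n a (Ioo (-T) T) f) (hn : 2 ≤ n) (ha : 0 < a)
    (hr : -T ≤ r) (hrs : r < s) (hs : s ≤ T)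
    (h : ∀ α β, r ≤ α → -T < α → β ≤ s → β < T → ∃ c d, c ≠ d ∧
      (∀ t ∈ Icc α β, 0 < fieldW n a f (shiftH f 0 c) t) ∧
      ∀ t ∈ Icc α β, 0 < fieldW n a f (shiftH f 0 d) t) :
    IsRStable n f T (piece n f r s) := by
  intro Ω hΩ hrel
  refine ⟨hrel, ?_⟩
  obtain ⟨-, L, hLc, hL, hΩL⟩ := hrel
  obtain ⟨α₀, β₀, hα₀, hαβ₀, hβ₀, hLp⟩ := exists_subset_piece (by linarith) hLc hL
  -- Clamping with the midpoint keeps α ≤ β even if the range of heights of `L` does not meet (r,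
  -- s).
  set m := (r + s) / 2 with hm
  set α := max r (min α₀ m) with hα
  set β := min s (max β₀ m) with hβ
  have hαm : α ≤ m := max_le (by linarith) (min_le_right _ _)
  have hmβ : m ≤ β := le_min (by linarith) (le_max_right _ _)
  have hTα : -T < α := lt_max_of_lt_right (lt_min hα₀ (by linarith))
  have hβT : β < T := min_lt_of_right_lt (max_lt hβ₀ (by linarith))
  have hΩp : Ω ⊆ piece n f α β := by
    intro p hp
    have h1 := hΩ hp
    have h2 := hLp (hΩL hp)
    obtain ⟨q, hq, rfl⟩ := h1
    have hq2 := (revol_mem_piece_iff q).1 h2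
    exact (revol_mem_piece_iff q).2 ⟨max_lt hq.1.1 (min_lt_of_left_lt hq2.1),
      lt_min hq.1.2 (lt_max_of_lt_left hq2.2)⟩
  obtain ⟨c, d, hcd, hc, hd⟩ := h α β (le_max_left _ _) hTα (min_le_left _ _) hβT
  obtain ⟨l, hl, hle⟩ := hf.exists_pos_le_jacobiForm hn ha hTα (hαm.trans hmβ) hβT hcd hc hd
  refine (EReal.coe_pos.2 hl).trans_le (le_firstEigenvalue ?_)
  rintro u ⟨hu, K, hKc, hK, h0⟩ hne
  have hpos := areaIntegral_sq_pos hf hn ha hTα hβT hu.continuous (hK.trans hΩp) h0 hne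
  rw [le_div_iff₀ hpos]
  exact hle u K (hu.of_le (by exact_mod_cast le_top)) hKc (hK.trans hΩp) h0

/-- The cut-off of a function of the height is a test function. -/
theorem isTestFunction_cutoff {a α β δ : ℝ} (hf : IsProfile n a (Ioo (-T) T) f) {w : ℝ → ℝ}
    (hw : ContDiffOn ℝ ∞ w (Ioo (-T) T)) (hα : -T < α) (hβ : β < T) (h0 : w α = 0) (h1 : w β = 0)
    (hδ : 0 < δ) : IsTestFunction n f T (piece n f α β) fun p => cutoff α β w δ p.2 := by
  have hsub : Icc α β ⊆ Ioo (-T) T := fun t ht => ⟨hα.trans_le ht.1, ht.2.trans_lt hβ⟩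
  have hS := cutoff_support_subset h0 h1 hδ
  refine ⟨(contDiff_cutoff isOpen_Ioo hw hsub h0 h1 hδ).comp contDiff_snd,
    revol f '' ({t | t ∈ Icc α β ∧ δ ≤ w t} ×ˢ univ),
    ((isCompact_cutoff_support (hw.continuousOn.mono hsub)).prod
      isCompact_univ).image_of_continuousOn ((continuousOn_revol hf).mono
        (prod_mono (fun t ht => hsub ht.1) Subset.rfl)),
    image_mono (prod_mono hS Subset.rfl), ?_⟩
  rintro _ ⟨q, -, rfl⟩ hq
  exact cutoff_eq_zero hδ fun h => hq ⟨q, ⟨h, mem_univ _⟩, rfl⟩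

theorem tendsto_jacobiForm_cutoff {a α β κ c : ℝ} (hf : IsProfile n a (Ioo (-T) T) f) (hn : 2 ≤ n)
    (ha : 0 < a) (hα : -T < α) (hαβ : α ≤ β) (hβ : β < T)
    (h0 : fieldW n a f (shiftH f κ c) α = 0) (h1 : fieldW n a f (shiftH f κ c) β = 0)
    (hpos : ∀ t ∈ Ioo α β, 0 < fieldW n a f (shiftH f κ c) t) :
    Filter.Tendsto (fun k : ℕ => jacobiForm n f T
      fun p => cutoff α β (fieldW n a f (shiftH f κ c)) (1 / ((k : ℝ) + 1)) p.2) Filter.atTop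
      (nhds (a ^ (2 * n - 1) * (sphereArea n * ∫ t in Ioo α β,
        κ * (κ * (1 - 1 / weightW n a f t ^ 2) - (2 * (n : ℝ) - 1))))) := by
  have hsub : Icc α β ⊆ Ioo (-T) T := fun t ht => ⟨hα.trans_le ht.1, ht.2.trans_lt hβ⟩
  have hH := fun t ht => hf.hasDerivAt_shiftH (t := t) κ c ht
  have hw := hf.contDiffOn_field ha hH
  rw [← hf.integral_form_field hn ha hH hα hαβ hβ h0 h1]
  have hlim := tendsto_integral_cutoff isOpen_Ioo hw hsub hsub h0 h1 hpos
    (hf.continuousOn_weightP.mono hsub) (hf.continuousOn_jacobiPotential.mono hsub)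
  refine ((hlim.const_mul _).const_mul _).congr fun k => ?_
  rw [jacobiForm_height hf hn ha
    ((contDiff_cutoff isOpen_Ioo hw hsub h0 h1 (by positivity)).differentiable (by simp))]

theorem integral_sq_pos {α β : ℝ} (hαβ : α < β) {w g : ℝ → ℝ} (hw : ContinuousOn w (Icc α β))
    (hg : ContinuousOn g (Icc α β)) (hw0 : ∀ t ∈ Ioo α β, 0 < w t) (hg0 : ∀ t ∈ Ioo α β, 0 < g t) :
    0 < ∫ t in Ioo α β, g t * w t ^ 2 := by
  rw [← integral_Ioc_eq_integral_Ioo, ← intervalIntegral.integral_of_le hαβ.le]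
  refine intervalIntegral.intervalIntegral_pos_of_pos_on ?_
    (fun t ht => mul_pos (hg0 t ht) (pow_pos (hw0 t ht) 2)) hαβ
  refine ContinuousOn.intervalIntegrable ?_
  rw [uIcc_of_le hαβ.le]
  exact hg.mul (hw.pow 2)

/-- A domain on which a Jacobi field is positive, vanishing on the boundary. -/
theorem isStableUnstable_piece {a α β c : ℝ} (hf : IsProfile n a (Ioo (-T) T) f) (hn : 2 ≤ n)
    (ha : 0 < a) (hα : -T < α) (hαβ : α < β) (hβ : β < T)
    (h0 : fieldW n a f (shiftH f 0 c) α = 0) (h1 : fieldW n a f (shiftH f 0 c) β = 0)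
    (hpos : ∀ t ∈ Ioo α β, 0 < fieldW n a f (shiftH f 0 c) t) :
    IsStableUnstable n f T (piece n f α β) := by
  have hsub : Icc α β ⊆ Ioo (-T) T := fun t ht => ⟨hα.trans_le ht.1, ht.2.trans_lt hβ⟩
  have hw := hf.contDiffOn_field ha fun t ht => hf.hasDerivAt_shiftH (t := t) 0 c ht
  refine ⟨isRelCompactOpen_piece hf hα hβ, le_antisymm ?_ ?_⟩
  · set W := fieldW n a f (shiftH f 0 c) with hWdef
    have hform := tendsto_jacobiForm_cutoff hf hn ha hα hαβ.le hβ h0 h1 hpos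
    simp only [zero_mul, integral_zero, mul_zero] at hform
    have hmass : Filter.Tendsto (fun k : ℕ => areaIntegral n f T
        fun p => cutoff α β W (1 / ((k : ℝ) + 1)) p.2 ^ 2) Filter.atTop
        (nhds (a ^ (2 * n - 1) * (sphereArea n * ∫ t in Ioo α β, weightW n a f t ^ 2 * W t ^ 2))) := by
      have hlim := tendsto_integral_cutoff isOpen_Ioo hw hsub hsub h0 h1 hpos
        -- With zero gradient weight the same limit lemma gives the convergence of the mass.
        (A := fun _ => 0) (B := fun t => -weightW n a f t ^ 2) continuousOn_const
        ((hf.continuousOn_weightW.mono hsub).pow 2).neg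
      simp only [zero_mul, zero_sub, neg_mul, neg_neg] at hlim
      refine ((hlim.const_mul _).const_mul _).congr fun k => ?_
      rw [areaIntegral_height hf hn ha]
    have hM : 0 < a ^ (2 * n - 1) *
        (sphereArea n * ∫ t in Ioo α β, weightW n a f t ^ 2 * W t ^ 2) := by
      refine mul_pos (by positivity) (mul_pos (sphereArea_pos hn) (integral_sq_pos hαβ
        (hw.continuousOn.mono hsub) ((hf.continuousOn_weightW.mono hsub).pow 2) hpos fun t ht => ?_))
      exact pow_pos (hf.weightW_pos ha (hsub (Ioo_subset_Icc_self ht))) 2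
    have hquot := hform.div hmass hM.ne'
    rw [zero_div] at hquot
    have hquot' := (continuous_coe_real_ereal.tendsto 0).comp hquot
    refine ge_of_tendsto hquot' ?_
    filter_upwards [hmass.eventually_const_lt hM] with k hk
    refine iInf₂_le_of_le _ (isTestFunction_cutoff hf hw hα hβ h0 h1
      (δ := 1 / ((k : ℝ) + 1)) (by positivity)) (iInf_le_of_le ?_ le_rfl)
    by_contra! hzero
    refine hk.ne' ?_
    rw [areaIntegral]
    refine setIntegral_eq_zero_of_forall_eq_zero fun q hq => ?_
    have := hzero _ ((revol_mem_piece_iff q).2 hq.1)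
    rw [this]
    simp
  · rw [← EReal.coe_zero]
    refine le_firstEigenvalue ?_
    rintro u ⟨hu, K, hKc, hK, hu0⟩ hne
    have hpos' := areaIntegral_sq_pos hf hn ha hα hβ hu.continuous hK hu0 hne
    obtain ⟨α', β', hα', hαβ', hβ', hK'⟩ := exists_subset_piece hαβ hKc hK
    refine div_nonneg (hf.jacobiForm_nonneg (c := c) hn ha (hα.trans hα') hαβ' (hβ'.trans hβ) ?_
      (hu.of_le (by exact_mod_cast le_top)) hKc hK' hu0) hpos'.le
    exact fun t ht => hpos t ⟨hα'.trans_le ht.1, ht.2.trans_lt hβ'⟩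

/-- A function of the height with negative quadratic form. -/
theorem one_le_morseIndex {a : ℝ} (hf : IsProfile n a (Ioo (-T) T) f) (hn : 2 ≤ n) (ha : 0 < a)
    {χ : ℝ → ℝ} {Ω : Set (Nil n)} (hΩ : IsRelCompactOpen n f T Ω)
    (hχ : IsTestFunction n f T Ω fun p => χ p.2) (hχd : Differentiable ℝ χ)
    (hneg : jacobiForm n f T (fun p => χ p.2) < 0) : 1 ≤ morseIndex n f T := by
  set u : Nil n → ℝ := fun p => χ p.2 with hu
  have hscale : ∀ c : ℝ, jacobiForm n f T (c • u) = c ^ 2 * jacobiForm n f T u := by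
    intro c
    have e : (c • u) = fun p : Nil n => (fun t => c * χ t) p.2 := rfl
    -- Every multiple of u is again a function of the height, so homogeneity is read off from the
    -- one-dimensional integral.
    rw [e, jacobiForm_height hf hn ha (hχd.const_mul c), hu, jacobiForm_height hf hn ha hχd,
      mul_left_comm (c ^ 2), mul_left_comm (c ^ 2), ← integral_const_mul (c ^ 2)]
    congr 2
    refine integral_congr_ae (Filter.Eventually.of_forall fun t => ?_)
    simp only
    rw [deriv_const_mul _ (hχd t)]
    ring
  have hu0 : u ≠ 0 := by
    intro h
    have := hscale 0
    rw [zero_smul, ← h] at this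
    linarith
  refine le_iSup₂_of_le Ω hΩ (le_iSup₂_of_le (Submodule.span ℝ {u}) ?_ (le_iSup_of_le ?_ ?_))
  · intro v hv
    obtain ⟨c, rfl⟩ := Submodule.mem_span_singleton.1 hv
    obtain ⟨h1, K, hKc, hK, h0⟩ := hχ
    exact ⟨contDiff_const.smul h1, K, hKc, hK, fun p hp hpK => mul_eq_zero_of_right c (h0 p hp hpK)⟩
  · intro v hv hv0
    obtain ⟨c, rfl⟩ := Submodule.mem_span_singleton.1 hv
    have hc : c ≠ 0 := fun h => hv0 (by rw [h, zero_smul])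
    rw [hscale]
    exact mul_neg_of_pos_of_neg (by positivity) hneg
  · rw [rank_submodule_eq_one_iff _ |>.2 ⟨u, Submodule.mem_span_singleton_self u, hu0, le_rfl⟩]
    simp

end Test

/-! ### Stability and index read off from the ratio of the Jacobi fields -/

namespace IsProfile

variable {n : ℕ} {a : ℝ} {f : ℝ → ℝ} {H : ℝ}

theorem neg_lt_jacobiRatio {t : ℝ} (hf : IsFullProfile n a f) (hn : 2 ≤ n) (ha : 0 < a)
    (hlt : ∀ t ∈ Ioo (-catHalf n a) (catHalf n a), scaleH f t < H)
    (ht : t ∈ Ioo 0 (catHalf n a)) : -H < jacobiRatio f t := by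
  have ht' : t ∈ Ioo (-catHalf n a) (catHalf n a) := ⟨by linarith [ht.1, ht.2], ht.2⟩
  have := div_pos (hf.pos t ht') (hf.deriv_pos hn ha ht)
  rw [jacobiRatio]
  linarith [hlt t ht']

theorem isRStable_lower (hf : IsFullProfile n a f) (hn : 2 ≤ n) (ha : 0 < a)
    (hlt : ∀ t ∈ Ioo (-catHalf n a) (catHalf n a), scaleH f t < H) :
    IsRStable n f (catHalf n a) (piece n f (-catHalf n a) 0) := by
  have hT := catHalf_pos hn ha
  refine isRStable_piece hf hn ha le_rfl (by linarith) hT.le fun α β _ hα hβ hβT => ?_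
  have hsub : Icc α β ⊆ Ioo (-catHalf n a) (catHalf n a) :=
    fun t ht => ⟨hα.trans_le ht.1, ht.2.trans_lt hβT⟩
  -- The ratio stays above -H, so every c ≤ -H gives a field positive for t ≤ 0; two distinct ones
  -- suffice.
  refine ⟨-H, -H - 1, by linarith, hf.fieldW_shiftH_pos hn ha hsub ?_ ?_,
    hf.fieldW_shiftH_pos hn ha hsub ?_ ?_⟩
  · intro t ht _
    linarith [hf.neg_lt_jacobiRatio hn ha hlt ht]
  · exact fun t ht h => absurd (h.2.trans hβ) ht.1.not_ge
  · intro t ht _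
    linarith [hf.neg_lt_jacobiRatio hn ha hlt ht]
  · exact fun t ht h => absurd (h.2.trans hβ) ht.1.not_ge

/-- Positivity on [-l, b] holds for every c strictly between minus the ratio at b and H. This
interval is nonempty for each b < T because the ratio only reaches -H in the limit. -/
theorem isRStable_upper (hf : IsFullProfile n a f) (hn : 2 ≤ n) (ha : 0 < a)
    (hlt : ∀ t ∈ Ioo (-catHalf n a) (catHalf n a), scaleH f t < H) {l : ℝ}
    (hl : l ∈ Ioo 0 (catHalf n a)) (hlH : jacobiRatio f l = H) :
    IsRStable n f (catHalf n a) (piece n f (-l) (catHalf n a)) := by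
  have hT := catHalf_pos hn ha
  have hanti := hf.strictAntiOn_jacobiRatio hn ha
  refine isRStable_piece hf hn ha (by linarith [hl.2]) (by linarith [hl.1]) le_rfl
    fun α β hα hαT _ hβT => ?_
  have hsub : Icc α β ⊆ Ioo (-catHalf n a) (catHalf n a) :=
    fun t ht => ⟨hαT.trans_le ht.1, ht.2.trans_lt hβT⟩
  -- β may be negative or zero, where the ratio is not used; enlarging it to a point of (0, T) is
  -- harmless.
  have hb : max β (catHalf n a / 2) ∈ Ioo 0 (catHalf n a) :=
    ⟨lt_max_of_lt_right (by linarith), max_lt hβT (by linarith)⟩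
  set b := max β (catHalf n a / 2)
  have hbH := hf.neg_lt_jacobiRatio hn ha hlt hb
  have key : ∀ c, -jacobiRatio f b < c → c < H →
      ∀ t ∈ Icc α β, 0 < fieldW n a f (shiftH f 0 c) t := by
    intro c hc1 hc2
    refine hf.fieldW_shiftH_pos hn ha hsub (fun t ht h => ?_) fun t ht h => ?_
    · have := hanti.antitoneOn ht hl (by linarith [h.1])
      linarith
    · have := hanti.antitoneOn ht hb (h.2.trans (le_max_left _ _))
      linarith
  -- These two constants divide the admissible interval of c into thirds.
  exact ⟨(2 * H - jacobiRatio f b) / 3, (H - 2 * jacobiRatio f b) / 3, by linarith,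
    key _ (by linarith) (by linarith), key _ (by linarith) (by linarith)⟩

theorem isStableUnstable_of_jacobiRatio (hf : IsFullProfile n a f) (hn : 2 ≤ n) (ha : 0 < a)
    {r s : ℝ} (hr : r ∈ Ioo 0 (catHalf n a)) (hs : s ∈ Ioo 0 (catHalf n a))
    (h : jacobiRatio f s = -jacobiRatio f r) :
    IsStableUnstable n f (catHalf n a) (piece n f (-r) s) := by
  obtain ⟨h0, h1, hpos⟩ := hf.fieldW_shiftH_nodal hn ha zero_le_one hr hs
    (c := jacobiRatio f r) (by ring) (by linarith)
  exact isStableUnstable_piece hf hn ha (by linarith [hr.2]) (by linarith [hr.1, hs.1]) hs.2 h0 h1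
    hpos

theorem one_le_morseIndex (hf : IsFullProfile n a f) (hn : 2 ≤ n) (ha : 0 < a)
    (hH : Filter.Tendsto (scaleH f) (nhdsWithin (catHalf n a) (Iio (catHalf n a))) (nhds H))
    (hH0 : 0 < H) : 1 ≤ morseIndex n f (catHalf n a) := by
  have hT := catHalf_pos hn ha
  set T := catHalf n a with hTdef
  -- κ ≤ 1 preserves the monotonicity of the ratio and makes the form negative, since 2n - 1 ≥ 3.
  -- The bound κT < H keeps the limit of the ratio plus κt negative, so a zero b exists.
  obtain ⟨κ, hκ0, hκ1, hκH⟩ : ∃ κ : ℝ, 0 < κ ∧ κ ≤ 1 ∧ κ * T < H := by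
    refine ⟨min 1 (H / (2 * T)), lt_min one_pos (by positivity), min_le_left _ _, ?_⟩
    refine (mul_le_mul_of_nonneg_right (min_le_right _ _) hT.le).trans_lt ?_
    rw [div_mul_eq_mul_div, div_lt_iff₀ (by positivity)]
    nlinarith [mul_pos hH0 hT]
  obtain ⟨b, hb, hb0⟩ := hf.exists_jacobiRatio_add_eq hn ha hH (κ := κ) (c := 0) (by linarith)
  obtain ⟨h0, h1, hpos⟩ := hf.fieldW_shiftH_nodal hn ha hκ1 hb hb hb0 (by rw [hb0, neg_zero])
  have hα : -T < -b := by linarith [hb.2]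
  have hαβ : -b < b := by linarith [hb.1]
  have hsub : Icc (-b) b ⊆ Ioo (-T) T := fun t ht => ⟨hα.trans_le ht.1, ht.2.trans_lt hb.2⟩
  have hlim := tendsto_jacobiForm_cutoff hf hn ha hα hαβ.le hb.2 h0 h1 hpos
  have hw := hf.contDiffOn_field ha fun t ht => hf.hasDerivAt_shiftH (t := t) κ 0 ht
  have h3 := exponent_pos hn
  have hint : ∫ t in Ioo (-b) b,
      κ * (κ * (1 - 1 / weightW n a f t ^ 2) - (2 * (n : ℝ) - 1)) < 0 := by
    have hc : ContinuousOn (fun t => κ * ((2 * (n : ℝ) - 1) - κ * (1 - 1 / weightW n a f t ^ 2)))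
        (Icc (-b) b) := by
      have h : ContinuousOn (fun t => 1 / weightW n a f t ^ 2) (Icc (-b) b) :=
        continuousOn_const.div ((hf.continuousOn_weightW.mono hsub).pow 2)
          fun t ht => pow_ne_zero 2 (hf.weightW_pos ha (hsub ht)).ne'
      fun_prop
    have := integral_sq_pos hαβ (w := fun _ => 1) continuousOn_const hc (fun _ _ => one_pos)
      fun t ht => by
        have hW := hf.weightW_pos ha (hsub (Ioo_subset_Icc_self ht))
        have h1 : 0 ≤ 1 / weightW n a f t ^ 2 := by positivity
        refine mul_pos hκ0 ?_
        nlinarith [mul_nonneg hκ0.le h1]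
    rw [← neg_pos, ← integral_neg]
    refine this.trans_eq (integral_congr_ae (Filter.Eventually.of_forall fun t => ?_))
    simp only
    ring
  have hneg := mul_neg_of_pos_of_neg (pow_pos ha (2 * n - 1))
    (mul_neg_of_pos_of_neg (sphereArea_pos hn) hint)
  obtain ⟨k, hk⟩ := (hlim.eventually_lt_const hneg).exists
  have hδ : (0 : ℝ) < 1 / ((k : ℝ) + 1) := by positivity
  exact NilCatenoid.one_le_morseIndex hf hn ha (isRelCompactOpen_piece hf hα hb.2)
    (isTestFunction_cutoff hf hw hα hb.2 h0 h1 hδ)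
    ((contDiff_cutoff isOpen_Ioo hw hsub h0 h1 hδ).differentiable (by simp)) hk

end IsProfile

end NilCatenoid

end

theorem theorem3 (n : ℕ) (hn : 2 ≤ n) (a : ℝ) (ha : 0 < a) :
    ∃ T : ℝ, 0 < T ∧
      (∃ f : ℝ → ℝ, NilCatenoid.IsMaximalProfile n a (Set.Ioo (-T) T) f) ∧
      ∀ f : ℝ → ℝ, NilCatenoid.IsMaximalProfile n a (Set.Ioo (-T) T) f →
        -- the half-catenoids are r-stable
        (NilCatenoid.IsRStable n f T (NilCatenoid.piece n f 0 T) ∧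
          NilCatenoid.IsRStable n f T (NilCatenoid.piece n f (-T) 0)) ∧
        -- a symmetric stable-unstable domain, and the index
        ((∃ z : ℝ, 0 < z ∧ z < T ∧
            NilCatenoid.IsStableUnstable n f T (NilCatenoid.piece n f (-z) z)) ∧
          1 ≤ NilCatenoid.morseIndex n f T) ∧
        -- the failure of the Lindelöf property
        ∃ l : ℝ, 0 < l ∧ l < T ∧
          NilCatenoid.IsRStable n f T (NilCatenoid.piece n f (-l) T) ∧
          ∀ r : ℝ, l < r → r < T → ∃ s : ℝ, 0 < s ∧ s < T ∧
            NilCatenoid.IsStableUnstable n f T (NilCatenoid.piece n f (-r) s) := by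
  refine ⟨NilCatenoid.catHalf n a, NilCatenoid.catHalf_pos hn ha,
    ⟨_, NilCatenoid.isMaximalProfile_catProfile hn ha⟩, fun f hmax => ?_⟩
  have hf : NilCatenoid.IsFullProfile n a f := hmax.1
  obtain ⟨H, hH, hlt⟩ := hf.exists_scaleH_tendsto
  have hH0 : 0 < H := by
    have h := hlt 0 hf.zero_mem
    rwa [NilCatenoid.scaleH, intervalIntegral.integral_same] at h
  obtain ⟨z, hz, hz0⟩ := hf.exists_jacobiRatio_eq hn ha hH (c := 0) (by linarith)
  obtain ⟨l, hl, hlH⟩ := hf.exists_jacobiRatio_eq hn ha hH (c := H) (by linarith)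
  have hup := hf.isRStable_upper hn ha hlt hl hlH
  refine ⟨⟨fun Ω hΩ => hup Ω (hΩ.trans (NilCatenoid.piece_mono (by linarith [hl.1]) le_rfl)),
    hf.isRStable_lower hn ha hlt⟩, ⟨⟨z, hz.1, hz.2,
      hf.isStableUnstable_of_jacobiRatio hn ha hz hz (by rw [hz0, neg_zero])⟩,
      hf.one_le_morseIndex hn ha hH hH0⟩, l, hl.1, hl.2, hup, fun r hlr hrT => ?_⟩
  have hr : r ∈ Set.Ioo 0 (NilCatenoid.catHalf n a) := ⟨hl.1.trans hlr, hrT⟩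
  -- Beyond l the ratio is below H, so its negative exceeds -H and is a value of the ratio. This is
  -- the only place where r > l enters apart from r > 0.
  have hrl := hf.strictAntiOn_jacobiRatio hn ha hl hr hlr
  obtain ⟨s, hs, hsr⟩ := hf.exists_jacobiRatio_eq hn ha hH (c := -NilCatenoid.IsProfile.jacobiRatio f r)
    (by linarith)
  exact ⟨s, hs.1, hs.2, hf.isStableUnstable_of_jacobiRatio hn ha hr hs hsr⟩
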